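/- **Setting.** Let $N\ge1$. The general Lie conformal algebra $gc_N$ is the free $\mathbb{C}[\partial]$-module with basis $J^n_{E_{ij}}$ ($n\ge0$, $1\le i,j\le N$); for a matrix $A=(a_{ij})\in gl_N(\mathbb{C})$ put $J^n_A=\sum_{i,j}a_{ij}J^n_{E_{ij}}$. Its $\lambda$-bracket $gc_N\times gc_N\to gc_N[\lambda]$ is the $\mathbb{C}$-bilinear map with $[\partial a_\lambda b]=-\lambda[a_\lambda b]$, $[a_\lambda\partial b]=(\partial+\lambda)[a_\lambda b]$ and $$[J^m_A{}_\lambda J^n_B]=\sum_{s=0}^m\binom ms(\lambda+\partial)^sJ^{m+n-s}_{AB}-\sum_{s=0}^n\binom ns(-\lambda)^sJ^{m+n-s}_{BA}.$$ A module $M$ over $gc_N$ is a $\mathbb{C}[\partial]$-module with a $\mathbb{C}$-bilinear $\lambda$-action $gc_N\times M\to M[\lambda]$, $(a,v)\mapsto a_\lambda v$, such that $a_\lambda(b_\mu v)-b_\mu(a_\lambda v)=[a_\lambda b]_{\lambda+\mu}v$, $(\partial a)_\lambda v=-\lambda\,a_\lambda v$ and $a_\lambda(\partial v)=(\partial+\lambda)(a_\lambda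 v)$. For $a\in\mathbb{C}$, $\mathbb{C}_a$ is the one-dimensional module on which $\partial$ acts as $a$ and $gc_N$ acts as $0$; $\mathbb{C}=\mathbb{C}_0$ is the trivial module. For $\alpha\in\mathbb{C}$, $\mathbb{C}^N_\alpha[\partial]$ is the free $\mathbb{C}[\partial]$-module $\mathbb{C}^N[\partial]$ with the $\lambda$-action determined by $J^m_A{}_\lambda v=(\partial+\lambda+\alpha)^mAv$ for $v\in\mathbb{C}^N$. For $q\ge0$, $\widetilde C^q(gc_N,M)$ is the space of $\mathbb{C}$-linear maps $\gamma:gc_N^{\otimes q}\to M[\lambda_1,\dots,\lambda_q]$, written $\gamma_{\lambda_1,\dots,\lambda_q}(a_1,\dots,a_q)$, which satisfy $\gamma_{\lambda_1,\dots,\lambda_q}(\dots,\partial a_i,\dots)=-\lambda_i\gamma_{\lambda_1,\dots,\lambda_q}(\dots,a_i,\dots)$ for all $i$ and change sign under the simultaneous exchange of $a_i,a_{i+1}$ and $\lambda_i,\lambda_{i+1}$; in particular $\widetilde C^0(gc_N,M)=M$. The differential is $$(d\gamma)_{\lambda_1,\dots,\lambda_{q+1}}(a_1,\dots,a_{q+1})=\sum_{i}(-1)^{i+1}a_i{}_{\lambda_i}\gamma_{\dots,\hat\lambda_i,\dots}(\dots,\hat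 a_i,\dots)+\sum_{i<j}(-1)^{i+j}\gamma_{\lambda_i+\lambda_j,\dots,\hat\lambda_i,\dots,\hat\lambda_j,\dots}([a_i{}_{\lambda_i}a_j],\dots,\hat a_i,\dots,\hat a_j,\dots),$$ and $\partial$ acts on $\widetilde C^q(gc_N,M)$ as multiplication by $\partial_M+\lambda_1+\dots+\lambda_q$, where $\partial_M$ is the action of $\partial$ on $M$. The basic cohomology $\widetilde H^q(gc_N,M)$ is the cohomology of $(\widetilde C^*,d)$, and the reduced cohomology $H^q(gc_N,M)$ is the cohomology of the quotient complex $\widetilde C^*/\partial\widetilde C^*$. **Theorem.** (1) $\dim\widetilde H^q(gc_1,\mathbb{C})$ is $1$ for $q=0,3$ and $0$ for $q=1,2$. $\dim H^q(gc_1,\mathbb{C})$ is $1$ for $q=0,2,3$ and $0$ for $q=1$. (2) For every $N\ge1$, $\dim\widetilde H^q(gc_N,\mathbb{C})$ is $1$ for $q=0$ and $0$ for $q=1,2$, and $\dim H^q(gc_N,\mathbb{C})$ is $1$ for $q=0,2$ and $0$ for $q=1$. Moreover, $H^2(gc_N,\mathbb{C})$ is spanned by the class of a reduced $2$-cocycle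 that is represented by a cochain $\psi\in\widetilde C^2(gc_N,\mathbb{C})$ with $$\psi_{\lambda,-\lambda}(J^m_A,J^n_B)=(-1)^n\frac{m!\,n!}{(m+n+1)!}\,\mathrm{tr}(AB)\,\lambda^{m+n+1}\qquad(m,n\ge0,\ A,B\in gl_N(\mathbb{C})).$$ (3) For every $N\ge1$ and $a\in\mathbb{C}$ with $a\ne0$, $H^q(gc_N,\mathbb{C}_a)=0$ for all $q\ge0$. (4) For every $N\ge1$ and $\alpha\in\mathbb{C}$, $H^q(gc_N,\mathbb{C}^N_\alpha[\partial])=0$ for all $q\ge0$. More generally, let $M$ be any $gc_N$-module that is free over $\mathbb{C}[\partial]$ and for which there is a nonzero $c\in\mathbb{C}$ with $J^0_I{}_\lambda v|_{\lambda=0}=cv$ for all $v\in M$, where $I$ is the $N\times N$ identity matrix. Then $H^q(gc_N,M)=0$ for all $q\ge0$. -/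

import Mathlib

open Polynomial

noncomputable section

namespace ConfCoh

/-! ## The general Lie conformal algebra `gc_N`

Indeterminates `λ, λ₁, …, λ_q` are handled through their values: as `ℂ` is infinite, an element of
`V[λ₁, …, λ_q]` is the same thing as a `V`-valued polynomial function on `ℂ^q`, and an identity
between polynomials is the same thing as the identity between their values at all complex points.
The variable of `ℂ[X]` plays the role of `∂`. -/

/-- The free `ℂ[∂]`-module with basis `J^n_{E_{ij}}`, where `n ∈ ℕ` and `1 ≤ i, j ≤ N`. -/
abbrev gc (N : ℕ) : Type := (ℕ × Fin N × Fin N) →₀ ℂ[X]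

/-- The element `J^n_A` of `gc_N`, linear in the matrix `A`. -/
def J {N : ℕ} (n : ℕ) (A : Matrix (Fin N) (Fin N) ℂ) : gc N :=
  ∑ i, ∑ j, Finsupp.single (n, i, j) (C (A i j))

/-- The `λ`-bracket of two generators, at `λ = z`:
`∑ₛ (m choose s) (λ + ∂)^s J^{m+n-s}_{AB} - ∑ₛ (n choose s) (-λ)^s J^{m+n-s}_{BA}`. -/
def genBracket {N : ℕ} (z : ℂ) (m : ℕ) (A : Matrix (Fin N) (Fin N) ℂ)
    (n : ℕ) (B : Matrix (Fin N) (Fin N) ℂ) : gc N :=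
  ∑ s ∈ Finset.range (m + 1),
      ((m.choose s : ℂ[X]) * (C z + X) ^ s) • J (m + n - s) (A * B)
    - ∑ s ∈ Finset.range (n + 1), ((n.choose s : ℂ) * (-z) ^ s) • J (m + n - s) (B * A)

/-- The `λ`-bracket `[a_λ b]` of `gc_N` at `λ = z`: the bilinear extension of the bracket of the
generators by `[p(∂)a_λ r(∂)b] = p(-λ) r(∂ + λ) [a_λ b]`. -/
def bracket {N : ℕ} (z : ℂ) (a b : gc N) : gc N :=
  a.sum fun k p => b.sum fun l r =>
    p.eval (-z) • r.comp (X + C z) •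
      genBracket z k.1 (Matrix.single k.2.1 k.2.2 1) l.1 (Matrix.single l.2.1 l.2.2 1)

/-! ## Modules -/

/-- A (conformal) module over `gc_N` on the complex vector space `M`: the action `D` of `∂`, and a
bilinear `λ`-action `a_λ v ∈ M[λ]`, of which `act z a v` is the value at `λ = z`. -/
structure ConfModule (N : ℕ) (M : Type*) [AddCommGroup M] [Module ℂ M] where
  D : M →ₗ[ℂ] M
  act : ℂ → gc N →ₗ[ℂ] M →ₗ[ℂ] M
  act_poly : ∀ (a : gc N) (v : M), ∃ (n : ℕ) (c : ℕ → M),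
    ∀ z : ℂ, act z a v = ∑ k ∈ Finset.range n, z ^ k • c k
  act_bracket : ∀ (z w : ℂ) (a b : gc N) (v : M),
    act z a (act w b v) - act w b (act z a v) = act (z + w) (bracket z a b) v
  act_D_left : ∀ (z : ℂ) (a : gc N) (v : M), act z ((X : ℂ[X]) • a) v = -(z • act z a v)
  act_D_right : ∀ (z : ℂ) (a : gc N) (v : M), act z a (D v) = D (act z a v) + z • act z a v

/-- The one-dimensional module `ℂ_a`: `∂` acts as `a`, and `gc_N` acts as zero. For `a = 0` this is
the trivial module `ℂ`. -/
def scalarModule (N : ℕ) (a : ℂ) : ConfModule N ℂ where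
  D := a • LinearMap.id
  act _ := 0
  act_poly _ _ := ⟨0, 0, by simp⟩
  act_bracket := by simp
  act_D_left := by simp
  act_D_right := by simp

/-- The `λ`-action at `λ = z` on `ℂ^N[∂]` determined by `J^m_A _λ v = (∂ + λ + α)^m A v` for
`v ∈ ℂ^N`, and by `(p(∂)a)_λ (r(∂)v) = p(-λ) r(∂ + λ) (a_λ v)`. -/
def natAct {N : ℕ} (α z : ℂ) (a : gc N) (v : Fin N → ℂ[X]) : Fin N → ℂ[X] :=
  a.sum fun k p => p.eval (-z) • (X + C z + C α) ^ k.1 •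
    Pi.single k.2.1 ((v k.2.2).comp (X + C z))

section NaturalModule

variable {N : ℕ} (α z : ℂ)

theorem natAct_add_left (a b : gc N) (v : Fin N → ℂ[X]) :
    natAct α z (a + b) v = natAct α z a v + natAct α z b v := by
  unfold natAct
  exact Finsupp.sum_add_index' (by simp) (by intros; simp [add_smul])

theorem natAct_zero_left (v : Fin N → ℂ[X]) : natAct α z (0 : gc N) v = 0 := by
  simp [natAct]

theorem natAct_single (k : ℕ × Fin N × Fin N) (p : ℂ[X]) (v : Fin N → ℂ[X]) :
    natAct α z (Finsupp.single k p) v = p.eval (-z) • (X + C z + C α) ^ k.1 •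
      Pi.single k.2.1 ((v k.2.2).comp (X + C z)) := by
  unfold natAct
  exact Finsupp.sum_single_index (by simp)

theorem natAct_smul_left (q : ℂ[X]) (a : gc N) (v : Fin N → ℂ[X]) :
    natAct α z (q • a) v = q.eval (-z) • natAct α z a v := by
  induction a using Finsupp.induction_linear with
  | zero => simp [natAct]
  | add f g hf hg => rw [smul_add, natAct_add_left, hf, hg, natAct_add_left, smul_add]
  | single k p =>
    rw [Finsupp.smul_single, natAct_single, natAct_single]
    simp [mul_smul]

theorem natAct_csmul_left (c : ℂ) (a : gc N) (v : Fin N → ℂ[X]) :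
    natAct α z (c • a) v = c • natAct α z a v := by
  have h : c • a = (C c : ℂ[X]) • a := by
    ext k n
    simp
  rw [h, natAct_smul_left, eval_C]

theorem natAct_add_right (a : gc N) (v w : Fin N → ℂ[X]) :
    natAct α z a (v + w) = natAct α z a v + natAct α z a w := by
  unfold natAct
  rw [← Finsupp.sum_add]
  refine Finsupp.sum_congr fun k _ => ?_
  simp [Pi.single_add]

theorem natAct_smul_right (q : ℂ[X]) (a : gc N) (v : Fin N → ℂ[X]) :
    natAct α z a (q • v) = q.comp (X + C z) • natAct α z a v := by
  unfold natAct
  rw [Finsupp.smul_sum]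
  refine Finsupp.sum_congr fun k _ => ?_
  ext i : 1
  by_cases h : i = k.2.1
  · subst h
    simp [smul_eq_C_mul]
    ring
  · simp [Pi.single_eq_of_ne h]

theorem natAct_csmul_right (c : ℂ) (a : gc N) (v : Fin N → ℂ[X]) :
    natAct α z a (c • v) = c • natAct α z a v := by
  have h : ∀ u : Fin N → ℂ[X], c • u = (C c : ℂ[X]) • u := by
    intro u
    ext i : 1
    simp [smul_eq_C_mul]
  rw [h, h, natAct_smul_right, C_comp]

theorem natAct_J (n : ℕ) (A : Matrix (Fin N) (Fin N) ℂ) (v : Fin N → ℂ[X]) :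
    natAct α z (J n A) v =
      (X + C z + C α) ^ n • (A.map C).mulVec (fun j => (v j).comp (X + C z)) := by
  have hs : ∀ (s : Finset (Fin N)) (f : Fin N → gc N),
      natAct α z (∑ i ∈ s, f i) v = ∑ i ∈ s, natAct α z (f i) v := by
    intro s f
    induction s using Finset.cons_induction with
    | empty => simp [natAct_zero_left]
    | cons i s hi ih => rw [Finset.sum_cons, Finset.sum_cons, natAct_add_left, ih]
  unfold J
  simp only [hs, natAct_single]
  ext l : 1
  simp only [Finset.sum_apply, Pi.smul_apply, Matrix.mulVec, dotProduct, Matrix.map_apply, eval_C,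
    smul_eq_mul, Finset.mul_sum]
  rw [Finset.sum_eq_single l]
  · refine Finset.sum_congr rfl fun j _ => ?_
    simp [smul_eq_C_mul]
    ring
  · intro i _ hi
    refine Finset.sum_eq_zero fun j _ => ?_
    simp [Pi.single_eq_of_ne (Ne.symm hi)]
  · simp

theorem natAct_sum (s : Finset ℕ) (f : ℕ → gc N) (v : Fin N → ℂ[X]) :
    natAct α z (∑ i ∈ s, f i) v = ∑ i ∈ s, natAct α z (f i) v := by
  induction s using Finset.cons_induction with
  | empty => simp [natAct_zero_left]
  | cons i s hi ih => rw [Finset.sum_cons, Finset.sum_cons, natAct_add_left, ih]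

theorem binom_aux (m n : ℕ) (Y W : ℂ[X]) :
    ∑ s ∈ Finset.range (m + 1), (m.choose s : ℂ[X]) * W ^ s * Y ^ (m + n - s)
      = Y ^ n * (W + Y) ^ m := by
  rw [add_pow, Finset.mul_sum]
  refine Finset.sum_congr rfl fun s hs => ?_
  have : m + n - s = n + (m - s) := by
    have := Finset.mem_range.1 hs
    omega
  rw [this, pow_add]
  ring

theorem natAct_genBracket (w : ℂ) (m : ℕ) (A : Matrix (Fin N) (Fin N) ℂ) (n : ℕ)
    (B : Matrix (Fin N) (Fin N) ℂ) (v : Fin N → ℂ[X]) :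
    natAct α (z + w) (genBracket z m A n B) v =
      natAct α z (J m A) (natAct α w (J n B) v) - natAct α w (J n B) (natAct α z (J m A) v) := by
  have hsub : ∀ a b : gc N,
      natAct α (z + w) (a - b) v = natAct α (z + w) a v - natAct α (z + w) b v := by
    intro a b
    rw [sub_eq_add_neg, natAct_add_left, ← neg_one_smul ℂ b, natAct_csmul_left, neg_one_smul,
      sub_eq_add_neg]
  have hmul : ∀ (A B : Matrix (Fin N) (Fin N) ℂ) (u : Fin N → ℂ[X]),
      ((A * B).map C).mulVec u = (A.map C).mulVec ((B.map C).mulVec u) := by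
    intro A B u
    rw [Matrix.mulVec_mulVec, Matrix.map_mul]
  have hcomp : ∀ (x y : ℂ) (B : Matrix (Fin N) (Fin N) ℂ) (u : Fin N → ℂ[X]),
      (fun j => ((B.map C).mulVec (fun j => (u j).comp (X + C x)) j).comp (X + C y))
        = (B.map C).mulVec (fun j => (u j).comp (X + C (y + x))) := by
    intro x y B u
    ext j : 1
    simp only [Matrix.mulVec, dotProduct, Matrix.map_apply, Polynomial.sum_comp, mul_comp, C_comp,
      comp_assoc, add_comp, X_comp, C_add, add_assoc]
  have hact : ∀ (x y : ℂ) (m n : ℕ) (A B : Matrix (Fin N) (Fin N) ℂ),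
      natAct α x (J m A) (natAct α y (J n B) v) =
        ((X + C x + C α) ^ m * (X + C (x + y) + C α) ^ n) •
          ((A * B).map C).mulVec (fun j => (v j).comp (X + C (x + y))) := by
    intro x y m n A B
    rw [natAct_J α y, natAct_smul_right, natAct_J, hmul, hcomp, smul_smul]
    congr 1
    simp
    ring
  rw [hact z w, hact w z, genBracket, hsub, natAct_sum, natAct_sum]
  congr 1
  · have h1 : ∀ s ∈ Finset.range (m + 1), natAct α (z + w)
        (((m.choose s : ℂ[X]) * (C z + X) ^ s) • J (m + n - s) (A * B)) v =
        ((m.choose s : ℂ[X]) * (C (-w)) ^ s * (X + C (z + w) + C α) ^ (m + n - s)) •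
          ((A * B).map C).mulVec (fun j => (v j).comp (X + C (z + w))) := by
      intro s _
      rw [natAct_smul_left, natAct_J, ← smul_assoc]
      congr 1
      rw [smul_eq_C_mul]
      congr 1
      simp
    rw [Finset.sum_congr rfl h1, ← Finset.sum_smul, binom_aux]
    congr 1
    simp
    ring
  · have h1 : ∀ s ∈ Finset.range (n + 1), natAct α (z + w)
        (((n.choose s : ℂ) * (-z) ^ s) • J (m + n - s) (B * A)) v =
        ((n.choose s : ℂ[X]) * (C (-z)) ^ s * (X + C (z + w) + C α) ^ (n + m - s)) •
          ((B * A).map C).mulVec (fun j => (v j).comp (X + C (z + w))) := by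
      intro s _
      rw [natAct_csmul_left, natAct_J, ← smul_assoc, add_comm n m]
      congr 1
      rw [smul_eq_C_mul]
      congr 1
      simp
    rw [Finset.sum_congr rfl h1, ← Finset.sum_smul, binom_aux, add_comm w z]
    congr 1
    simp
    ring

theorem bracket_add_left (a b c : gc N) : bracket z (a + b) c = bracket z a c + bracket z b c := by
  unfold bracket
  refine Finsupp.sum_add_index' (by simp) ?_
  intro k p q
  rw [← Finsupp.sum_add]
  exact Finsupp.sum_congr fun l _ => by simp [add_smul]

theorem bracket_add_right (a b c : gc N) :
    bracket z a (b + c) = bracket z a b + bracket z a c := by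
  unfold bracket
  rw [← Finsupp.sum_add]
  refine Finsupp.sum_congr fun k _ => ?_
  exact Finsupp.sum_add_index' (by simp) (by intros; simp [add_smul])

theorem bracket_single (k l : ℕ × Fin N × Fin N) (p r : ℂ[X]) :
    bracket z (Finsupp.single k p) (Finsupp.single l r) =
      p.eval (-z) • r.comp (X + C z) •
        genBracket z k.1 (Matrix.single k.2.1 k.2.2 1) l.1 (Matrix.single l.2.1 l.2.2 1) := by
  unfold bracket
  rw [Finsupp.sum_single_index (by simp), Finsupp.sum_single_index (by simp)]

theorem single_eq_smul_J (k : ℕ × Fin N × Fin N) (p : ℂ[X]) :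
    (Finsupp.single k p : gc N) = p • J k.1 (Matrix.single k.2.1 k.2.2 1) := by
  unfold J
  rw [Finset.sum_eq_single k.2.1, Finset.sum_eq_single k.2.2]
  · simp
  · intro j _ hj
    simp [Ne.symm hj]
  · simp
  · intro i _ hi
    refine Finset.sum_eq_zero fun j _ => ?_
    simp [Ne.symm hi]
  · simp

theorem natAct_bracket (w : ℂ) (a b : gc N) (v : Fin N → ℂ[X]) :
    natAct α z a (natAct α w b v) - natAct α w b (natAct α z a v) =
      natAct α (z + w) (bracket z a b) v := by
  induction a using Finsupp.induction_linear with
  | zero =>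
    have h := natAct_csmul_right α w 0 b 0
    simp only [zero_smul] at h
    simp [natAct_zero_left, bracket, h]
  | add f g hf hg =>
    rw [bracket_add_left, natAct_add_left, natAct_add_left, natAct_add_left, natAct_add_right,
      ← hf, ← hg]
    abel
  | single k p =>
    induction b using Finsupp.induction_linear with
    | zero =>
      have h := natAct_csmul_right α z 0 (Finsupp.single k p) 0
      simp only [zero_smul] at h
      simp [natAct_zero_left, bracket, h]
    | add f g hf hg =>
      rw [bracket_add_right, natAct_add_left, natAct_add_left, natAct_add_left, natAct_add_right,
        ← hf, ← hg]
      abel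
    | single l r =>
      rw [bracket_single, natAct_csmul_left, natAct_smul_left, natAct_genBracket,
        single_eq_smul_J k, single_eq_smul_J l]
      simp only [natAct_smul_left, natAct_csmul_right]
      have : (r.comp (X + C z)).eval (-(z + w)) = r.eval (-w) := by
        simp [eval_comp]
      rw [this, smul_sub, smul_sub, smul_comm (r.eval (-w)) (p.eval (-z))]

theorem natAct_poly (a : gc N) (v : Fin N → ℂ[X]) :
    ∃ (n : ℕ) (c : ℕ → (Fin N → ℂ[X])),
      ∀ z : ℂ, natAct α z a v = ∑ k ∈ Finset.range n, z ^ k • c k := by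
  induction a using Finsupp.induction_linear with
  | zero => exact ⟨0, 0, by simp [natAct]⟩
  | add f g hf hg =>
    obtain ⟨n, c, hc⟩ := hf
    obtain ⟨m, e, he⟩ := hg
    refine ⟨n + m, fun k => (if k < n then c k else 0) + (if k < m then e k else 0), fun z => ?_⟩
    have aux : ∀ (n m : ℕ) (h : n ≤ m) (c : ℕ → (Fin N → ℂ[X])),
        ∑ k ∈ Finset.range n, z ^ k • c k
          = ∑ k ∈ Finset.range m, z ^ k • (if k < n then c k else 0) := by
      intro n m h c
      refine Finset.sum_subset_zero_on_sdiff (Finset.range_mono h) ?_ ?_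
      · intro k hk
        simp only [Finset.mem_sdiff, Finset.mem_range] at hk
        simp [hk.2]
      · intro k hk
        simp [Finset.mem_range.1 hk]
    rw [natAct_add_left, hc, he, aux n (n + m) (by omega) c, aux m (n + m) (by omega) e,
      ← Finset.sum_add_distrib]
    exact Finset.sum_congr rfl fun k _ => (smul_add _ _ _).symm
  | single k p =>
    let G : ℂ[X][X] := (p.map C).comp (-X) * ((X + C X + C (C α)) ^ k.1 *
      ((v k.2.2).map C).comp (C X + X))
    refine ⟨G.natDegree + 1, fun j => Pi.single k.2.1 (G.coeff j), fun z => ?_⟩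
    have hG : G.eval (C z) = C (p.eval (-z)) * ((X + C z + C α) ^ k.1 *
        (v k.2.2).comp (X + C z)) := by
      simp only [G, eval_mul, eval_comp, eval_neg, eval_X, eval_pow, eval_add, eval_C]
      congr 1
      · rw [← C_neg, eval_map, eval₂_at_apply]
      · rw [eval_map, comp, add_comm (C z) X]
    rw [natAct_single]
    ext i : 1
    by_cases h : i = k.2.1
    · subst h
      rw [eval_eq_sum_range] at hG
      simp only [Pi.smul_apply, Pi.single_eq_same, Finset.sum_apply, smul_eq_C_mul, smul_eq_mul]
      rw [← hG]
      exact Finset.sum_congr rfl fun j _ => by rw [C_pow, mul_comm]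
    · simp [Pi.single_eq_of_ne h]

end NaturalModule

/-- The `gc_N`-module `ℂ^N_α[∂]`, with underlying `ℂ[∂]`-module `ℂ^N[∂]`. For `α = 0` this is the
natural module of `gc_N`. -/
def natModule (N : ℕ) (α : ℂ) : ConfModule N (Fin N → ℂ[X]) where
  D := (LinearMap.lsmul ℂ[X] (Fin N → ℂ[X]) X).restrictScalars ℂ
  act z := LinearMap.mk₂ ℂ (natAct α z) (natAct_add_left α z) (natAct_csmul_left α z)
    (natAct_add_right α z) (natAct_csmul_right α z)
  act_poly := natAct_poly α
  act_bracket z w a b v := natAct_bracket α z w a b v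
  act_D_left z a v := by
    simp [natAct_smul_left]
  act_D_right z a v := by
    simp only [LinearMap.mk₂_apply, LinearMap.coe_restrictScalars, LinearMap.lsmul_apply]
    rw [natAct_smul_right, X_comp, add_smul]
    congr 1
    ext i : 1
    simp [smul_eq_C_mul]

/-! ## Cohomology -/

section Cohomology

variable {N : ℕ} {M : Type*} [AddCommGroup M] [Module ℂ M]

/-- Arbitrary functions `(a₁, …, a_q), (λ₁, …, λ_q) ↦ γ_{λ₁, …, λ_q}(a₁, …, a_q) ∈ M`. -/
abbrev PreCochain (N : ℕ) (M : Type*) (q : ℕ) : Type _ :=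
  (Fin q → gc N) → (Fin q → ℂ) → M

namespace ConfModule

/-- The space of (basic) `q`-cochains of `gc_N` with coefficients in `M`: the maps that are
`ℂ`-multilinear in `a₁, …, a_q`, polynomial in `λ₁, …, λ_q`, conformally antilinear, and
skew-symmetric under the simultaneous exchange of two neighbouring `aᵢ` and `λᵢ`. -/
def cochains (_ρ : ConfModule N M) (q : ℕ) : Submodule ℂ (PreCochain N M q) where
  carrier := {γ |
    (∀ z : Fin q → ℂ, ∃ f : MultilinearMap ℂ (fun _ : Fin q => gc N) M, ∀ a, γ a z = f a) ∧
    (∀ a : Fin q → gc N, ∃ c : (Fin q →₀ ℕ) →₀ M,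
      ∀ z : Fin q → ℂ, γ a z = c.sum fun k v => (∏ i, z i ^ k i) • v) ∧
    (∀ (a : Fin q → gc N) (z : Fin q → ℂ) (i : Fin q),
      γ (Function.update a i ((X : ℂ[X]) • a i)) z = -(z i • γ a z)) ∧
    (∀ (a : Fin q → gc N) (z : Fin q → ℂ) (i j : Fin q), (i : ℕ) + 1 = j →
      γ (a ∘ Equiv.swap i j) (z ∘ Equiv.swap i j) = -γ a z)}
  zero_mem' := ⟨fun _ => ⟨0, by simp⟩, fun _ => ⟨0, by simp⟩, by simp, by simp⟩
  add_mem' := by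
    rintro γ δ ⟨h1, h2, h3, h4⟩ ⟨g1, g2, g3, g4⟩
    refine ⟨fun z => ?_, fun a => ?_, fun a z i => ?_, fun a z i j hij => ?_⟩
    · obtain ⟨f, hf⟩ := h1 z
      obtain ⟨g, hg⟩ := g1 z
      exact ⟨f + g, fun a => by simp [hf, hg]⟩
    · obtain ⟨c, hc⟩ := h2 a
      obtain ⟨e, he⟩ := g2 a
      refine ⟨c + e, fun z => ?_⟩
      rw [Finsupp.sum_add_index' (by simp) (by simp), ← hc, ← he]
      rfl
    · simp only [Pi.add_apply, h3, g3, smul_add, neg_add]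
    · simp only [Pi.add_apply, h4 a z i j hij, g4 a z i j hij, neg_add]
  smul_mem' := by
    rintro t γ ⟨h1, h2, h3, h4⟩
    refine ⟨fun z => ?_, fun a => ?_, fun a z i => ?_, fun a z i j hij => ?_⟩
    · obtain ⟨f, hf⟩ := h1 z
      exact ⟨t • f, fun a => by simp [hf]⟩
    · obtain ⟨c, hc⟩ := h2 a
      refine ⟨t • c, fun z => ?_⟩
      rw [Finsupp.sum_smul_index' (by simp), Pi.smul_apply, Pi.smul_apply, hc, Finsupp.smul_sum]
      exact Finsupp.sum_congr fun k _ => smul_comm _ _ _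
    · simp only [Pi.smul_apply, h3, smul_neg, smul_comm t]
    · simp only [Pi.smul_apply, h4 a z i j hij, smul_neg]

/-- The differential:
`(dγ)_λ(a) = ∑ᵢ (-1)^{i+1} aᵢ_{λᵢ} γ_{…λ̂ᵢ…}(…âᵢ…)
  + ∑_{i<j} (-1)^{i+j} γ_{λᵢ+λⱼ, …λ̂ᵢ…λ̂ⱼ…}([aᵢ_{λᵢ} aⱼ], …âᵢ…âⱼ…)` (with indices from `1`);
for `q = 0` the second sum is empty. -/
def d (ρ : ConfModule N M) : (q : ℕ) → PreCochain N M q →ₗ[ℂ] PreCochain N M (q + 1)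
  | 0 =>
    { toFun := fun γ a z => ρ.act (z 0) (a 0) (γ (Fin.removeNth 0 a) (Fin.removeNth 0 z))
      map_add' := fun γ δ => by
        funext a z
        simp
      map_smul' := fun t γ => by
        funext a z
        simp }
  | q + 1 =>
    { toFun := fun γ a z =>
        ∑ i : Fin (q + 2), (-1 : ℂ) ^ (i : ℕ) •
            ρ.act (z i) (a i) (γ (i.removeNth a) (i.removeNth z))
        + ∑ j : Fin (q + 2), ∑ i : Fin (q + 1),
            if i.castSucc < j then
              (-1 : ℂ) ^ ((i : ℕ) + (j : ℕ)) •
                γ (Fin.cons (bracket (z i.castSucc) (a i.castSucc) (a j))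
                    (i.removeNth (j.removeNth a)))
                  (Fin.cons (z i.castSucc + z j) (i.removeNth (j.removeNth z)))
            else 0
      map_add' := fun γ δ => by
        funext a z
        simp only [Pi.add_apply, map_add, smul_add, Finset.sum_add_distrib, Finset.sum_ite,
          Finset.sum_const_zero, add_zero]
        abel
      map_smul' := fun t γ => by
        funext a z
        simp only [Pi.smul_apply, map_smul, RingHom.id_apply, smul_add, Finset.smul_sum,
          smul_ite, smul_zero, smul_comm t] }

/-- The action of `∂` on cochains: `(∂γ)_λ(a) = (∂_M + λ₁ + ⋯ + λ_q) γ_λ(a)`. -/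
def del (ρ : ConfModule N M) (q : ℕ) : PreCochain N M q →ₗ[ℂ] PreCochain N M q where
  toFun γ a z := ρ.D (γ a z) + (∑ i, z i) • γ a z
  map_add' γ δ := by
    funext a z
    simp only [Pi.add_apply, map_add, smul_add]
    abel
  map_smul' t γ := by
    funext a z
    simp only [Pi.smul_apply, map_smul, RingHom.id_apply, smul_add, smul_comm t]

/-- Basic cocycles. -/
def basicZ (ρ : ConfModule N M) (q : ℕ) : Submodule ℂ (PreCochain N M q) :=
  ρ.cochains q ⊓ LinearMap.ker (ρ.d q)

/-- Basic coboundaries. -/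
def basicB (ρ : ConfModule N M) : (q : ℕ) → Submodule ℂ (PreCochain N M q)
  | 0 => ⊥
  | q + 1 => (ρ.cochains q).map (ρ.d q)

/-- The basic cohomology `H̃^q(gc_N, M)`. -/
abbrev BasicH (ρ : ConfModule N M) (q : ℕ) : Type _ :=
  ρ.basicZ q ⧸ (ρ.basicB q).submoduleOf (ρ.basicZ q)

/-- The subspace `∂C̃^q` of the basic cochains. -/
def delCochains (ρ : ConfModule N M) (q : ℕ) : Submodule ℂ (PreCochain N M q) :=
  (ρ.cochains q).map (ρ.del q)

/-- The basic cochains that represent a cocycle of the reduced complex `C̃^*/∂C̃^*`. -/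
def redZ (ρ : ConfModule N M) (q : ℕ) : Submodule ℂ (PreCochain N M q) :=
  ρ.cochains q ⊓ (ρ.delCochains (q + 1)).comap (ρ.d q)

/-- The basic cochains that represent a coboundary of the reduced complex `C̃^*/∂C̃^*`. -/
def redB (ρ : ConfModule N M) (q : ℕ) : Submodule ℂ (PreCochain N M q) :=
  ρ.basicB q ⊔ ρ.delCochains q

/-- The (reduced) cohomology `H^q(gc_N, M)`: the cohomology of the complex `C̃^*/∂C̃^*`. -/
abbrev RedH (ρ : ConfModule N M) (q : ℕ) : Type _ :=
  ρ.redZ q ⧸ (ρ.redB q).submoduleOf (ρ.redZ q)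

end ConfModule

end Cohomology

end ConfCoh

end

/-! Contraction ι with x at λ = μ satisfies Cartan's formula dι + ιd = L, where L is the action of x
at λ = μ on cochains. At λ = 0 the element J^0_I acts on gc_N as 0 and J^1_I acts as ∂. Hence J^0_I
acts on cochains with values in M as the scalar c of part (4), and J^1_I acts on cochains with
values in ℂ_a as ∂ - a. Either way a nonzero constant is null-homotopic modulo ∂, which gives (3)
and (4) (`subsingleton_redH`).

For trivial coefficients J^1_I makes ∂ itself null-homotopic on the basic complex. The μ-derivative
at 0 of Cartan's formula for J^0_I does the same for -D, where D (`lowerD`) is induced by J^n_A ↦ n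
J^{n-1}_A. In positive degree ∂ is injective, and D is injective modulo ∂
(`exists_del_eq_of_lowerD_eq`). This allows a descent. For a basic cocycle γ let β and η be its
contractions at λ = 0 with J^1_I and J^0_I. Then dβ = ∂γ, dη = 0, and Dβ + η is exact modulo ∂
(`lowerD_contr_J_one`). If some x with dx = ∂w makes D(β + x) divisible by ∂, then β + x = ∂ε and γ
= dε - w (`exists_eq_d_sub`). So degree q is governed by degree q - 1, through η, and by an
obstruction among the (q-2)-cochains modulo the images of ∂ and D.

In degree 1 the differential is injective, and in degree 2 there is no obstruction. In degree 3 the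
obstruction is a multiple of the trace form τ, and it does occur: there are α and e with Dψ + dτ =
∂α, ∂e = dψ, De = dα, de = 0. The cocycle e is not exact, since exactness would give N = τ(J^0_I) =
0. In degree 4, for N = 1, the obstruction is a 2-cochain δ, read as the functional x^m y^n ↦ δ(J^m,
J^n). On λ₁ + λ₂ = 0 its class modulo ∂ and D is its restriction to polynomials in x - y. Testing dδ
on translation-invariant polynomials in three variables leaves only ψ and α, and both can be
absorbed by means of e, so every basic 4-cocycle is exact.

The reduced cohomology follows from the connecting map γ ↦ δ, dγ = ∂δ: ψ maps to e, which gives H^2,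
and for N = 1 the class of e gives H^3. -/

noncomputable section

namespace ConfCoh

/-! ### Contractions, Lie derivatives and Cartan's formula -/

section Contraction

variable {N : ℕ} {M : Type*} [AddCommGroup M] [Module ℂ M]

/-- Skew-symmetry under the simultaneous exchange of neighbouring arguments and indeterminates. -/
def IsSkew {q : ℕ} (γ : PreCochain N M q) : Prop :=
  ∀ (a : Fin q → gc N) (z : Fin q → ℂ) (i j : Fin q), (i : ℕ) + 1 = j →
    γ (a ∘ Equiv.swap i j) (z ∘ Equiv.swap i j) = -γ a z

/-- Contraction with the element `x` at `λ = μ`, inserted in front. -/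
def contr (x : gc N) (μ : ℂ) (q : ℕ) : PreCochain N M (q + 1) →ₗ[ℂ] PreCochain N M q where
  toFun γ a z := γ (Fin.cons x a) (Fin.cons μ z)
  map_add' _ _ := rfl
  map_smul' _ _ := rfl

@[simp] theorem contr_apply (x : gc N) (μ : ℂ) (q : ℕ) (γ : PreCochain N M (q + 1))
    (a : Fin q → gc N) (z : Fin q → ℂ) :
    contr x μ q γ a z = γ (Fin.cons x a) (Fin.cons μ z) := rfl

theorem cons_comp_swap {α : Type*} {q : ℕ} (x : α) (a : Fin q → α) (i j : Fin q) :
    (Fin.cons x a : Fin (q + 1) → α) ∘ Equiv.swap i.succ j.succ =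
      Fin.cons x (a ∘ Equiv.swap i j) := by
  funext k
  refine Fin.cases ?_ (fun k => ?_) k
  · have : Equiv.swap i.succ j.succ (0 : Fin (q + 1)) = 0 :=
      Equiv.swap_apply_of_ne_of_ne (Fin.succ_ne_zero _).symm (Fin.succ_ne_zero _).symm
    simp [this]
  · have : Equiv.swap i.succ j.succ k.succ = (Equiv.swap i j k).succ :=
      ((Fin.succ_injective q).swap_apply i j k)
    simp [this]

theorem cons_cons_comp_swap {α : Type*} {q : ℕ} (x y : α) (a : Fin q → α) :
    (Fin.cons x (Fin.cons y a : Fin (q + 1) → α) : Fin (q + 2) → α) ∘ Equiv.swap 0 1 =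
      Fin.cons y (Fin.cons x a : Fin (q + 1) → α) := by
  funext k
  refine Fin.cases ?_ (fun k => ?_) k
  · simp
  · refine Fin.cases ?_ (fun k => ?_) k
    · simp
    · have : Equiv.swap (0 : Fin (q + 2)) 1 k.succ.succ = k.succ.succ :=
        Equiv.swap_apply_of_ne_of_ne (Fin.succ_ne_zero _)
          (fun h => Fin.succ_ne_zero k (Fin.succ_injective _ h))
      simp [this]

theorem IsSkew.cons_cons {q : ℕ} {γ : PreCochain N M (q + 2)} (h : IsSkew γ) (x y : gc N)
    (a : Fin q → gc N) (u v : ℂ) (z : Fin q → ℂ) :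
    γ (Fin.cons y (Fin.cons x a : Fin (q + 1) → gc N)) (Fin.cons v (Fin.cons u z : Fin (q + 1) → ℂ))
      = -γ (Fin.cons x (Fin.cons y a : Fin (q + 1) → gc N))
          (Fin.cons u (Fin.cons v z : Fin (q + 1) → ℂ)) := by
  rw [← h _ _ 0 1 (by simp), cons_cons_comp_swap, cons_cons_comp_swap]

theorem IsSkew.contr {q : ℕ} {γ : PreCochain N M (q + 1)} (h : IsSkew γ) (x : gc N) (μ : ℂ) :
    IsSkew (contr x μ q γ) := by
  intro a z i j hij
  simp only [contr_apply]
  rw [← cons_comp_swap, ← cons_comp_swap, h _ _ i.succ j.succ (by simp [← hij])]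

theorem insertNth_comp_swap {α : Type*} {q : ℕ} (y : α) (b : Fin q → α) (j : Fin q) :
    (j.castSucc.insertNth y b : Fin (q + 1) → α) ∘ Equiv.swap j.castSucc j.succ =
      j.succ.insertNth y b := by
  symm
  rw [Fin.insertNth_eq_iff]
  refine ⟨by simp, ?_⟩
  funext k
  simp only [Fin.removeNth_apply, Function.comp_apply]
  rcases lt_trichotomy k j with h | h | h
  · have h1 : j.succ.succAbove k = k.castSucc :=
      Fin.succAbove_of_castSucc_lt _ _ (by grind)
    have h2 : j.castSucc.succAbove k = k.castSucc :=
      Fin.succAbove_of_castSucc_lt _ _ (by simpa using h)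
    rw [h1, Equiv.swap_apply_of_ne_of_ne, ← h2, Fin.insertNth_apply_succAbove]
    · simpa using h.ne
    · grind
  · subst h
    have h1 : k.succ.succAbove k = k.castSucc :=
      Fin.succAbove_of_castSucc_lt _ _ (by simp [Fin.lt_def])
    have h2 : k.castSucc.succAbove k = k.succ :=
      Fin.succAbove_of_le_castSucc _ _ le_rfl
    rw [h1, Equiv.swap_apply_left, ← h2, Fin.insertNth_apply_succAbove]
  · have h1 : j.succ.succAbove k = k.succ :=
      Fin.succAbove_of_le_castSucc _ _ (by grind)
    have h2 : j.castSucc.succAbove k = k.succ :=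
      Fin.succAbove_of_le_castSucc _ _ (by grind)
    rw [h1, Equiv.swap_apply_of_ne_of_ne, ← h2, Fin.insertNth_apply_succAbove]
    · grind
    · simpa using h.ne'

/-- Moving the front argument to position j takes j neighbouring transpositions. -/
theorem IsSkew.insertNth {q : ℕ} {γ : PreCochain N M (q + 1)} (h : IsSkew γ) (j : Fin (q + 1))
    (y : gc N) (w : ℂ) (b : Fin q → gc N) (z : Fin q → ℂ) :
    γ (Fin.cons y b) (Fin.cons w z) =
      (-1 : ℂ) ^ (j : ℕ) • γ (j.insertNth y b) (j.insertNth w z) := by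
  induction j using Fin.induction with
  | zero => simp
  | succ j ih =>
    rw [← insertNth_comp_swap, ← insertNth_comp_swap, h _ _ _ _ (by simp), ih]
    simp [pow_succ]

theorem IsSkew.update {q : ℕ} {γ : PreCochain N M (q + 1)} (h : IsSkew γ) (j : Fin (q + 1))
    (y : gc N) (w : ℂ) (a : Fin (q + 1) → gc N) (z : Fin (q + 1) → ℂ) :
    γ (Fin.cons y (j.removeNth a)) (Fin.cons w (j.removeNth z)) =
      (-1 : ℂ) ^ (j : ℕ) • γ (Function.update a j y) (Function.update z j w) := by
  rw [h.insertNth j, Fin.insertNth_removeNth, Fin.insertNth_removeNth]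

theorem removeNth_succ_cons {α : Type*} {q : ℕ} (x : α) (a : Fin (q + 1) → α) (j : Fin (q + 1)) :
    (j.succ.removeNth (Fin.cons x a : Fin (q + 2) → α) : Fin (q + 1) → α) =
      Fin.cons x (j.removeNth a) := by
  funext k
  refine Fin.cases ?_ (fun k => ?_) k
  · simp [Fin.removeNth_apply]
  · simp [Fin.removeNth_apply]

namespace ConfModule

variable (ρ : ConfModule N M)

/-- The action of `x` at `λ = μ` on cochains. -/
def lieD (x : gc N) (μ : ℂ) (q : ℕ) : PreCochain N M q →ₗ[ℂ] PreCochain N M q where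
  toFun γ a z := ρ.act μ x (γ a z) -
    ∑ i, γ (Function.update a i (bracket μ x (a i))) (Function.update z i (μ + z i))
  map_add' γ δ := by
    funext a z
    simp only [Pi.add_apply, map_add, Finset.sum_add_distrib]
    abel
  map_smul' t γ := by
    funext a z
    simp only [Pi.smul_apply, map_smul, RingHom.id_apply, smul_sub, Finset.smul_sum]

theorem lieD_apply (x : gc N) (μ : ℂ) (q : ℕ) (γ : PreCochain N M q)
    (a : Fin q → gc N) (z : Fin q → ℂ) :
    ρ.lieD x μ q γ a z = ρ.act μ x (γ a z) -
      ∑ i, γ (Function.update a i (bracket μ x (a i))) (Function.update z i (μ + z i)) := rfl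

theorem d_zero_apply (γ : PreCochain N M 0) (a : Fin 1 → gc N) (z : Fin 1 → ℂ) :
    ρ.d 0 γ a z = ρ.act (z 0) (a 0) (γ (Fin.removeNth 0 a) (Fin.removeNth 0 z)) := rfl

theorem d_succ_apply (q : ℕ) (γ : PreCochain N M (q + 1)) (a : Fin (q + 2) → gc N)
    (z : Fin (q + 2) → ℂ) :
    ρ.d (q + 1) γ a z =
      ∑ i : Fin (q + 2), (-1 : ℂ) ^ (i : ℕ) •
            ρ.act (z i) (a i) (γ (i.removeNth a) (i.removeNth z))
        + ∑ j : Fin (q + 2), ∑ i : Fin (q + 1),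
            if i.castSucc < j then
              (-1 : ℂ) ^ ((i : ℕ) + (j : ℕ)) •
                γ (Fin.cons (bracket (z i.castSucc) (a i.castSucc) (a j))
                    (i.removeNth (j.removeNth a)))
                  (Fin.cons (z i.castSucc + z j) (i.removeNth (j.removeNth z)))
            else 0 := rfl

/-- Cartan's homotopy formula in degree `0`. -/
theorem contr_d_zero (x : gc N) (μ : ℂ) (γ : PreCochain N M 0) :
    contr x μ 0 (ρ.d 0 γ) = ρ.lieD x μ 0 γ := by
  funext a z
  simp [lieD_apply, d_zero_apply]

/-- Cartan's homotopy formula. -/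
theorem contr_d_add_d_contr (x : gc N) (μ : ℂ) (q : ℕ) {γ : PreCochain N M (q + 1)}
    (h : IsSkew γ) :
    contr x μ (q + 1) (ρ.d (q + 1) γ) + ρ.d q (contr x μ q γ) = ρ.lieD x μ (q + 1) γ := by
  funext a z
  -- The terms of dγ in which x acts or is bracketed make up the Lie derivative. The other terms
  -- keep x as a spectator and will cancel against d of the contraction.
  have key : contr x μ (q + 1) (ρ.d (q + 1) γ) a z =
      ρ.lieD x μ (q + 1) γ a z
      + (∑ i : Fin (q + 1), (-1 : ℂ) ^ ((i : ℕ) + 1) •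
            ρ.act (z i) (a i) (γ (Fin.cons x (i.removeNth a)) (Fin.cons μ (i.removeNth z)))
        + ∑ j : Fin (q + 1), ∑ i : Fin q,
            if i.succ.castSucc < j.succ then
              (-1 : ℂ) ^ ((i.succ : ℕ) + (j.succ : ℕ)) •
                γ (Fin.cons (bracket (z i.castSucc) (a i.castSucc) (a j))
                    (i.succ.removeNth (Fin.cons x (j.removeNth a) : Fin (q + 1) → gc N)))
                  (Fin.cons (z i.castSucc + z j)
                    (i.succ.removeNth (Fin.cons μ (j.removeNth z) : Fin (q + 1) → ℂ)))
            else 0) := by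
    simp only [contr_apply, d_succ_apply, lieD_apply]
    rw [Fin.sum_univ_succ, Fin.sum_univ_succ (f := fun j : Fin (q + 2) => ∑ i : Fin (q + 1), _)]
    have h0 : ∀ j : Fin (q + 1), (∑ i : Fin (q + 1), if i.castSucc < j.succ then
              (-1 : ℂ) ^ ((i : ℕ) + (j.succ : ℕ)) •
                γ (Fin.cons (bracket ((Fin.cons μ z : Fin (q + 2) → ℂ) i.castSucc)
                    ((Fin.cons x a : Fin (q + 2) → gc N) i.castSucc)
                    ((Fin.cons x a : Fin (q + 2) → gc N) j.succ))
                    (i.removeNth (j.succ.removeNth (Fin.cons x a : Fin (q + 2) → gc N))))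
                  (Fin.cons ((Fin.cons μ z : Fin (q + 2) → ℂ) i.castSucc +
                      (Fin.cons μ z : Fin (q + 2) → ℂ) j.succ)
                    (i.removeNth (j.succ.removeNth (Fin.cons μ z : Fin (q + 2) → ℂ))))
            else 0) =
        -γ (Function.update a j (bracket μ x (a j))) (Function.update z j (μ + z j))
        + ∑ i : Fin q, if i.succ.castSucc < j.succ then
              (-1 : ℂ) ^ ((i.succ : ℕ) + (j.succ : ℕ)) •
                γ (Fin.cons (bracket (z i.castSucc) (a i.castSucc) (a j))
                    (i.succ.removeNth (Fin.cons x (j.removeNth a) : Fin (q + 1) → gc N)))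
                  (Fin.cons (z i.castSucc + z j)
                    (i.succ.removeNth (Fin.cons μ (j.removeNth z) : Fin (q + 1) → ℂ)))
            else 0 := by
      intro j
      rw [Fin.sum_univ_succ]
      congr 1
      · simp only [Fin.castSucc_zero, Fin.succ_pos, if_true, Fin.cons_zero, Fin.cons_succ,
          removeNth_succ_cons, Fin.removeNth_zero, Fin.tail_cons, h.update j, smul_smul]
        rw [← pow_add]
        have : (-1 : ℂ) ^ (((0 : Fin (q + 1)) : ℕ) + (j.succ : ℕ) + (j : ℕ)) = -1 := by
          rw [show ((0 : Fin (q + 1)) : ℕ) + (j.succ : ℕ) + (j : ℕ) = 2 * j + 1 by simp; ring]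
          simp [pow_succ, pow_mul]
        rw [this, neg_one_smul]
      · refine Finset.sum_congr rfl fun i _ => ?_
        simp only [removeNth_succ_cons, ← Fin.succ_castSucc, Fin.cons_succ]
    rw [Finset.sum_congr rfl fun j _ => h0 j]
    simp only [Fin.cons_zero, Fin.cons_succ, removeNth_succ_cons, Fin.removeNth_zero, Fin.tail_cons,
      Finset.sum_add_distrib, Finset.sum_neg_distrib, Fin.val_succ, Fin.val_zero, pow_zero,
      one_smul, Fin.not_lt_zero, if_false, Finset.sum_const_zero, zero_add]
    abel
  rw [Pi.add_apply, Pi.add_apply, key, add_assoc, add_eq_left]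
  cases q with
  | zero => simp [d_zero_apply]
  | succ q =>
    -- In dγ the bracket stands in front of x, in the contraction behind it; the exchange costs the
    -- sign that makes the bracket terms cancel.
    have hsw : ∀ (j : Fin (q + 2)) (i : Fin (q + 1)),
        γ (Fin.cons (bracket (z i.castSucc) (a i.castSucc) (a j))
            (i.succ.removeNth (Fin.cons x (j.removeNth a) : Fin (q + 2) → gc N)))
          (Fin.cons (z i.castSucc + z j)
            (i.succ.removeNth (Fin.cons μ (j.removeNth z) : Fin (q + 2) → ℂ))) =
        -γ (Fin.cons x (Fin.cons (bracket (z i.castSucc) (a i.castSucc) (a j))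
                  (i.removeNth (j.removeNth a)) : Fin (q + 1) → gc N))
          (Fin.cons μ (Fin.cons (z i.castSucc + z j)
            (i.removeNth (j.removeNth z)) : Fin (q + 1) → ℂ)) := by
      intro j i
      rw [removeNth_succ_cons, removeNth_succ_cons, h.cons_cons]
    simp only [hsw, d_succ_apply, contr_apply, ← Fin.succ_castSucc, Fin.succ_lt_succ_iff]
    have h1 : ∀ (i j : ℕ), (-1 : ℂ) ^ (i + 1 + (j + 1)) = (-1) ^ (i + j) := by
      intro i j
      rw [show i + 1 + (j + 1) = i + j + 2 by ring, pow_add]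
      simp
    have h2 : ∀ i : ℕ, (-1 : ℂ) ^ (i + 1) = - (-1) ^ i := by
      intro i
      simp [pow_succ]
    simp only [Fin.val_succ, h1, h2, neg_smul, smul_neg, Finset.sum_neg_distrib]
    have h3 : ∀ (p : Prop) [Decidable p] (m : M), (if p then -m else 0) = -(if p then m else 0) := by
      intro p _ m
      split_ifs <;> simp
    simp only [h3, Finset.sum_neg_distrib]
    abel

end ConfModule

end Contraction

/-! ### The λ-bracket on generators; J^0_I and J^1_I at λ = 0 -/

section Bracket

variable {N : ℕ}

theorem smul_eq_C_smul (c : ℂ) (a : gc N) : c • a = (C c : ℂ[X]) • a := by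
  ext k n
  simp

theorem bracket_zero_left (z : ℂ) (b : gc N) : bracket z 0 b = 0 := by simp [bracket]

theorem bracket_zero_right (z : ℂ) (a : gc N) : bracket z a 0 = 0 := by simp [bracket]

theorem bracket_polySMul_left (z : ℂ) (q : ℂ[X]) (a b : gc N) :
    bracket z (q • a) b = q.eval (-z) • bracket z a b := by
  induction a using Finsupp.induction_linear with
  | zero => simp [bracket_zero_left]
  | add f g hf hg => rw [smul_add, bracket_add_left, hf, hg, bracket_add_left, smul_add]
  | single k p =>
    induction b using Finsupp.induction_linear with
    | zero => simp [bracket_zero_right]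
    | add f g hf hg => rw [bracket_add_right, hf, hg, bracket_add_right, smul_add]
    | single l r =>
      rw [Finsupp.smul_single, bracket_single, bracket_single]
      simp [mul_smul]

theorem bracket_polySMul_right (z : ℂ) (q : ℂ[X]) (a b : gc N) :
    bracket z a (q • b) = q.comp (X + C z) • bracket z a b := by
  induction a using Finsupp.induction_linear with
  | zero => simp [bracket_zero_left]
  | add f g hf hg => rw [bracket_add_left, hf, hg, bracket_add_left, smul_add]
  | single k p =>
    induction b using Finsupp.induction_linear with
    | zero => simp [bracket_zero_right]
    | add f g hf hg => rw [smul_add, bracket_add_right, hf, hg, bracket_add_right, smul_add]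
    | single l r =>
      rw [Finsupp.smul_single, bracket_single, bracket_single, smul_eq_mul, mul_comp, mul_smul,
        smul_eq_C_smul, smul_eq_C_smul, smul_smul, smul_smul, smul_smul, smul_smul]
      congr 1
      ring

theorem bracket_smul_left (z : ℂ) (c : ℂ) (a b : gc N) :
    bracket z (c • a) b = c • bracket z a b := by
  rw [smul_eq_C_smul, bracket_polySMul_left, eval_C]

theorem bracket_smul_right (z : ℂ) (c : ℂ) (a b : gc N) :
    bracket z a (c • b) = c • bracket z a b := by
  rw [smul_eq_C_smul, bracket_polySMul_right, C_comp, ← smul_eq_C_smul]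

theorem J_add (n : ℕ) (A B : Matrix (Fin N) (Fin N) ℂ) : J n (A + B) = J n A + J n B := by
  simp [J, Finset.sum_add_distrib]

theorem J_zero (n : ℕ) : J n (0 : Matrix (Fin N) (Fin N) ℂ) = 0 := by
  simp [J]

theorem J_smul (n : ℕ) (c : ℂ) (A : Matrix (Fin N) (Fin N) ℂ) : J n (c • A) = c • J n A := by
  simp [J, Finset.smul_sum, smul_eq_C_mul]

theorem J_single (n : ℕ) (i j : Fin N) :
    J n (Matrix.single i j (1 : ℂ)) = Finsupp.single (n, i, j) 1 := by
  rw [← one_smul ℂ[X] (J n _), ← single_eq_smul_J (n, i, j)]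

theorem genBracket_add_left (z : ℂ) (m n : ℕ) (A A' B : Matrix (Fin N) (Fin N) ℂ) :
    genBracket z m (A + A') n B = genBracket z m A n B + genBracket z m A' n B := by
  simp only [genBracket, add_mul, mul_add, J_add, smul_add, Finset.sum_add_distrib]
  abel

theorem genBracket_add_right (z : ℂ) (m n : ℕ) (A B B' : Matrix (Fin N) (Fin N) ℂ) :
    genBracket z m A n (B + B') = genBracket z m A n B + genBracket z m A n B' := by
  simp only [genBracket, add_mul, mul_add, J_add, smul_add, Finset.sum_add_distrib]
  abel

theorem genBracket_smul_left (z : ℂ) (m n : ℕ) (c : ℂ) (A B : Matrix (Fin N) (Fin N) ℂ) :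
    genBracket z m (c • A) n B = c • genBracket z m A n B := by
  simp only [genBracket, Matrix.smul_mul, Matrix.mul_smul, J_smul, smul_sub, Finset.smul_sum,
    smul_comm c]

theorem genBracket_smul_right (z : ℂ) (m n : ℕ) (c : ℂ) (A B : Matrix (Fin N) (Fin N) ℂ) :
    genBracket z m A n (c • B) = c • genBracket z m A n B := by
  simp only [genBracket, Matrix.smul_mul, Matrix.mul_smul, J_smul, smul_sub, Finset.smul_sum,
    smul_comm c]

/-- Both sides are bilinear in A and B, and on matrix units this is the definition of the bracket.
-/
theorem bracket_J (z : ℂ) (m n : ℕ) (A B : Matrix (Fin N) (Fin N) ℂ) :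
    bracket z (J m A) (J n B) = genBracket z m A n B := by
  have hs : ∀ (i j : Fin N) (x : ℂ), Matrix.single i j x = x • Matrix.single i j (1 : ℂ) := by
    intro i j x
    simp [Matrix.smul_single]
  induction A using Matrix.induction_on' with
  | h_zero =>
    rw [J_zero, bracket_zero_left, ← zero_smul ℂ (0 : Matrix (Fin N) (Fin N) ℂ),
      genBracket_smul_left, zero_smul]
  | h_add A A' h h' => rw [J_add, bracket_add_left, h, h', genBracket_add_left]
  | h_std_basis i j x =>
    rw [hs i j x, J_smul, bracket_smul_left, genBracket_smul_left]
    congr 1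
    induction B using Matrix.induction_on' with
    | h_zero =>
      rw [J_zero, bracket_zero_right, ← zero_smul ℂ (0 : Matrix (Fin N) (Fin N) ℂ),
        genBracket_smul_right, zero_smul]
    | h_add B B' h h' => rw [J_add, bracket_add_right, h, h', genBracket_add_right]
    | h_std_basis k l y =>
      rw [hs k l y, J_smul, bracket_smul_right, genBracket_smul_right, J_single, J_single,
        bracket_single]
      simp

theorem gc_induction {p : gc N → Prop} (a : gc N) (add : ∀ a b, p a → p b → p (a + b))
    (smul_J : ∀ (r : ℂ[X]) (n : ℕ) (A : Matrix (Fin N) (Fin N) ℂ), p (r • J n A)) : p a := by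
  induction a using Finsupp.induction_linear with
  | zero => simpa [J_zero] using smul_J 0 0 0
  | add f g hf hg => exact add f g hf hg
  | single k r =>
    rw [single_eq_smul_J]
    exact smul_J _ _ _

/-- At λ = 0 only the two terms with s = 0 survive, and they cancel because I is central. -/
theorem bracket_J_zero_one_at_zero (b : gc N) : bracket 0 (J 0 1) b = 0 := by
  induction b using gc_induction with
  | add a b ha hb => rw [bracket_add_right, ha, hb, add_zero]
  | smul_J r n A =>
    rw [bracket_polySMul_right, bracket_J, genBracket, Finset.sum_range_succ' _ n]
    simp

/-- The terms with s = 0 cancel as for J^0_I; what is left is the term s = 1 of the first sum, (λ +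
∂)b at λ = 0. -/
theorem bracket_J_one_one_at_zero (b : gc N) : bracket 0 (J 1 1) b = (X : ℂ[X]) • b := by
  induction b using gc_induction with
  | add a b ha hb => rw [bracket_add_right, ha, hb, smul_add]
  | smul_J r n A =>
    rw [bracket_polySMul_right, bracket_J, genBracket, Finset.sum_range_succ' _ n]
    simp [Finset.sum_range_succ]
    rw [smul_comm]

end Bracket

/-! ### Vanishing of reduced cohomology: parts (3) and (4) -/

section Vanishing

variable {N : ℕ} {M : Type*} [AddCommGroup M] [Module ℂ M]

namespace ConfModule

variable {ρ : ConfModule N M}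

theorem isSkew_of_mem {q : ℕ} {γ : PreCochain N M q} (h : γ ∈ ρ.cochains q) : IsSkew γ := h.2.2.2

theorem contr_zero_mem {q : ℕ} {γ : PreCochain N M (q + 1)} (h : γ ∈ ρ.cochains (q + 1))
    (x : gc N) : contr x 0 q γ ∈ ρ.cochains q := by
  obtain ⟨h1, h2, h3, h4⟩ := h
  refine ⟨fun z => ?_, fun a => ?_, fun a z i => ?_, IsSkew.contr h4 x 0⟩
  · obtain ⟨f, hf⟩ := h1 (Fin.cons 0 z)
    exact ⟨f.curryLeft x, fun a => by simp [hf]⟩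
  · obtain ⟨c, hc⟩ := h2 (Fin.cons x a)
    refine ⟨c.sum fun k v => Finsupp.single k.tail ((0 : ℂ) ^ k 0 • v), fun z => ?_⟩
    rw [contr_apply, hc, Finsupp.sum_sum_index (by simp) (by simp)]
    refine Finsupp.sum_congr fun k _ => ?_
    rw [Finsupp.sum_single_index (by simp), Fin.prod_univ_succ]
    simp only [Fin.cons_zero, Fin.cons_succ, smul_smul, Finsupp.tail_apply]
    rw [mul_comm]
  · have := h3 (Fin.cons x a) (Fin.cons 0 z) i.succ
    simp only [Fin.cons_succ] at this
    rw [contr_apply, contr_apply, ← this, Fin.cons_update]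

/-- The inserted variable is 0 and adds nothing to ∑ λᵢ. This is why contractions at λ = 0 descend
to the reduced complex. -/
theorem contr_zero_del {q : ℕ} (γ : PreCochain N M (q + 1)) (x : gc N) :
    contr x 0 q (ρ.del (q + 1) γ) = ρ.del q (contr x 0 q γ) := by
  funext a z
  simp [del, Fin.sum_univ_succ]

theorem del_sub_mem {q : ℕ} {γ : PreCochain N M q} (h : γ ∈ ρ.cochains q) :
    ρ.del q γ ∈ ρ.delCochains q := ⟨γ, h, rfl⟩

/-- If some `x` acts on the cochains, modulo `∂`, by an invertible constant, then the reduced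
cohomology vanishes. -/
theorem subsingleton_redH (x : gc N) (c e : ℂ) (hc : c ≠ 0)
    (hL : ∀ (q : ℕ) (γ : PreCochain N M q), γ ∈ ρ.cochains q →
      ρ.lieD x 0 q γ = c • γ + e • ρ.del q γ) (q : ℕ) : Subsingleton (ρ.RedH q) := by
  rw [Submodule.Quotient.subsingleton_iff, Submodule.submoduleOf_eq_top]
  rintro γ ⟨hγ, δ, hδ, hd⟩
  have hγ' : γ ∈ ρ.cochains q := hγ
  have h1 : ρ.del q (contr x 0 q δ) = contr x 0 q (ρ.d q γ) := by
    rw [← contr_zero_del, hd]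
  -- With dγ = ∂δ, Cartan's formula reads cγ + e∂γ = ι(∂δ) + dιγ = ∂(ιδ) + dιγ.
  have hB : c • γ ∈ ρ.redB q := by
    have hmem : ρ.del q (contr x 0 q δ - e • γ) ∈ ρ.delCochains q :=
      del_sub_mem (sub_mem (contr_zero_mem hδ x) (Submodule.smul_mem _ _ hγ'))
    cases q with
    | zero =>
      have : c • γ = ρ.del 0 (contr x 0 0 δ - e • γ) := by
        rw [map_sub, map_smul, h1, contr_d_zero, hL _ _ hγ']
        abel
      rw [this]
      exact Submodule.mem_sup_right hmem
    | succ q =>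
      have : c • γ = ρ.d q (contr x 0 q γ) + ρ.del (q + 1) (contr x 0 (q + 1) δ - e • γ) := by
        have := ρ.contr_d_add_d_contr x 0 q (isSkew_of_mem hγ')
        rw [hL _ _ hγ'] at this
        rw [map_sub, map_smul, h1, ← sub_eq_iff_eq_add.2 this.symm]
        abel
      rw [this]
      exact Submodule.add_mem_sup ⟨_, contr_zero_mem hγ' x, rfl⟩ hmem
  simpa [hc] using Submodule.smul_mem _ c⁻¹ hB

theorem cochain_update_zero {q : ℕ} {γ : PreCochain N M q} (h : γ ∈ ρ.cochains q)
    (a : Fin q → gc N) (z : Fin q → ℂ) (i : Fin q) : γ (Function.update a i 0) z = 0 := by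
  obtain ⟨f, hf⟩ := h.1 z
  rw [hf, f.map_update_zero]

theorem subsingleton_redH_of_act_J_zero {c : ℂ} (hc : c ≠ 0)
    (h : ∀ v : M, ρ.act 0 (J 0 (1 : Matrix (Fin N) (Fin N) ℂ)) v = c • v) (q : ℕ) :
    Subsingleton (ρ.RedH q) := by
  refine subsingleton_redH (J 0 1) c 0 hc (fun q γ hγ => ?_) q
  funext a z
  simp [lieD_apply, bracket_J_zero_one_at_zero, cochain_update_zero hγ, h]

/-- The Lie derivative along J^1_I at λ = 0 is multiplication by ∑ λᵢ, whereas ∂ is multiplication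
by a + ∑ λᵢ. They differ by the constant -a. -/
theorem subsingleton_redH_scalarModule {a : ℂ} (ha : a ≠ 0) (q : ℕ) :
    Subsingleton ((scalarModule N a).RedH q) := by
  refine subsingleton_redH (J 1 1) (-a) 1 (neg_ne_zero.2 ha) (fun q γ hγ => ?_) q
  funext b z
  have h3 := hγ.2.2.1
  simp only [lieD_apply, bracket_J_one_one_at_zero, zero_add, Function.update_eq_self, h3]
  simp [scalarModule, del, Finset.sum_mul]

theorem natModule_act_J_zero (α : ℂ) (v : Fin N → ℂ[X]) :
    (natModule N α).act 0 (J 0 1) v = (1 : ℂ) • v := by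
  change natAct α 0 (J 0 1) v = _
  rw [natAct_J]
  simp

end ConfModule

end Vanishing

/-! ### Jacobi identity and skew-symmetry from the natural module -/

section Faithful

variable {N : ℕ}

/-- On a basis vector J^m acts as (∂ + t)^m. After the shift ∂ ↦ ∂ - t this becomes the monomial
∂^m, so the components of c, at ∂ = -t, are the coefficients of the result. -/
theorem coeff_natAct (t : ℂ) (c : gc N) (m : ℕ) (i j : Fin N) :
    ((natAct 0 t c (Pi.single j 1) i).comp (X - C t)).coeff m = (c (m, i, j)).eval (-t) := by
  induction c using Finsupp.induction_linear with
  | zero => simp [natAct_zero_left]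
  | add f g hf hg => rw [natAct_add_left, Pi.add_apply, add_comp, coeff_add, hf, hg]; simp
  | single k p =>
    obtain ⟨n, i', j'⟩ := k
    rw [natAct_single]
    by_cases hi : i = i'
    · subst hi
      by_cases hj : j = j'
      · subst hj
        by_cases hm : n = m
        · subst hm; simp
        · simp [coeff_X_pow, Ne.symm hm]
      · simp [Ne.symm hj]
    · simp [hi]

theorem eval_eq_zero_of_natAct {t : ℂ} {c : gc N} (h : ∀ v, natAct 0 t c v = 0)
    (k : ℕ × Fin N × Fin N) : (c k).eval (-t) = 0 := by
  obtain ⟨m, i, j⟩ := k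
  rw [← coeff_natAct, h]
  simp

/-- The natural module is faithful, so identities of gc_N, such as the Jacobi identity, can be
checked in it. -/
theorem eq_of_natAct {c e : gc N} (h : ∀ t v, natAct 0 t c v = natAct 0 t e v) : c = e := by
  ext1 k
  refine Polynomial.funext fun t => ?_
  obtain ⟨m, i, j⟩ := k
  have := coeff_natAct (-t) c m i j
  rw [h, coeff_natAct, neg_neg] at this
  exact this.symm

theorem natAct_bracket' (t z : ℂ) (a b : gc N) (v : Fin N → ℂ[X]) :
    natAct 0 t (bracket z a b) v =
      natAct 0 z a (natAct 0 (t - z) b v) - natAct 0 (t - z) b (natAct 0 z a v) := by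
  rw [natAct_bracket, add_sub_cancel]

theorem natAct_sub_right (α z : ℂ) (a : gc N) (v w : Fin N → ℂ[X]) :
    natAct α z a (v - w) = natAct α z a v - natAct α z a w :=
  map_sub ((natModule N α).act z a) v w

theorem natAct_sub_left (α z : ℂ) (a b : gc N) (v : Fin N → ℂ[X]) :
    natAct α z (a - b) v = natAct α z a v - natAct α z b v := by
  rw [sub_eq_add_neg, natAct_add_left, ← neg_one_smul ℂ b, natAct_csmul_left, neg_one_smul,
    sub_eq_add_neg]

/-- The Jacobi identity of `gc_N`. -/
theorem bracket_bracket (z w : ℂ) (a b c : gc N) :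
    bracket z a (bracket w b c) - bracket w b (bracket z a c) =
      bracket (z + w) (bracket z a b) c := by
  refine eq_of_natAct fun t v => ?_
  rw [natAct_sub_left]
  simp only [natAct_bracket', natAct_sub_right]
  rw [show t - w - z = t - z - w by ring, show t - (z + w) = t - z - w by ring,
    show z + w - z = w by ring]
  abel

theorem map_polySMul_of_conformal {V : Type*} [AddCommGroup V] [Module ℂ V] {t : ℂ}
    (φ : gc N →ₗ[ℂ] V) (hφ : ∀ a, φ ((X : ℂ[X]) • a) = -(t • φ a)) (p : ℂ[X]) (a : gc N) :
    φ (p • a) = p.eval (-t) • φ a := by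
  induction p using Polynomial.induction_on' with
  | add p q hp hq => rw [add_smul, map_add, hp, hq, eval_add, add_smul]
  | monomial n c =>
    rw [← C_mul_X_pow_eq_monomial, mul_smul, ← smul_eq_C_smul, map_smul]
    have : φ ((X : ℂ[X]) ^ n • a) = (-t) ^ n • φ a := by
      induction n with
      | zero => simp
      | succ n ih => rw [pow_succ', mul_smul, hφ, ih, pow_succ', mul_smul, neg_smul]
    rw [this]
    simp [mul_smul]

/-- A functional on which ∂ acts as -t only sees the components at ∂ = -t, and the action at λ = t
determines these. -/
theorem map_eq_zero_of_natAct {V : Type*} [AddCommGroup V] [Module ℂ V] {t : ℂ}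
    (φ : gc N →ₗ[ℂ] V) (hφ : ∀ a, φ ((X : ℂ[X]) • a) = -(t • φ a)) {c : gc N}
    (h : ∀ v, natAct 0 t c v = 0) : φ c = 0 := by
  rw [← Finsupp.sum_single c, map_finsuppSum]
  refine Finset.sum_eq_zero fun k _ => ?_
  have : Finsupp.single k (c k) = c k • (Finsupp.single k 1 : gc N) := by simp
  simp only [this]
  rw [map_polySMul_of_conformal φ hφ, eval_eq_zero_of_natAct h, zero_smul]

/-- Skew-symmetry of the bracket, under a conformally antilinear functional. -/
theorem map_bracket_comm {V : Type*} [AddCommGroup V] [Module ℂ V] {z w : ℂ}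
    (φ : gc N →ₗ[ℂ] V) (hφ : ∀ a, φ ((X : ℂ[X]) • a) = -((z + w) • φ a)) (a b : gc N) :
    φ (bracket w b a) = -φ (bracket z a b) := by
  rw [eq_neg_iff_add_eq_zero, ← map_add]
  refine map_eq_zero_of_natAct φ hφ fun v => ?_
  rw [natAct_add_left, natAct_bracket', natAct_bracket', add_sub_cancel_left, add_sub_cancel_right]
  abel

end Faithful

/-! ### Vector-valued polynomial maps; polynomial dependence of the bracket on λ -/

section PolynomialMaps

variable {N : ℕ}

/-- The polynomial maps `ℂ → V`. -/
def polyMaps (V : Type*) [AddCommGroup V] [Module ℂ V] : Submodule ℂ (ℂ → V) :=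
  Submodule.span ℂ (Set.range fun (p : ℕ × V) (z : ℂ) => z ^ p.1 • p.2)

variable {V : Type*} [AddCommGroup V] [Module ℂ V]

theorem pow_smul_mem_polyMaps (n : ℕ) (v : V) : (fun z : ℂ => z ^ n • v) ∈ polyMaps V :=
  Submodule.subset_span ⟨(n, v), rfl⟩

theorem const_mem_polyMaps (v : V) : (fun _ : ℂ => v) ∈ polyMaps V := by
  simpa using pow_smul_mem_polyMaps 0 v

theorem fun_add_mem_polyMaps {f g : ℂ → V} (hf : f ∈ polyMaps V) (hg : g ∈ polyMaps V) :
    (fun z => f z + g z) ∈ polyMaps V := add_mem hf hg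

theorem fun_smul_mem_polyMaps (c : ℂ) {f : ℂ → V} (hf : f ∈ polyMaps V) :
    (fun z => c • f z) ∈ polyMaps V := Submodule.smul_mem _ c hf

theorem bilin_mem_polyMaps {U W : Type*} [AddCommGroup U] [Module ℂ U] [AddCommGroup W]
    [Module ℂ W] (B : U →ₗ[ℂ] V →ₗ[ℂ] W) {f : ℂ → U} {g : ℂ → V} (hf : f ∈ polyMaps U)
    (hg : g ∈ polyMaps V) : (fun z => B (f z) (g z)) ∈ polyMaps W := by
  induction hf using Submodule.span_induction with
  | mem f h =>
    obtain ⟨⟨n, u⟩, rfl⟩ := h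
    induction hg using Submodule.span_induction with
    | mem g h =>
      obtain ⟨⟨m, v⟩, rfl⟩ := h
      simpa [smul_smul, ← pow_add] using pow_smul_mem_polyMaps (m + n) (B u v)
    | zero => simpa using const_mem_polyMaps (0 : W)
    | add g g' _ _ h h' => simpa using fun_add_mem_polyMaps h h'
    | smul c g _ h => simpa using fun_smul_mem_polyMaps c h
  | zero => simpa using const_mem_polyMaps (0 : W)
  | add g g' _ _ h h' => simpa using fun_add_mem_polyMaps h h'
  | smul c g _ h => simpa using fun_smul_mem_polyMaps c h

theorem map_mem_polyMaps {W : Type*} [AddCommGroup W] [Module ℂ W] (B : V →ₗ[ℂ] W) {f : ℂ → V}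
    (hf : f ∈ polyMaps V) : (fun z => B (f z)) ∈ polyMaps W := by
  induction hf using Submodule.span_induction with
  | mem f h =>
    obtain ⟨⟨n, u⟩, rfl⟩ := h
    simpa using pow_smul_mem_polyMaps n (B u)
  | zero => simpa using const_mem_polyMaps (0 : W)
  | add g g' _ _ h h' => simpa using fun_add_mem_polyMaps h h'
  | smul c g _ h => simpa using fun_smul_mem_polyMaps c h

theorem smul_mem_polyMaps {f : ℂ → ℂ} {g : ℂ → V} (hf : f ∈ polyMaps ℂ)
    (hg : g ∈ polyMaps V) : (fun z => f z • g z) ∈ polyMaps V :=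
  bilin_mem_polyMaps (LinearMap.lsmul ℂ V) hf hg

theorem polySMul_mem_polyMaps {f : ℂ → ℂ[X]} {g : ℂ → gc N} (hf : f ∈ polyMaps ℂ[X])
    (hg : g ∈ polyMaps (gc N)) : (fun z => f z • g z) ∈ polyMaps (gc N) :=
  bilin_mem_polyMaps ((LinearMap.lsmul ℂ[X] (gc N)).restrictScalars₁₂ ℂ ℂ) hf hg

theorem mul_mem_polyMaps {f g : ℂ → ℂ[X]} (hf : f ∈ polyMaps ℂ[X]) (hg : g ∈ polyMaps ℂ[X]) :
    (fun z => f z * g z) ∈ polyMaps ℂ[X] :=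
  bilin_mem_polyMaps (LinearMap.mul ℂ ℂ[X]) hf hg

theorem id_mem_polyMaps : (fun z : ℂ => z) ∈ polyMaps ℂ := by
  simpa using pow_smul_mem_polyMaps 1 (1 : ℂ)

theorem C_mem_polyMaps : (fun z : ℂ => (C z : ℂ[X])) ∈ polyMaps ℂ[X] := by
  simpa [smul_eq_C_mul] using pow_smul_mem_polyMaps 1 (1 : ℂ[X])

theorem pow_mem_polyMaps {f : ℂ → ℂ[X]} (hf : f ∈ polyMaps ℂ[X]) (n : ℕ) :
    (fun z => f z ^ n) ∈ polyMaps ℂ[X] := by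
  induction n with
  | zero => simpa using const_mem_polyMaps 1
  | succ n ih => simpa [pow_succ] using mul_mem_polyMaps ih hf

theorem comp_mem_polyMaps (p : ℂ[X]) {f : ℂ → ℂ[X]} (hf : f ∈ polyMaps ℂ[X]) :
    (fun z => p.comp (f z)) ∈ polyMaps ℂ[X] := by
  induction p using Polynomial.induction_on' with
  | add p q hp hq => simpa using fun_add_mem_polyMaps hp hq
  | monomial n c =>
    simpa [monomial_comp, smul_eq_C_mul] using
      fun_smul_mem_polyMaps c (pow_mem_polyMaps hf n)

theorem add_X_mem_polyMaps : (fun z : ℂ => (X + C z : ℂ[X])) ∈ polyMaps ℂ[X] :=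
  add_mem (const_mem_polyMaps X) C_mem_polyMaps

theorem sum_mem_polyMaps {ι : Type*} (s : Finset ι) {f : ι → ℂ → V}
    (h : ∀ i ∈ s, f i ∈ polyMaps V) : (fun z => ∑ i ∈ s, f i z) ∈ polyMaps V := by
  have : (fun z => ∑ i ∈ s, f i z) = ∑ i ∈ s, f i := by ext; simp
  rw [this]
  exact sum_mem h

theorem genBracket_mem_polyMaps (m n : ℕ) (A B : Matrix (Fin N) (Fin N) ℂ) :
    (fun z => genBracket z m A n B) ∈ polyMaps (gc N) := by
  refine sub_mem (sum_mem_polyMaps _ fun s _ => ?_) (sum_mem_polyMaps _ fun s _ => ?_)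
  · refine polySMul_mem_polyMaps (mul_mem_polyMaps (const_mem_polyMaps _) ?_) (const_mem_polyMaps _)
    exact pow_mem_polyMaps (add_mem C_mem_polyMaps (const_mem_polyMaps X)) s
  · have := Submodule.smul_mem _ ((n.choose s : ℂ) * (-1) ^ s)
      (pow_smul_mem_polyMaps s (J (m + n - s) (B * A)))
    convert this using 2 with z
    simp only [Pi.smul_apply, smul_smul]
    rw [neg_pow]
    ring_nf

theorem bracket_mem_polyMaps (a b : gc N) : (fun z => bracket z a b) ∈ polyMaps (gc N) := by
  induction a using gc_induction with
  | add a a' h h' => simpa only [bracket_add_left] using fun_add_mem_polyMaps h h'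
  | smul_J p m A =>
    induction b using gc_induction with
    | add b b' h h' => simpa only [bracket_add_right] using fun_add_mem_polyMaps h h'
    | smul_J r n B =>
      simp only [bracket_polySMul_left, bracket_polySMul_right, bracket_J]
      refine polySMul_mem_polyMaps (comp_mem_polyMaps r add_X_mem_polyMaps)
        (smul_mem_polyMaps ?_ (genBracket_mem_polyMaps m n A B))
      have := map_mem_polyMaps (Polynomial.leval (R := ℂ) 0)
        (comp_mem_polyMaps p (neg_mem C_mem_polyMaps))
      simpa [eval_comp] using this

theorem exists_eq_add_smul {f : ℂ → V} (hf : f ∈ polyMaps V) :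
    ∃ g ∈ polyMaps V, ∀ z, f z = f 0 + z • g z := by
  induction hf using Submodule.span_induction with
  | mem f h =>
    obtain ⟨⟨n, u⟩, rfl⟩ := h
    cases n with
    | zero => exact ⟨0, zero_mem _, by simp⟩
    | succ n => exact ⟨_, pow_smul_mem_polyMaps n u, fun z => by simp [smul_smul, pow_succ']⟩
  | zero => exact ⟨0, zero_mem _, by simp⟩
  | add f f' _ _ h h' =>
    obtain ⟨g, hg, h⟩ := h
    obtain ⟨g', hg', h'⟩ := h'
    refine ⟨g + g', add_mem hg hg', fun z => ?_⟩
    rw [Pi.add_apply, h, h']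
    simp only [Pi.add_apply, smul_add]
    abel
  | smul c f _ h =>
    obtain ⟨g, hg, h⟩ := h
    refine ⟨c • g, Submodule.smul_mem _ c hg, fun z => ?_⟩
    rw [Pi.smul_apply, h]
    simp only [Pi.smul_apply, smul_add, smul_comm c]

end PolynomialMaps

/-! ### First-order term of the action of J^0_I -/

section Lowering

variable {N : ℕ}

/-- The `ℂ[∂]`-linear map `J^n_A ↦ n J^{n-1}_A`. -/
def lower : gc N →ₗ[ℂ[X]] gc N :=
  Finsupp.lsum ℂ[X] fun k => (k.1 : ℂ[X]) • Finsupp.lsingle (k.1 - 1, k.2)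

theorem lower_single (m : ℕ) (e : Fin N × Fin N) (p : ℂ[X]) :
    lower (Finsupp.single (m, e) p) = (m : ℂ[X]) • Finsupp.single (m - 1, e) p := by
  simp [lower]

theorem lower_J (n : ℕ) (A : Matrix (Fin N) (Fin N) ℂ) :
    lower (J n A) = (n : ℂ[X]) • J (n - 1) A := by
  simp only [J, map_sum, lower_single, Finset.smul_sum]

/-- `[J^0_I _λ b]` is `λ · lower b` up to terms divisible by `λ²`. -/
theorem bracket_J_zero_one (b : gc N) :
    ∃ f ∈ polyMaps (gc N), ∀ z, bracket z (J 0 1) b = z • lower b + z ^ 2 • f z := by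
  induction b using gc_induction with
  | add a b ha hb =>
    obtain ⟨f, hf, ha⟩ := ha
    obtain ⟨g, hg, hb⟩ := hb
    refine ⟨f + g, add_mem hf hg, fun z => ?_⟩
    rw [bracket_add_right, ha, hb, map_add]
    simp only [Pi.add_apply, smul_add]
    abel
  | smul_J r n A =>
    obtain ⟨g, hg, h⟩ := exists_eq_add_smul (comp_mem_polyMaps r add_X_mem_polyMaps)
    simp only [C_0, add_zero, comp_X] at h
    obtain ⟨f, hf, h'⟩ : ∃ f ∈ polyMaps (gc N), ∀ z, bracket z (J 0 1) (J n A) =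
        z • lower (J n A) + z ^ 2 • f z := by
      cases n with
      | zero => exact ⟨0, zero_mem _, fun z => by simp [bracket_J, genBracket, lower_J]⟩
      | succ n =>
        -- The terms of order at least 2 in λ, divided by λ², so the index is shifted by 2. The
        -- order 0 cancels and the order 1 is `lower`.
        refine ⟨fun z => -∑ s ∈ Finset.range n, z ^ s •
          ((((n + 1).choose (s + 2) : ℂ) * (-1) ^ s) • J (n + 1 - (s + 2)) A), ?_, fun z => ?_⟩
        · exact neg_mem (sum_mem_polyMaps _ fun s _ => pow_smul_mem_polyMaps s _)
        · rw [bracket_J, genBracket, Finset.sum_range_succ' _ (n + 1), Finset.sum_range_succ' _ n,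
            lower_J, smul_neg, Finset.smul_sum]
          have : ∀ s, (((n + 1).choose (s + 2) : ℂ) * (-z) ^ (s + 2)) •
              J (n + 1 - (s + 2)) A = z ^ 2 • z ^ s •
              ((((n + 1).choose (s + 2) : ℂ) * (-1) ^ s) • J (n + 1 - (s + 2)) A) := by
            intro s
            rw [smul_smul, smul_smul, neg_pow]
            congr 1
            ring
          have h1 : ((n + 1 : ℕ) : ℂ[X]) • J n A = ((n : ℂ) + 1) • J n A := by
            rw [smul_eq_C_smul]
            simp
          simp only [add_assoc, one_add_one_eq_two, zero_add, one_mul, mul_one] at this ⊢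
          simp only [this]
          simp
          push_cast at h1
          rw [h1]
          module
    refine ⟨fun z => g z • lower (J n A) + r • f z + z • g z • f z, ?_, fun z => ?_⟩
    · refine add_mem (add_mem (polySMul_mem_polyMaps hg (const_mem_polyMaps _))
        (polySMul_mem_polyMaps (const_mem_polyMaps r) hf)) ?_
      exact smul_mem_polyMaps id_mem_polyMaps (polySMul_mem_polyMaps hg hf)
    · rw [bracket_polySMul_right, h, h', map_smul]
      simp only [smul_eq_C_smul, smul_eq_C_mul]
      simp only [smul_add, smul_smul, C_pow]
      module

end Lowering

/-! ### Cartan calculus with trivial coefficients; d² = 0 -/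

section Forms

variable {N : ℕ}

/-- Multilinear, conformally antilinear and skew-symmetric maps. -/
structure IsForm {q : ℕ} (γ : PreCochain N ℂ q) : Prop where
  add : ∀ (a : Fin q → gc N) (z : Fin q → ℂ) (i : Fin q) (x y : gc N),
    γ (Function.update a i (x + y)) z =
      γ (Function.update a i x) z + γ (Function.update a i y) z
  smul : ∀ (a : Fin q → gc N) (z : Fin q → ℂ) (i : Fin q) (p : ℂ[X]) (x : gc N),
    γ (Function.update a i (p • x)) z = p.eval (-(z i)) * γ (Function.update a i x) z
  skew : IsSkew γ

namespace IsForm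

variable {q : ℕ} {γ δ : PreCochain N ℂ q}

theorem zero : IsForm (0 : PreCochain N ℂ q) :=
  ⟨by simp, by simp, fun _ _ _ _ _ => by simp⟩

theorem add' (h : IsForm γ) (h' : IsForm δ) : IsForm (γ + δ) where
  add a z i x y := by simp only [Pi.add_apply, h.add, h'.add]; ring
  smul a z i p x := by simp only [Pi.add_apply, h.smul, h'.smul]; ring
  skew a z i j hij := by simp only [Pi.add_apply, h.skew _ _ _ _ hij, h'.skew _ _ _ _ hij]; ring

theorem const_smul (c : ℂ) (h : IsForm γ) : IsForm (c • γ) where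
  add a z i x y := by simp only [Pi.smul_apply, h.add, smul_eq_mul]; ring
  smul a z i p x := by simp only [Pi.smul_apply, h.smul, smul_eq_mul]; ring
  skew a z i j hij := by simp only [Pi.smul_apply, h.skew _ _ _ _ hij, smul_neg]

theorem sub (h : IsForm γ) (h' : IsForm δ) : IsForm (γ - δ) := by
  simpa [sub_eq_add_neg] using h.add' (h'.const_smul (-1))

theorem csmul (h : IsForm γ) (a : Fin q → gc N) (z : Fin q → ℂ) (i : Fin q) (c : ℂ) (x : gc N) :
    γ (Function.update a i (c • x)) z = c * γ (Function.update a i x) z := by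
  rw [smul_eq_C_smul, h.smul, eval_C]

theorem update_zero (h : IsForm γ) (a : Fin q → gc N) (z : Fin q → ℂ) (i : Fin q) :
    γ (Function.update a i 0) z = 0 := by
  simpa using h.csmul a z i 0 0

/-- The linear functional obtained by freezing all arguments but one. -/
def functional (h : IsForm γ) (a : Fin q → gc N) (z : Fin q → ℂ) (i : Fin q) : gc N →ₗ[ℂ] ℂ where
  toFun x := γ (Function.update a i x) z
  map_add' := h.add a z i
  map_smul' := h.csmul a z i

theorem functional_apply (h : IsForm γ) (a : Fin q → gc N) (z : Fin q → ℂ) (i : Fin q) (x : gc N) :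
    h.functional a z i x = γ (Function.update a i x) z := rfl

theorem functional_X (h : IsForm γ) (a : Fin q → gc N) (z : Fin q → ℂ) (i : Fin q) (x : gc N) :
    h.functional a z i ((X : ℂ[X]) • x) = -(z i • h.functional a z i x) := by
  simp [functional_apply, h.smul]

theorem exists_multilinearMap (h : IsForm γ) (z : Fin q → ℂ) :
    ∃ f : MultilinearMap ℂ (fun _ : Fin q => gc N) ℂ, ∀ a, γ a z = f a :=
  ⟨MultilinearMap.mk' (fun a => γ a z) (fun a i x y => h.add a z i x y)
    (fun a i c x => h.csmul a z i c x), fun _ => rfl⟩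

end IsForm

theorem isForm_contr {q : ℕ} {γ : PreCochain N ℂ (q + 1)} (h : IsForm γ) (x : gc N) (μ : ℂ) :
    IsForm (contr x μ q γ) where
  add a z i u v := by simp only [contr_apply, Fin.cons_update, h.add]
  smul a z i p u := by simp only [contr_apply, Fin.cons_update, h.smul, Fin.cons_succ]
  skew := h.skew.contr x μ

theorem contr_add_left {q : ℕ} {γ : PreCochain N ℂ (q + 1)} (h : IsForm γ) (x y : gc N) (μ : ℂ) :
    contr (x + y) μ q γ = contr x μ q γ + contr y μ q γ := by
  funext a z
  have := h.add (Fin.cons 0 a) (Fin.cons μ z) 0 x y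
  simp only [Fin.update_cons_zero] at this
  exact this

theorem contr_smul_left {q : ℕ} {γ : PreCochain N ℂ (q + 1)} (h : IsForm γ) (p : ℂ[X]) (x : gc N)
    (μ : ℂ) : contr (p • x) μ q γ = p.eval (-μ) • contr x μ q γ := by
  funext a z
  have := h.smul (Fin.cons 0 a) (Fin.cons μ z) 0 p x
  simp only [Fin.update_cons_zero, Fin.cons_zero] at this
  exact this

namespace ConfModule

/-- The trivial module. -/
abbrev triv (N : ℕ) : ConfModule N ℂ := scalarModule N 0

theorem triv_lieD_apply (x : gc N) (μ : ℂ) (q : ℕ) (γ : PreCochain N ℂ q) (a : Fin q → gc N)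
    (z : Fin q → ℂ) : (triv N).lieD x μ q γ a z =
      -∑ i, γ (Function.update a i (bracket μ x (a i))) (Function.update z i (μ + z i)) := by
  simp [lieD_apply, scalarModule]

theorem triv_lieD_zero (x : gc N) (μ : ℂ) : (triv N).lieD x μ 0 = 0 := by
  ext γ a z
  simp [triv_lieD_apply]

theorem triv_d_zero : (triv N).d 0 = 0 := by
  ext γ a z
  simp [d_zero_apply, scalarModule]

theorem lieD_add_left {q : ℕ} {γ : PreCochain N ℂ q} (h : IsForm γ) (x y : gc N) (μ : ℂ) :
    (triv N).lieD (x + y) μ q γ = (triv N).lieD x μ q γ + (triv N).lieD y μ q γ := by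
  funext a z
  simp only [Pi.add_apply, triv_lieD_apply, bracket_add_left, h.add, Finset.sum_add_distrib]
  ring

theorem lieD_smul_left {q : ℕ} {γ : PreCochain N ℂ q} (h : IsForm γ) (p : ℂ[X]) (x : gc N)
    (μ : ℂ) : (triv N).lieD (p • x) μ q γ = p.eval (-μ) • (triv N).lieD x μ q γ := by
  funext a z
  simp only [Pi.smul_apply, triv_lieD_apply, bracket_polySMul_left, h.csmul, Finset.mul_sum,
    smul_eq_mul, mul_neg]

theorem isForm_lieD {q : ℕ} {γ : PreCochain N ℂ q} (h : IsForm γ) (x : gc N) (μ : ℂ) :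
    IsForm ((triv N).lieD x μ q γ) where
  add a z i u v := by
    simp only [triv_lieD_apply]
    rw [← neg_add, ← Finset.sum_add_distrib]
    congr 1
    refine Finset.sum_congr rfl fun j _ => ?_
    rcases eq_or_ne j i with rfl | hj
    · simp only [Function.update_self, Function.update_idem, bracket_add_right, h.add]
    · simp only [Function.update_of_ne hj, Function.update_comm hj.symm, h.add]
  smul a z i p u := by
    simp only [triv_lieD_apply]
    rw [mul_neg, Finset.mul_sum]
    congr 1
    refine Finset.sum_congr rfl fun j _ => ?_
    rcases eq_or_ne j i with rfl | hj
    · simp only [Function.update_self, Function.update_idem, bracket_polySMul_right, h.smul]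
      simp [eval_comp]
    · simp only [Function.update_of_ne hj, Function.update_comm hj.symm, h.smul,
        Function.update_of_ne hj.symm]
  skew a z i j hij := by
    simp only [triv_lieD_apply, neg_neg]
    rw [← Equiv.sum_comp (Equiv.swap i j)
      (fun k => γ (Function.update a k (bracket μ x (a k))) (Function.update z k (μ + z k))),
      ← Finset.sum_neg_distrib]
    refine Finset.sum_congr rfl fun k _ => ?_
    have aux : ∀ {α : Type} (b : Fin q → α) (u : α),
        Function.update (b ∘ Equiv.swap i j) k u =
          Function.update b (Equiv.swap i j k) u ∘ Equiv.swap i j := by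
      intro α b u
      rw [Function.update_comp_equiv, Equiv.symm_apply_apply]
    rw [aux, aux, h.skew _ _ _ _ hij]
    simp

/-- The summand of the Lie derivative at the front position, where x is bracketed with y, gives the
correction term. -/
theorem contr_lieD (x y : gc N) (μ ν : ℂ) (q : ℕ) (γ : PreCochain N ℂ (q + 1)) :
    contr y ν q ((triv N).lieD x μ (q + 1) γ) =
      (triv N).lieD x μ q (contr y ν q γ) - contr (bracket μ x y) (μ + ν) q γ := by
  funext a z
  simp only [Pi.sub_apply, contr_apply, triv_lieD_apply, Fin.sum_univ_succ, Fin.cons_zero,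
    Fin.cons_succ, Fin.update_cons_zero, ← Fin.cons_update]
  ring

/-- When x and y hit different arguments, the two orders agree. When they hit the same one, the
difference is the Jacobi identity. -/
theorem lieD_lieD {q : ℕ} {γ : PreCochain N ℂ q} (h : IsForm γ) (x y : gc N) (μ ν : ℂ) :
    (triv N).lieD x μ q ((triv N).lieD y ν q γ) - (triv N).lieD y ν q ((triv N).lieD x μ q γ) =
      (triv N).lieD (bracket μ x y) (μ + ν) q γ := by
  funext a z
  have key : ∀ (x y : gc N) (μ ν : ℂ), (triv N).lieD x μ q ((triv N).lieD y ν q γ) a z =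
      ∑ i, ∑ j, γ (Function.update (Function.update a i (bracket μ x (a i))) j
          (bracket ν y (Function.update a i (bracket μ x (a i)) j)))
        (Function.update (Function.update z i (μ + z i)) j
          (ν + Function.update z i (μ + z i) j)) := by
    intro x y μ ν
    simp only [triv_lieD_apply, Finset.sum_neg_distrib, neg_neg]
  rw [Pi.sub_apply, Pi.sub_apply, key x y, key y x, Finset.sum_comm (s := Finset.univ)
    (f := fun i j => γ (Function.update (Function.update a i (bracket ν y (a i))) j _) _),
    ← Finset.sum_sub_distrib, triv_lieD_apply, ← Finset.sum_neg_distrib]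
  refine Finset.sum_congr rfl fun i _ => ?_
  rw [← Finset.sum_sub_distrib, Finset.sum_eq_single i]
  · simp only [Function.update_self, Function.update_idem, ← bracket_bracket]
    rw [show ν + (μ + z i) = μ + ν + z i by ring, show μ + (ν + z i) = μ + ν + z i by ring]
    simp only [← h.functional_apply]
    rw [map_sub]
    ring
  · intro j _ hj
    simp only [Function.update_of_ne hj, Function.update_of_ne hj.symm,
      Function.update_comm hj, sub_self]
  · simp

/-- In this form Cartan's formula computes d from d in one degree less, so the properties of d below
follow by induction on the degree, without manipulating the double sum. -/
theorem contr_d (q : ℕ) {γ : PreCochain N ℂ (q + 1)} (h : IsForm γ) (x : gc N) (μ : ℂ) :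
    contr x μ (q + 1) ((triv N).d (q + 1) γ) =
      (triv N).lieD x μ (q + 1) γ - (triv N).d q (contr x μ q γ) :=
  eq_sub_of_add_eq ((triv N).contr_d_add_d_contr x μ q h.skew)

/-- Skew-symmetry of dγ in its first two arguments, which reduces to that of γ and of the bracket.
-/
theorem contr_contr_d_comm (q : ℕ) {γ : PreCochain N ℂ (q + 1)} (h : IsForm γ) (x y : gc N)
    (μ ν : ℂ) : contr y ν q (contr x μ (q + 1) ((triv N).d (q + 1) γ)) =
      -contr x μ q (contr y ν (q + 1) ((triv N).d (q + 1) γ)) := by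
  have hbr : contr (bracket ν y x) (ν + μ) q γ = -contr (bracket μ x y) (μ + ν) q γ := by
    funext a z
    have := map_bracket_comm (z := μ) (w := ν)
      (h.functional (Fin.cons 0 a) (Fin.cons (μ + ν) z) 0)
      (fun b => h.functional_X _ _ _ _) x y
    simp only [IsForm.functional_apply, Fin.update_cons_zero] at this
    rw [add_comm ν μ]
    exact this
  simp only [contr_d q h, map_sub, contr_lieD, hbr]
  cases q with
  | zero => simp [triv_d_zero, triv_lieD_zero]
  | succ q =>
    have hc : contr y ν q (contr x μ (q + 1) γ) = -contr x μ q (contr y ν (q + 1) γ) := by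
      funext a z
      simp only [contr_apply, Pi.neg_apply]
      rw [h.skew.cons_cons]
    simp only [contr_d q (isForm_contr h _ _), hc, map_neg]
    abel

theorem isForm_d (q : ℕ) {γ : PreCochain N ℂ q} (h : IsForm γ) : IsForm ((triv N).d q γ) := by
  induction q with
  | zero => rw [triv_d_zero]; exact IsForm.zero
  | succ q ih =>
    have hx : ∀ x μ, IsForm (contr x μ (q + 1) ((triv N).d (q + 1) γ)) := by
      intro x μ
      rw [contr_d q h]
      exact (isForm_lieD h x μ).sub (ih (isForm_contr h x μ))
    have hcons : ∀ {α : Type} (a : Fin (q + 2) → α), ∃ x b, a = Fin.cons x b :=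
      fun a => ⟨a 0, Fin.tail a, (Fin.cons_self_tail a).symm⟩
    refine ⟨fun a z i x y => ?_, fun a z i p x => ?_, fun a z i j hij => ?_⟩
    · obtain ⟨u, a, rfl⟩ := hcons a
      obtain ⟨μ, z, rfl⟩ := hcons z
      refine Fin.cases ?_ (fun i => ?_) i
      · simp only [Fin.update_cons_zero, ← contr_apply]
        have : contr (x + y) μ (q + 1) ((triv N).d (q + 1) γ) =
            contr x μ (q + 1) ((triv N).d (q + 1) γ) + contr y μ (q + 1) ((triv N).d (q + 1) γ) := by
          simp only [contr_d q h, lieD_add_left h, contr_add_left h, map_add]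
          abel
        exact congrFun (congrFun this a) z
      · simpa only [contr_apply, Fin.cons_update] using (hx u μ).add a z i x y
    · obtain ⟨u, a, rfl⟩ := hcons a
      obtain ⟨μ, z, rfl⟩ := hcons z
      refine Fin.cases ?_ (fun i => ?_) i
      · simp only [Fin.update_cons_zero, Fin.cons_zero, ← contr_apply, ← smul_eq_mul]
        rw [← Pi.smul_apply, ← Pi.smul_apply]
        simp only [contr_d q h, lieD_smul_left h, contr_smul_left h, map_smul, smul_sub]
      · simpa only [contr_apply, Fin.cons_update, Fin.cons_succ] using (hx u μ).smul a z i p x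
    · obtain ⟨u, a, rfl⟩ := hcons a
      obtain ⟨μ, z, rfl⟩ := hcons z
      obtain ⟨j, rfl⟩ : ∃ j', j = Fin.succ j' := Fin.exists_succ_eq.2 (by grind) |>.imp
        fun _ h => h.symm
      revert hij
      refine Fin.cases ?_ (fun i => ?_) i
      · intro hij
        have hj : j = 0 := Fin.ext (by simp only [Fin.val_zero, Fin.val_succ] at hij ⊢; omega)
        subst hj
        obtain ⟨v, a, rfl⟩ : ∃ v b, a = Fin.cons v b :=
          ⟨a 0, Fin.tail a, (Fin.cons_self_tail a).symm⟩
        obtain ⟨ν, z, rfl⟩ : ∃ v b, z = Fin.cons v b :=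
          ⟨z 0, Fin.tail z, (Fin.cons_self_tail z).symm⟩
        rw [Fin.succ_zero_eq_one, cons_cons_comp_swap, cons_cons_comp_swap]
        exact congrFun (congrFun (contr_contr_d_comm q h v u ν μ) a) z
      · intro hij
        rw [cons_comp_swap, cons_comp_swap]
        exact (hx u μ).skew a z i j (by simpa using hij)

theorem ext_contr {q : ℕ} {γ δ : PreCochain N ℂ (q + 1)}
    (h : ∀ x μ, contr x μ q γ = contr x μ q δ) : γ = δ := by
  funext a z
  rw [← Fin.cons_self_tail a, ← Fin.cons_self_tail z]
  exact congrFun (congrFun (h _ _) _) _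

theorem lieD_d (q : ℕ) {γ : PreCochain N ℂ q} (h : IsForm γ) (x : gc N) (μ : ℂ) :
    (triv N).lieD x μ (q + 1) ((triv N).d q γ) = (triv N).d q ((triv N).lieD x μ q γ) := by
  induction q with
  | zero => simp [triv_d_zero]
  | succ q ih =>
    refine ext_contr fun y ν => ?_
    rw [contr_lieD, contr_d q h, contr_d q h, contr_d q (isForm_lieD h x μ), contr_lieD, map_sub,
      map_sub, ih (isForm_contr h y ν), ← lieD_lieD h]
    abel

/-- By Cartan's formula ιddγ = Ldγ - d(Lγ - dιγ). The first two terms cancel since L commutes with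
d, and ddιγ = 0 by induction. -/
theorem d_d (q : ℕ) {γ : PreCochain N ℂ q} (h : IsForm γ) :
    (triv N).d (q + 1) ((triv N).d q γ) = 0 := by
  induction q with
  | zero => simp [triv_d_zero]
  | succ q ih =>
    refine ext_contr fun y ν => ?_
    rw [contr_d (q + 1) (isForm_d _ h), contr_d q h, map_sub, ih (isForm_contr h y ν), lieD_d _ h]
    simp

end ConfModule

end Forms

/-! ### Polynomial functions of several complex variables -/

section PolynomialFunctions

/-- Polynomial functions of finitely many complex variables. -/
def IsPolyFun {q : ℕ} (f : (Fin q → ℂ) → ℂ) : Prop :=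
  ∃ p : MvPolynomial (Fin q) ℂ, ∀ z, f z = MvPolynomial.eval z p

namespace IsPolyFun

variable {q r : ℕ} {f g : (Fin q → ℂ) → ℂ}

theorem const (c : ℂ) : IsPolyFun fun _ : Fin q → ℂ => c := ⟨MvPolynomial.C c, by simp⟩

theorem coord (i : Fin q) : IsPolyFun fun z : Fin q → ℂ => z i := ⟨MvPolynomial.X i, by simp⟩

theorem add (hf : IsPolyFun f) (hg : IsPolyFun g) : IsPolyFun fun z => f z + g z := by
  obtain ⟨p, hp⟩ := hf
  obtain ⟨r, hr⟩ := hg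
  exact ⟨p + r, by simp [hp, hr]⟩

theorem mul (hf : IsPolyFun f) (hg : IsPolyFun g) : IsPolyFun fun z => f z * g z := by
  obtain ⟨p, hp⟩ := hf
  obtain ⟨r, hr⟩ := hg
  exact ⟨p * r, by simp [hp, hr]⟩

theorem pow (hf : IsPolyFun f) (n : ℕ) : IsPolyFun fun z => f z ^ n := by
  obtain ⟨p, hp⟩ := hf
  exact ⟨p ^ n, by simp [hp]⟩

theorem neg (hf : IsPolyFun f) : IsPolyFun fun z => -f z := by
  obtain ⟨p, hp⟩ := hf
  exact ⟨-p, by simp [hp]⟩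

theorem sub (hf : IsPolyFun f) (hg : IsPolyFun g) : IsPolyFun fun z => f z - g z := by
  simpa only [sub_eq_add_neg] using hf.add hg.neg

theorem sum {ι : Type*} (s : Finset ι) {f : ι → (Fin q → ℂ) → ℂ}
    (h : ∀ i ∈ s, IsPolyFun (f i)) : IsPolyFun fun z => ∑ i ∈ s, f i z := by
  induction s using Finset.cons_induction with
  | empty => simpa using const 0
  | cons i s hi ih =>
    simp only [Finset.sum_cons]
    exact (h i (by simp)).add (ih fun j hj => h j (by simp [hj]))

theorem comp (hf : IsPolyFun f) {w : (Fin r → ℂ) → Fin q → ℂ} (hw : ∀ i, IsPolyFun fun z => w z i) :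
    IsPolyFun fun z => f (w z) := by
  obtain ⟨p, hp⟩ := hf
  choose P hP using hw
  refine ⟨MvPolynomial.aeval P p, fun z => ?_⟩
  simp only [hp]
  induction p using MvPolynomial.induction_on generalizing f with
  | C a => simp
  | add p p' h h' => simp [h fun _ => rfl, h' fun _ => rfl]
  | mul_X p i h => simp [h fun _ => rfl, hP]

theorem differentiable (hf : IsPolyFun f) : Differentiable ℂ f := by
  obtain ⟨p, hp⟩ := hf
  rw [show f = fun z => MvPolynomial.eval z p from _root_.funext hp]
  clear hp
  induction p using MvPolynomial.induction_on with
  | C a => simp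
  | add p p' h h' => simpa using h.fun_add h'
  | mul_X p i h => simpa using h.fun_mul (differentiable_apply i)

theorem deriv_cons {f : (Fin (q + 1) → ℂ) → ℂ} (hf : IsPolyFun f) :
    IsPolyFun fun z : Fin q → ℂ => deriv (fun μ => f (Fin.cons μ z)) 0 := by
  obtain ⟨p, hp⟩ := hf
  have key : ∀ (z : Fin q → ℂ) (ν : ℂ), HasDerivAt (fun μ => f (Fin.cons μ z))
      (MvPolynomial.eval (Fin.cons ν z) (MvPolynomial.pderiv 0 p)) ν := by
    intro z ν
    simp only [hp]
    clear hp
    induction p using MvPolynomial.induction_on with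
    | C a => simpa using hasDerivAt_const ν a
    | add p p' h h' => simpa using h.fun_add h'
    | mul_X p i h =>
      have hX : HasDerivAt (fun μ : ℂ => (Fin.cons μ z : Fin (q + 1) → ℂ) i)
          (MvPolynomial.eval (Fin.cons ν z)
            (MvPolynomial.pderiv 0 (MvPolynomial.X i : MvPolynomial (Fin (q + 1)) ℂ))) ν := by
        refine Fin.cases ?_ (fun i => ?_) i
        · simpa using hasDerivAt_id' ν
        · simpa [MvPolynomial.pderiv_X] using hasDerivAt_const ν (z i)
      have := h.fun_mul hX
      simp only [MvPolynomial.eval_mul, MvPolynomial.eval_X, Derivation.leibniz, smul_eq_mul,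
        map_add] at this ⊢
      refine this.congr_deriv ?_
      ring
  have h0 : IsPolyFun fun z : Fin (q + 1) → ℂ => MvPolynomial.eval z (MvPolynomial.pderiv 0 p) :=
    ⟨_, fun _ => rfl⟩
  have := h0.comp (w := fun z : Fin q → ℂ => (Fin.cons 0 z : Fin (q + 1) → ℂ)) (fun i => by
    refine Fin.cases ?_ (fun i => ?_) i
    · simpa using const 0
    · simpa using coord i)
  convert this using 2 with z
  exact (key z 0).deriv

theorem _root_.MvPolynomial.sum_X_ne_zero :
    (∑ i : Fin (q + 1), MvPolynomial.X i : MvPolynomial (Fin (q + 1)) ℂ) ≠ 0 := by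
  intro h
  have := congrArg (MvPolynomial.eval (Pi.single 0 1)) h
  simp at this

/-- Polynomial functions that agree off the hyperplane `∑ zᵢ = 0` are equal. -/
theorem eq_of_sum_ne_zero {f g : (Fin (q + 1) → ℂ) → ℂ} (hf : IsPolyFun f) (hg : IsPolyFun g)
    (h : ∀ z, ∑ i, z i ≠ 0 → f z = g z) : f = g := by
  obtain ⟨p, hp⟩ := hf
  obtain ⟨r, hr⟩ := hg
  have : (∑ i : Fin (q + 1), MvPolynomial.X i) * (p - r) = 0 := by
    refine MvPolynomial.funext fun z => ?_
    simp only [map_mul, map_sum, MvPolynomial.eval_X, map_sub, map_zero, ← hp, ← hr, mul_eq_zero]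
    by_cases hz : ∑ i, z i = 0
    · exact Or.inl hz
    · exact Or.inr (sub_eq_zero.2 (h z hz))
  have := (mul_eq_zero.1 this).resolve_left MvPolynomial.sum_X_ne_zero
  rw [sub_eq_zero] at this
  funext z
  rw [hp, hr, this]

end IsPolyFun

end PolynomialFunctions

/-! ### The operators ∂ and D on cochains with trivial coefficients -/

section TrivialCochains

variable {N : ℕ}

namespace ConfModule

variable {q : ℕ} {γ : PreCochain N ℂ q}

theorem isPolyFun_iff {f : (Fin q → ℂ) → ℂ} : IsPolyFun f ↔ ∃ c : (Fin q →₀ ℕ) →₀ ℂ,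
    ∀ z : Fin q → ℂ, f z = c.sum fun k v => (∏ i, z i ^ k i) • v := by
  constructor
  · rintro ⟨p, hp⟩
    refine ⟨Finsupp.onFinset p.support (fun k => p.coeff k) (by simp), fun z => ?_⟩
    rw [hp, MvPolynomial.eval_eq', Finsupp.onFinset_sum _ (by simp)]
    exact Finset.sum_congr rfl fun k _ => mul_comm _ _
  · rintro ⟨c, hc⟩
    refine ⟨c.sum fun k v => MvPolynomial.monomial k v, fun z => ?_⟩
    rw [hc, Finsupp.sum, Finsupp.sum, map_sum]
    refine Finset.sum_congr rfl fun k _ => ?_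
    rw [MvPolynomial.eval_monomial, Finsupp.prod_fintype _ _ (by simp), smul_eq_mul, mul_comm]

/-- Separates the algebraic conditions, for which Cartan calculus suffices, from polynomial
dependence on the λᵢ. -/
theorem mem_cochains_iff :
    γ ∈ (triv N).cochains q ↔ IsForm γ ∧ ∀ a, IsPolyFun (γ a) := by
  constructor
  · rintro ⟨h1, h2, h3, h4⟩
    have hadd : ∀ a z i x y, γ (Function.update a i (x + y)) z =
        γ (Function.update a i x) z + γ (Function.update a i y) z := by
      intro a z i x y
      obtain ⟨f, hf⟩ := h1 z
      simp only [hf, f.map_update_add]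
    refine ⟨⟨hadd, fun a z i p x => ?_, h4⟩, fun a => isPolyFun_iff.2 (h2 a)⟩
    let φ : gc N →ₗ[ℂ] ℂ :=
      { toFun := fun x => γ (Function.update a i x) z
        map_add' := hadd a z i
        map_smul' := fun c x => by
          obtain ⟨f, hf⟩ := h1 z
          simp only [hf, f.map_update_smul, RingHom.id_apply] }
    refine map_polySMul_of_conformal φ (fun b => ?_) p x
    have := h3 (Function.update a i b) z i
    simpa [φ] using this
  · rintro ⟨h, hp⟩
    refine ⟨h.exists_multilinearMap, fun a => isPolyFun_iff.1 (hp a), fun a z i => ?_, h.skew⟩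
    have := h.smul a z i X (a i)
    simpa using this

theorem isForm_of_mem (h : γ ∈ (triv N).cochains q) : IsForm γ := (mem_cochains_iff.1 h).1

theorem isPolyFun_of_mem (h : γ ∈ (triv N).cochains q) (a : Fin q → gc N) : IsPolyFun (γ a) :=
  (mem_cochains_iff.1 h).2 a

/-- Needed because the differential inserts brackets, which themselves depend on the λᵢ. -/
theorem isPolyFun_update (h : γ ∈ (triv N).cochains q) {r : ℕ} (b : Fin q → gc N) (k : Fin q)
    {f : ℂ → gc N} (hf : f ∈ polyMaps (gc N)) {u : (Fin r → ℂ) → ℂ} (hu : IsPolyFun u)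
    {w : (Fin r → ℂ) → Fin q → ℂ} (hw : ∀ i, IsPolyFun fun z => w z i) :
    IsPolyFun fun z => γ (Function.update b k (f (u z))) (w z) := by
  have hγ := isForm_of_mem h
  induction hf using Submodule.span_induction with
  | mem f hf =>
    obtain ⟨⟨n, c⟩, rfl⟩ := hf
    simp only [hγ.csmul]
    exact (hu.pow n).mul ((isPolyFun_of_mem h _).comp hw)
  | zero => simpa [hγ.update_zero] using IsPolyFun.const 0
  | add f g _ _ hf hg => simpa only [Pi.add_apply, hγ.add] using hf.add hg
  | smul c f _ hf => simpa only [Pi.smul_apply, hγ.csmul] using (IsPolyFun.const c).mul hf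

theorem triv_d_succ_apply (γ : PreCochain N ℂ (q + 1)) (a : Fin (q + 2) → gc N)
    (z : Fin (q + 2) → ℂ) :
    (triv N).d (q + 1) γ a z = ∑ j : Fin (q + 2), ∑ i : Fin (q + 1),
            if i.castSucc < j then
              (-1 : ℂ) ^ ((i : ℕ) + (j : ℕ)) *
                γ (Fin.cons (bracket (z i.castSucc) (a i.castSucc) (a j))
                    (i.removeNth (j.removeNth a)))
                  (Fin.cons (z i.castSucc + z j) (i.removeNth (j.removeNth z)))
            else 0 := by
  simp [d_succ_apply, scalarModule]

theorem d_mem (h : γ ∈ (triv N).cochains q) : (triv N).d q γ ∈ (triv N).cochains (q + 1) := by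
  refine mem_cochains_iff.2 ⟨isForm_d q (isForm_of_mem h), fun a => ?_⟩
  cases q with
  | zero => rw [triv_d_zero]; exact IsPolyFun.const 0
  | succ q =>
    rw [show (triv N).d (q + 1) γ a = _ from _root_.funext fun z => triv_d_succ_apply γ a z]
    refine IsPolyFun.sum _ fun j _ => IsPolyFun.sum _ fun i _ => ?_
    split_ifs with hij
    · refine (IsPolyFun.const _).mul ?_
      have := isPolyFun_update h (Fin.cons 0 (i.removeNth (j.removeNth a))) 0
        (bracket_mem_polyMaps (a i.castSucc) (a j)) (IsPolyFun.coord i.castSucc)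
        (w := fun z : Fin (q + 2) → ℂ =>
          Fin.cons (z i.castSucc + z j) (i.removeNth (j.removeNth z)))
        (fun k => by
          refine Fin.cases ?_ (fun k => ?_) k
          · simpa using (IsPolyFun.coord i.castSucc).add (IsPolyFun.coord j)
          · simpa [Fin.removeNth_apply] using IsPolyFun.coord _)
      simpa only [Fin.update_cons_zero] using this
    · exact IsPolyFun.const 0

theorem triv_del_apply (γ : PreCochain N ℂ q) (a : Fin q → gc N) (z : Fin q → ℂ) :
    (triv N).del q γ a z = (∑ i, z i) * γ a z := by
  simp [del, scalarModule]

theorem del_mem (h : γ ∈ (triv N).cochains q) : (triv N).del q γ ∈ (triv N).cochains q := by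
  obtain ⟨h, hp⟩ := mem_cochains_iff.1 h
  refine mem_cochains_iff.2 ⟨⟨fun a z i x y => ?_, fun a z i p x => ?_, fun a z i j hij => ?_⟩,
    fun a => ?_⟩
  · simp only [triv_del_apply, h.add, mul_add]
  · simp only [triv_del_apply, h.smul]
    ring
  · simp only [triv_del_apply, h.skew _ _ _ _ hij, Function.comp_apply, mul_neg,
      Equiv.sum_comp (Equiv.swap i j) z]
  · rw [show (triv N).del q γ a = _ from _root_.funext fun z => triv_del_apply γ a z]
    exact (IsPolyFun.sum _ fun i _ => IsPolyFun.coord i).mul (hp a)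

theorem contr_mem {γ : PreCochain N ℂ (q + 1)} (h : γ ∈ (triv N).cochains (q + 1)) (x : gc N)
    (μ : ℂ) : contr x μ q γ ∈ (triv N).cochains q := by
  refine mem_cochains_iff.2 ⟨isForm_contr (isForm_of_mem h) x μ, fun a => ?_⟩
  refine (isPolyFun_of_mem h (Fin.cons x a)).comp
    (w := fun z : Fin q → ℂ => (Fin.cons μ z : Fin (q + 1) → ℂ)) fun i => ?_
  refine Fin.cases ?_ (fun i => ?_) i
  · simpa using IsPolyFun.const μ
  · simpa using IsPolyFun.coord i

/-- J^1_I replaces each aᵢ in turn by ∂aᵢ, which multiplies the value by -λᵢ. So ∂ is a Lie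
derivative, null-homotopic and commuting with d. -/
theorem lieD_J_one (h : IsForm γ) : (triv N).lieD (J 1 1) 0 q γ = (triv N).del q γ := by
  funext a z
  have : ∀ i, γ (Function.update a i ((X : ℂ[X]) • a i)) z = -(z i) * γ a z := by
    intro i
    rw [h.smul, Function.update_eq_self, eval_X]
  simp [triv_lieD_apply, bracket_J_one_one_at_zero, triv_del_apply, this, Finset.sum_mul]

theorem lieD_J_zero (h : IsForm γ) : (triv N).lieD (J 0 1) 0 q γ = 0 := by
  funext a z
  simp [triv_lieD_apply, bracket_J_zero_one_at_zero, h.update_zero]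

theorem del_d (h : IsForm γ) :
    (triv N).del (q + 1) ((triv N).d q γ) = (triv N).d q ((triv N).del q γ) := by
  rw [← lieD_J_one (isForm_d q h), lieD_d q h, lieD_J_one h]

/-- The derivation of the complex of cochains induced by `lower`. -/
def lowerD (q : ℕ) : PreCochain N ℂ q →ₗ[ℂ] PreCochain N ℂ q where
  toFun γ a z := ∑ i, γ (Function.update a i (lower (a i))) z
  map_add' γ δ := by
    funext a z
    simp [Finset.sum_add_distrib]
  map_smul' c γ := by
    funext a z
    simp [Finset.mul_sum]

theorem lowerD_apply (γ : PreCochain N ℂ q) (a : Fin q → gc N) (z : Fin q → ℂ) :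
    lowerD q γ a z = ∑ i, γ (Function.update a i (lower (a i))) z := rfl

theorem lowerD_del (γ : PreCochain N ℂ q) :
    lowerD q ((triv N).del q γ) = (triv N).del q (lowerD q γ) := by
  funext a z
  simp only [lowerD_apply, triv_del_apply, Finset.mul_sum]

/-- The coefficient of `μ` in the contraction with `J^0_I` at `λ = μ`. -/
def contrDeriv (γ : PreCochain N ℂ (q + 1)) : PreCochain N ℂ q :=
  fun a z => deriv (fun μ : ℂ => contr (J 0 1) μ q γ a z) 0

theorem differentiable_contr {γ : PreCochain N ℂ (q + 1)} (h : γ ∈ (triv N).cochains (q + 1))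
    (x : gc N) (a : Fin q → gc N) (z : Fin q → ℂ) :
    Differentiable ℂ fun μ : ℂ => contr x μ q γ a z := by
  refine (isPolyFun_of_mem h (Fin.cons x a)).differentiable.comp
    (differentiable_pi.2 fun i => ?_)
  refine Fin.cases ?_ (fun i => ?_) i
  · simp
  · simp

theorem hasDerivAt_contr {γ : PreCochain N ℂ (q + 1)} (h : γ ∈ (triv N).cochains (q + 1))
    (a : Fin q → gc N) (z : Fin q → ℂ) :
    HasDerivAt (fun μ : ℂ => contr (J 0 1) μ q γ a z) (contrDeriv γ a z) 0 :=
  (differentiable_contr h _ a z 0).hasDerivAt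

theorem contrDeriv_mem {γ : PreCochain N ℂ (q + 1)} (h : γ ∈ (triv N).cochains (q + 1)) :
    contrDeriv γ ∈ (triv N).cochains q := by
  have hf : ∀ μ, IsForm (contr (J 0 1) μ q γ) := fun μ => isForm_contr (isForm_of_mem h) _ μ
  refine mem_cochains_iff.2 ⟨⟨fun a z i x y => ?_, fun a z i p x => ?_, fun a z i j hij => ?_⟩,
    fun a => (isPolyFun_of_mem h (Fin.cons (J 0 1) a)).deriv_cons⟩
  · refine HasDerivAt.unique (hasDerivAt_contr h _ _) ?_
    simp only [(hf _).add]
    exact (hasDerivAt_contr h _ _).add (hasDerivAt_contr h _ _)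
  · refine HasDerivAt.unique (hasDerivAt_contr h _ _) ?_
    simp only [(hf _).smul]
    exact (hasDerivAt_contr h _ _).const_mul _
  · refine HasDerivAt.unique (hasDerivAt_contr h _ _) ?_
    simp only [(hf _).skew _ _ _ _ hij]
    exact (hasDerivAt_contr h _ _).neg

theorem hasDerivAt_d {Γ : ℂ → PreCochain N ℂ q} {Γ' : PreCochain N ℂ q}
    (h : ∀ a z, HasDerivAt (fun μ => Γ μ a z) (Γ' a z) 0) (a : Fin (q + 1) → gc N)
    (z : Fin (q + 1) → ℂ) :
    HasDerivAt (fun μ => (triv N).d q (Γ μ) a z) ((triv N).d q Γ' a z) 0 := by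
  cases q with
  | zero => simpa [triv_d_zero] using hasDerivAt_const (0 : ℂ) (0 : ℂ)
  | succ q =>
    simp only [triv_d_succ_apply]
    refine HasDerivAt.fun_sum fun j _ => HasDerivAt.fun_sum fun i _ => ?_
    split_ifs
    · exact (h _ _).const_mul _
    · exact hasDerivAt_const _ _

/-- The bracket with J^0_I vanishes at μ = 0, so the shift of λᵢ by μ does not contribute to the
derivative; only the linear term `lower` of the bracket does. -/
theorem hasDerivAt_lieD (h : γ ∈ (triv N).cochains q) (a : Fin q → gc N) (z : Fin q → ℂ) :
    HasDerivAt (fun μ => (triv N).lieD (J 0 1) μ q γ a z) (-lowerD q γ a z) 0 := by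
  have hγ := isForm_of_mem h
  simp only [triv_lieD_apply, lowerD_apply]
  refine (HasDerivAt.fun_sum fun i _ => ?_).neg
  obtain ⟨f, hf, hb⟩ := bracket_J_zero_one (a i)
  have hdiff : ∀ {f : ℂ → gc N}, f ∈ polyMaps (gc N) → Differentiable ℂ
      fun μ => γ (Function.update a i (f μ)) (Function.update z i (μ + z i)) := by
    intro f hf
    have := isPolyFun_update h a i hf (IsPolyFun.coord (0 : Fin 1))
      (w := fun v : Fin 1 → ℂ => Function.update z i (v 0 + z i)) (fun k => by
        rcases eq_or_ne k i with rfl | hk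
        · simpa using (IsPolyFun.coord (0 : Fin 1)).add (IsPolyFun.const (z k))
        · simpa [Function.update_of_ne hk] using IsPolyFun.const (z k))
    exact this.differentiable.comp (differentiable_pi.2 fun _ => differentiable_id)
  simp only [hb, hγ.add, hγ.csmul]
  have h1 := (hasDerivAt_id' (0 : ℂ)).fun_mul (hdiff (const_mem_polyMaps (lower (a i))) 0).hasDerivAt
  have h2 := (hasDerivAt_pow 2 (0 : ℂ)).fun_mul (hdiff hf 0).hasDerivAt
  simpa using h1.fun_add h2

/-- The derivative of Cartan's formula for J^0_I at μ = 0: a null-homotopy of -D. -/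
theorem contrDeriv_d {γ : PreCochain N ℂ (q + 1)} (h : γ ∈ (triv N).cochains (q + 1)) :
    contrDeriv ((triv N).d (q + 1) γ) + (triv N).d q (contrDeriv γ) = -lowerD (q + 1) γ := by
  funext a z
  refine HasDerivAt.unique ?_ (hasDerivAt_lieD h a z)
  have := (hasDerivAt_contr (d_mem h) a z).add (hasDerivAt_d (hasDerivAt_contr h) a z)
  refine this.congr_of_eventuallyEq (Filter.Eventually.of_forall fun μ => ?_)
  exact (congrFun (congrFun ((triv N).contr_d_add_d_contr (J 0 1) μ q (isForm_of_mem h).skew) a)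
    z).symm

/-- Before contraction ∂ multiplies by μ + ∑ λᵢ, and the product rule applied to the factor μ leaves
the contraction at 0. -/
theorem contrDeriv_del {γ : PreCochain N ℂ (q + 1)} (h : γ ∈ (triv N).cochains (q + 1)) :
    contrDeriv ((triv N).del (q + 1) γ) =
      (triv N).del q (contrDeriv γ) + contr (J 0 1) 0 q γ := by
  funext a z
  refine HasDerivAt.unique (hasDerivAt_contr (del_mem h) a z) ?_
  have hfun : (fun μ : ℂ => contr (J 0 1) μ q ((triv N).del (q + 1) γ) a z) =
      fun μ => (μ + ∑ i, z i) * contr (J 0 1) μ q γ a z := by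
    funext μ
    simp [triv_del_apply, Fin.sum_univ_succ]
  rw [hfun]
  have := ((hasDerivAt_id' (0 : ℂ)).add_const (∑ i, z i)).fun_mul (hasDerivAt_contr h a z)
  refine this.congr_deriv ?_
  simp only [Pi.add_apply, triv_del_apply]
  ring

/-- In positive degree the homotopy formula expresses D through operators that preserve cochains. -/
theorem lowerD_mem (h : γ ∈ (triv N).cochains q) : lowerD q γ ∈ (triv N).cochains q := by
  cases q with
  | zero =>
    have : lowerD 0 γ = 0 := by
      funext a z
      simp [lowerD_apply]
    rw [this]
    exact zero_mem _
  | succ q =>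
    rw [← neg_neg (lowerD (q + 1) γ), ← contrDeriv_d h]
    exact neg_mem (add_mem (contrDeriv_mem (d_mem h)) (d_mem (contrDeriv_mem h)))

theorem contrDeriv_zero : contrDeriv (0 : PreCochain N ℂ (q + 1)) = 0 := by
  funext a z
  simp [contrDeriv]

theorem lowerD_d {γ : PreCochain N ℂ (q + 1)} (h : γ ∈ (triv N).cochains (q + 1)) :
    lowerD (q + 2) ((triv N).d (q + 1) γ) = (triv N).d (q + 1) (lowerD (q + 1) γ) := by
  have h1 := contrDeriv_d (d_mem h)
  have h2 := congrArg ((triv N).d (q + 1)) (contrDeriv_d h)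
  rw [d_d _ (isForm_of_mem h), contrDeriv_zero, zero_add] at h1
  rw [map_add, d_d _ (isForm_of_mem (contrDeriv_mem h)), add_zero, map_neg] at h2
  rw [← neg_inj, ← h1, h2]

end ConfModule

end TrivialCochains

/-! ### Cochains given by their values on generators -/

section Generators

variable {N : ℕ}

/-- The generator `J^n_{E_ij}`. -/
def gen (k : ℕ × Fin N × Fin N) : gc N := Finsupp.single k 1

theorem J_single_eq_gen (n : ℕ) (i j : Fin N) :
    J n (Matrix.single i j (1 : ℂ)) = gen (n, i, j) := J_single n i j

theorem single_eq_smul_gen (k : ℕ × Fin N × Fin N) (p : ℂ[X]) :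
    (Finsupp.single k p : gc N) = p • gen k := by
  simp [gen]

theorem lower_gen (k : ℕ × Fin N × Fin N) :
    lower (gen k) = (k.1 : ℂ) • gen (k.1 - 1, k.2) := by
  rw [smul_eq_C_smul, gen, gen, ← Prod.mk.eta (p := k), lower_single]
  simp

/-- The arguments are reduced to generators one at a time: a coefficient p(∂) comes out as the
scalar p(-λᵢ), so a fixed point z suffices. -/
theorem IsForm.eq_zero_of_gen {q : ℕ} {γ : PreCochain N ℂ q} (h : IsForm γ) {z : Fin q → ℂ}
    (hγ : ∀ k : Fin q → ℕ × Fin N × Fin N, γ (fun i => gen (k i)) z = 0) (a : Fin q → gc N) :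
    γ a z = 0 := by
  have key : ∀ (s : Finset (Fin q)) (a : Fin q → gc N), (∀ i ∉ s, ∃ k, a i = gen k) →
      γ a z = 0 := by
    intro s
    induction s using Finset.cons_induction with
    | empty =>
      intro a ha
      choose k hk using fun i => ha i (by simp)
      rw [show a = fun i => gen (k i) from _root_.funext hk, hγ]
    | cons i s hi ih =>
      intro a ha
      have : ∀ x, γ (Function.update a i x) z = 0 := by
        intro x
        induction x using Finsupp.induction_linear with
        | zero => exact h.update_zero a z i
        | add f g hf hg => rw [h.add, hf, hg, add_zero]
        | single k p =>
          rw [single_eq_smul_gen, h.smul, ih _ fun j hj => ?_, mul_zero]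
          rcases eq_or_ne j i with rfl | hji
          · exact ⟨k, by simp⟩
          · rw [Function.update_of_ne hji]
            exact ha j (by simp [hji, hj])
      simpa using this (a i)
  exact key Finset.univ a (by simp)

/-- The functional on `gc N` with prescribed values on the generators, on which `∂` acts as `-z`. -/
def conformalFunctional (z : ℂ) (c : ℕ × Fin N × Fin N → ℂ) : gc N →ₗ[ℂ] ℂ :=
  Finsupp.lsum ℂ fun k => c k • Polynomial.leval (-z)

theorem conformalFunctional_single (z : ℂ) (c : ℕ × Fin N × Fin N → ℂ) (k : ℕ × Fin N × Fin N)
    (p : ℂ[X]) : conformalFunctional z c (Finsupp.single k p) = c k * p.eval (-z) := by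
  simp [conformalFunctional]

theorem conformalFunctional_gen (z : ℂ) (c : ℕ × Fin N × Fin N → ℂ) (k : ℕ × Fin N × Fin N) :
    conformalFunctional z c (gen k) = c k := by
  simp [gen, conformalFunctional_single]

theorem conformalFunctional_smul (z : ℂ) (c : ℕ × Fin N × Fin N → ℂ) (p : ℂ[X]) (a : gc N) :
    conformalFunctional z c (p • a) = p.eval (-z) * conformalFunctional z c a := by
  induction a using Finsupp.induction_linear with
  | zero => simp
  | add f g hf hg => rw [smul_add, map_add, hf, hg, map_add, mul_add]
  | single k r =>
    rw [Finsupp.smul_single, conformalFunctional_single, conformalFunctional_single, smul_eq_mul,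
      eval_mul]
    ring

theorem conformalFunctional_apply (z : ℂ) (c : ℕ × Fin N × Fin N → ℂ) (a : gc N) :
    conformalFunctional z c a = ∑ k ∈ a.support, c k * (a k).eval (-z) := by
  simp [conformalFunctional, Finsupp.lsum_apply, Finsupp.sum]

theorem conformalFunctional_J (z : ℂ) (c : ℕ × Fin N × Fin N → ℂ) (n : ℕ)
    (A : Matrix (Fin N) (Fin N) ℂ) :
    conformalFunctional z c (J n A) = ∑ i, ∑ j, c (n, i, j) * A i j := by
  simp [J, conformalFunctional_single]

theorem conformalFunctional_add_left (z : ℂ) (c e : ℕ × Fin N × Fin N → ℂ) (a : gc N) :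
    conformalFunctional z (fun k => c k + e k) a =
      conformalFunctional z c a + conformalFunctional z e a := by
  simp [conformalFunctional_apply, add_mul, Finset.sum_add_distrib]

theorem conformalFunctional_mul_left (z r : ℂ) (c : ℕ × Fin N × Fin N → ℂ) (a : gc N) :
    conformalFunctional z (fun k => r * c k) a = r * conformalFunctional z c a := by
  simp [conformalFunctional_apply, Finset.mul_sum, mul_assoc]

theorem isPolyFun_eval_neg {q : ℕ} (p : ℂ[X]) (i : Fin q) :
    IsPolyFun fun z : Fin q → ℂ => p.eval (-(z i)) := by
  induction p using Polynomial.induction_on' with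
  | add p r hp hr => simpa using hp.add hr
  | monomial n c => simpa using (IsPolyFun.const c).mul ((IsPolyFun.coord i).neg.pow n)

theorem isPolyFun_eval {q : ℕ} (p : ℂ[X]) {f : (Fin q → ℂ) → ℂ} (hf : IsPolyFun f) :
    IsPolyFun fun z : Fin q → ℂ => p.eval (f z) := by
  induction p using Polynomial.induction_on' with
  | add p r hp hr => simpa using hp.add hr
  | monomial n c => simpa using (IsPolyFun.const c).mul (hf.pow n)

namespace ConfModule

/-- The `1`-cochain with the prescribed constant values on the generators. -/
def cochainOne (c : ℕ × Fin N × Fin N → ℂ) : PreCochain N ℂ 1 :=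
  fun a z => conformalFunctional (z 0) c (a 0)

theorem cochainOne_mem (c : ℕ × Fin N × Fin N → ℂ) : cochainOne c ∈ (triv N).cochains 1 := by
  refine mem_cochains_iff.2 ⟨⟨fun a z i x y => ?_, fun a z i p x => ?_, fun a z i j hij => ?_⟩,
    fun a => ?_⟩
  · fin_cases i
    simp [cochainOne]
  · fin_cases i
    simp [cochainOne, conformalFunctional_smul]
  · omega
  · rw [show cochainOne c a = _ from _root_.funext fun z => conformalFunctional_apply _ c (a 0)]
    exact IsPolyFun.sum _ fun k _ => (IsPolyFun.const _).mul (isPolyFun_eval_neg _ _)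

/-- The `2`-cochain whose values on the generators are prescribed polynomials in
`(λ₁ - λ₂) / 2`. -/
def cochainTwo (c : ℕ × Fin N × Fin N → ℕ × Fin N × Fin N → ℂ[X]) : PreCochain N ℂ 2 :=
  fun a z => conformalFunctional (z 0) (fun k => conformalFunctional (z 1)
    (fun l => (c k l).eval ((z 0 - z 1) / 2)) (a 1)) (a 0)

theorem cochainTwo_mem {c : ℕ × Fin N × Fin N → ℕ × Fin N × Fin N → ℂ[X]}
    (hc : ∀ k l t, (c k l).eval (-t) = -(c l k).eval t) :
    cochainTwo c ∈ (triv N).cochains 2 := by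
  have happ : ∀ a z, cochainTwo c a z = ∑ k ∈ (a 0).support, ∑ l ∈ (a 1).support,
      (c k l).eval ((z 0 - z 1) / 2) * ((a 1) l).eval (-(z 1)) * ((a 0) k).eval (-(z 0)) := by
    intro a z
    simp only [cochainTwo, conformalFunctional_apply, Finset.sum_mul]
  refine mem_cochains_iff.2 ⟨⟨fun a z i x y => ?_, fun a z i p x => ?_, fun a z i j hij => ?_⟩,
    fun a => ?_⟩
  · fin_cases i
    · simp [cochainTwo]
    · simp [cochainTwo]
      exact conformalFunctional_add_left _ _ _ _
  · fin_cases i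
    · simp [cochainTwo, conformalFunctional_smul]
    · simp [cochainTwo, conformalFunctional_smul]
      exact conformalFunctional_mul_left _ _ _ _
  · obtain ⟨rfl, rfl⟩ : i = 0 ∧ j = 1 := by omega
    simp only [happ, Function.comp_apply, Equiv.swap_apply_left, Equiv.swap_apply_right]
    rw [Finset.sum_comm, ← Finset.sum_neg_distrib]
    refine Finset.sum_congr rfl fun k _ => ?_
    rw [← Finset.sum_neg_distrib]
    refine Finset.sum_congr rfl fun l _ => ?_
    rw [show (z 1 - z 0) / 2 = -((z 0 - z 1) / 2) by ring, hc]
    ring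
  · rw [show cochainTwo c a = _ from _root_.funext (happ a)]
    refine IsPolyFun.sum _ fun k _ => IsPolyFun.sum _ fun l _ =>
      ((isPolyFun_eval _ ?_).mul (isPolyFun_eval_neg _ _)).mul (isPolyFun_eval_neg _ _)
    simpa only [div_eq_mul_inv] using
      ((IsPolyFun.coord (0 : Fin 2)).sub (IsPolyFun.coord 1)).mul (IsPolyFun.const 2⁻¹)

theorem cochainTwo_gen (c : ℕ × Fin N × Fin N → ℕ × Fin N × Fin N → ℂ[X])
    (k l : ℕ × Fin N × Fin N) (z : Fin 2 → ℂ) :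
    cochainTwo c ![gen k, gen l] z = (c k l).eval ((z 0 - z 1) / 2) := by
  simp [cochainTwo, conformalFunctional_gen]

end ConfModule

end Generators

/-! ### Divisibility by ∂ and the regular sequence ∂, D -/

section Division

variable {N : ℕ}

/-- The substitution X₀ ↦ -(X₁ + ⋯ + X_q) is the identity modulo ∑ Xᵢ, and by hypothesis it sends p
to 0. -/
theorem MvPolynomial.sum_X_dvd {q : ℕ} {p : MvPolynomial (Fin (q + 1)) ℂ}
    (h : ∀ z : Fin (q + 1) → ℂ, ∑ i, z i = 0 → MvPolynomial.eval z p = 0) :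
    (∑ i, MvPolynomial.X i) ∣ p := by
  let g : Fin (q + 1) → MvPolynomial (Fin (q + 1)) ℂ :=
    Fin.cons (-∑ i : Fin q, MvPolynomial.X i.succ) fun i => MvPolynomial.X i.succ
  have hg : MvPolynomial.aeval g p = 0 := by
    refine MvPolynomial.funext fun z => ?_
    have : MvPolynomial.eval z (MvPolynomial.aeval g p) =
        MvPolynomial.eval (fun i => MvPolynomial.eval z (g i)) p := by
      clear h
      induction p using MvPolynomial.induction_on with
      | C a => simp
      | add p p' h h' => simp only [map_add, h, h']
      | mul_X p i h =>
        simp only [map_mul, h, MvPolynomial.aeval_X, MvPolynomial.eval_X]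
    rw [this, h, map_zero]
    simp [g, Fin.sum_univ_succ]
  let I : Ideal (MvPolynomial (Fin (q + 1)) ℂ) := Ideal.span {∑ i, MvPolynomial.X i}
  have hI : (Ideal.Quotient.mkₐ ℂ I).comp (MvPolynomial.aeval g) = Ideal.Quotient.mkₐ ℂ I := by
    refine MvPolynomial.algHom_ext fun i => ?_
    simp only [AlgHom.comp_apply, MvPolynomial.aeval_X, Ideal.Quotient.mkₐ_eq_mk]
    refine Fin.cases ?_ (fun i => ?_) i
    · refine Ideal.Quotient.eq.2 (Ideal.mem_span_singleton.2 ⟨-1, ?_⟩)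
      simp only [g, Fin.cons_zero, Fin.sum_univ_succ (n := q)]
      ring
    · simp [g]
  rw [← Ideal.mem_span_singleton, ← Ideal.Quotient.eq_zero_iff_mem]
  have := AlgHom.congr_fun hI p
  rw [AlgHom.comp_apply, hg, map_zero] at this
  exact this.symm

namespace ConfModule

variable {q : ℕ}

/-- A cochain that vanishes where `∑ λᵢ = 0` is divisible by `∂`. -/
theorem exists_del_eq {x : PreCochain N ℂ (q + 1)} (hx : x ∈ (triv N).cochains (q + 1))
    (h : ∀ a z, ∑ i, z i = 0 → x a z = 0) :
    ∃ ε ∈ (triv N).cochains (q + 1), (triv N).del (q + 1) ε = x := by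
  have hdiv : ∀ a, ∃ p : MvPolynomial (Fin (q + 1)) ℂ, ∀ z,
      x a z = (∑ i, z i) * MvPolynomial.eval z p := by
    intro a
    obtain ⟨p, hp⟩ := isPolyFun_of_mem hx a
    obtain ⟨r, rfl⟩ := MvPolynomial.sum_X_dvd fun z hz => (hp z).symm.trans (h a z hz)
    exact ⟨r, fun z => by simp [hp]⟩
  choose P hP using hdiv
  have hf := isForm_of_mem hx
  have hpoly : ∀ a, IsPolyFun fun z => MvPolynomial.eval z (P a) := fun a => ⟨P a, fun _ => rfl⟩
  refine ⟨fun a z => MvPolynomial.eval z (P a), mem_cochains_iff.2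
    ⟨⟨fun a z i u v => ?_, fun a z i p u => ?_, fun a z i j hij => ?_⟩, hpoly⟩, ?_⟩
  · refine congrFun (IsPolyFun.eq_of_sum_ne_zero (hpoly _) ((hpoly _).add (hpoly _))
      fun z hz => ?_) z
    refine mul_left_cancel₀ hz ?_
    simp only [mul_add, ← hP, hf.add]
  · refine congrFun (IsPolyFun.eq_of_sum_ne_zero (hpoly _)
      ((isPolyFun_eval_neg p i).mul (hpoly _)) fun z hz => ?_) z
    refine mul_left_cancel₀ hz ?_
    rw [mul_left_comm, ← hP, ← hP, hf.smul]
  · refine congrFun (IsPolyFun.eq_of_sum_ne_zero ((hpoly _).comp (w := fun z => z ∘ Equiv.swap i j)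
      fun k => IsPolyFun.coord _) (hpoly _).neg fun z hz => ?_) z
    refine mul_left_cancel₀ hz ?_
    rw [mul_neg, ← hP, ← hf.skew a z i j hij, hP]
    simp only [Function.comp_apply, Equiv.sum_comp (Equiv.swap i j) z]
  · funext a z
    rw [triv_del_apply, hP]

theorem eq_zero_of_del_eq_zero {x : PreCochain N ℂ (q + 1)} (hx : x ∈ (triv N).cochains (q + 1))
    (h : (triv N).del (q + 1) x = 0) : x = 0 := by
  funext a
  refine IsPolyFun.eq_of_sum_ne_zero (isPolyFun_of_mem hx a) (IsPolyFun.const 0) fun z hz => ?_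
  have := congrFun (congrFun h a) z
  rw [triv_del_apply] at this
  exact (mul_eq_zero.1 this).resolve_left hz

theorem eq_of_del_eq {x y : PreCochain N ℂ (q + 1)} (hx : x ∈ (triv N).cochains (q + 1))
    (hy : y ∈ (triv N).cochains (q + 1))
    (h : (triv N).del (q + 1) x = (triv N).del (q + 1) y) : x = y :=
  sub_eq_zero.1 (eq_zero_of_del_eq_zero (sub_mem hx hy) (by rw [map_sub, h, sub_self]))

theorem lower_update_gen {x : PreCochain N ℂ q} (hx : IsForm x) (k : Fin q → ℕ × Fin N × Fin N)
    (z : Fin q → ℂ) (i : Fin q) :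
    x (Function.update (fun i => gen (k i)) i (lower (gen (k i)))) z =
      (k i).1 * x (fun j => gen (Function.update k i ((k i).1 - 1, (k i).2) j)) z := by
  rw [lower_gen, hx.csmul]
  congr 2
  funext j
  rcases eq_or_ne j i with rfl | hj
  · simp
  · simp [Function.update_of_ne hj]

/-- `∂` and `lowerD` form a regular sequence on the cochains. -/
theorem exists_del_eq_of_lowerD_eq {x y : PreCochain N ℂ (q + 1)}
    (hx : x ∈ (triv N).cochains (q + 1))
    (h : lowerD (q + 1) x = (triv N).del (q + 1) y) :
    ∃ ε ∈ (triv N).cochains (q + 1), (triv N).del (q + 1) ε = x := by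
  refine exists_del_eq hx fun a z hz => ?_
  have hf := isForm_of_mem hx
  refine hf.eq_zero_of_gen (fun k => ?_) a
  -- Induction on the total degree of all arguments but the first. Raising the first degree by one
  -- and evaluating Dx there gives a nonzero multiple of the wanted value, plus values whose other
  -- degrees have a smaller sum.
  have key : ∀ (m : ℕ) (k : Fin (q + 1) → ℕ × Fin N × Fin N), ∑ i : Fin q, (k i.succ).1 = m →
      x (fun i => gen (k i)) z = 0 := by
    intro m
    induction m using Nat.strong_induction_on with
    | _ m ih =>
      intro k hk
      let k' := Function.update k 0 ((k 0).1 + 1, (k 0).2)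
      have h1 : lowerD (q + 1) x (fun i => gen (k' i)) z = 0 := by
        rw [h, triv_del_apply, hz, zero_mul]
      simp only [lowerD_apply, lower_update_gen hf] at h1
      rw [Fin.sum_univ_succ, Finset.sum_eq_zero, add_zero] at h1
      · have h2 : Function.update k' 0 ((k' 0).1 - 1, (k' 0).2) = k := by
          simp [k']
        rw [h2] at h1
        refine (mul_eq_zero.1 h1).resolve_left ?_
        simp only [k', Function.update_self]
        exact Nat.cast_ne_zero.2 (Nat.succ_ne_zero _)
      · intro i _
        have hki : ∀ j : Fin q, k' j.succ = k j.succ := fun j =>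
          Function.update_of_ne (Fin.succ_ne_zero j) _ _
        rcases Nat.eq_zero_or_pos (k' i.succ).1 with h0 | h0
        · simp [h0]
        · rw [ih (m - 1) (by
            have : (k i.succ).1 ≤ m := hk ▸ Finset.single_le_sum (f := fun j : Fin q => (k j.succ).1)
              (fun _ _ => Nat.zero_le _) (Finset.mem_univ i)
            rw [hki] at h0
            omega), mul_zero]
          rw [← hk, ← Finset.add_sum_erase _ _ (Finset.mem_univ i),
            ← Finset.add_sum_erase Finset.univ (fun j : Fin q => (k j.succ).1) (Finset.mem_univ i)]
          have : ∑ j ∈ Finset.univ.erase i, (Function.update k' i.succ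
              ((k' i.succ).1 - 1, (k' i.succ).2) j.succ).1 =
              ∑ j ∈ Finset.univ.erase i, (k j.succ).1 := by
            refine Finset.sum_congr rfl fun j hj => ?_
            rw [Function.update_of_ne, hki]
            simpa using Finset.ne_of_mem_erase hj
          rw [this, Function.update_self, hki]
          rw [hki] at h0
          omega
  exact key _ k rfl

/-- Cochains `x`, `y` with `lowerD x = ∂y` come from a common cochain. -/
theorem exists_del_eq_and_lowerD_eq {x y : PreCochain N ℂ (q + 1)}
    (hx : x ∈ (triv N).cochains (q + 1)) (hy : y ∈ (triv N).cochains (q + 1))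
    (h : lowerD (q + 1) x = (triv N).del (q + 1) y) :
    ∃ ε ∈ (triv N).cochains (q + 1), (triv N).del (q + 1) ε = x ∧ lowerD (q + 1) ε = y := by
  obtain ⟨ε, hε, rfl⟩ := exists_del_eq_of_lowerD_eq hx h
  exact ⟨ε, hε, rfl, eq_of_del_eq (lowerD_mem hε) hy (by rw [← lowerD_del, h])⟩

end ConfModule

end Division

/-! ### The differential on 1-cochains -/

section LowDegree

variable {N : ℕ}

namespace ConfModule

theorem triv_d_one_apply (γ : PreCochain N ℂ 1) (a b : gc N) (z w : ℂ) :
    (triv N).d 1 γ ![a, b] ![z, w] = -γ ![bracket z a b] ![z + w] := by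
  rw [triv_d_succ_apply, Fin.sum_univ_two]
  simp
  congr 1

theorem triv_d_two_apply (γ : PreCochain N ℂ 2) (a b c : gc N) (u v w : ℂ) :
    (triv N).d 2 γ ![a, b, c] ![u, v, w] =
      -γ ![bracket u a b, c] ![u + v, w] + γ ![bracket u a c, b] ![u + w, v]
        - γ ![bracket v b c, a] ![v + w, u] := by
  rw [triv_d_succ_apply, Fin.sum_univ_three]
  have h1 : ∀ {α : Type} (x y t : α), Fin.tail (Fin.removeNth 1 ![x, y, t]) = ![t] := by
    intro α x y t
    funext i
    fin_cases i
    rfl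
  have h2 : ∀ {α : Type} (x y t : α), Fin.tail (Fin.removeNth 2 ![x, y, t]) = ![y] := by
    intro α x y t
    funext i
    fin_cases i
    rfl
  have h3 : ∀ {α : Type} (x y t : α),
      (Fin.removeNth 1 (Fin.removeNth 2 ![x, y, t] : Fin 2 → α) : Fin 1 → α) = ![x] := by
    intro α x y t
    funext i
    fin_cases i
    rfl
  simp [Fin.sum_univ_two, h1, h2, h3]
  simp only [Matrix.vecCons]
  ring

/-- The differential is injective on `1`-cochains. -/
theorem eq_zero_of_d_one {γ : PreCochain N ℂ 1} (hγ : γ ∈ (triv N).cochains 1)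
    (h : (triv N).d 1 γ = 0) : γ = 0 := by
  have hf := isForm_of_mem hγ
  have hv : ∀ {α : Type} (a : Fin 1 → α) (x : α), Function.update a 0 x = ![x] := by
    intro α a x
    funext i
    fin_cases i
    simp
  let φ : ℂ → gc N →ₗ[ℂ] ℂ := fun z => hf.functional 0 ![z] 0
  have hφ : ∀ z x, φ z x = γ ![x] ![z] := fun z x => by
    simp only [φ, IsForm.functional_apply, hv]
  have key : ∀ n B z, φ z (J n B) = 0 := by
    intro n B z
    induction n using Nat.strong_induction_on with
    | _ n ih =>
      -- The bracket of J^0_I with J^{n+1}_B at λ = 1 is (n+1) J^n_B plus multiples of lower J^k_B;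
      -- the second variable z - 1 makes the sum of the variables z.
      have h1 : φ z (bracket 1 (J 0 1) (J (n + 1) B)) = 0 := by
        have := triv_d_one_apply γ (J 0 1) (J (n + 1) B) 1 (z - 1)
        rw [h, add_sub_cancel] at this
        rw [hφ]
        simpa using this
      have e : bracket 1 (J 0 1) (J (n + 1) B) = ((n : ℂ) + 1) • J n B -
          ∑ s ∈ Finset.range n, (((n + 1).choose (s + 1 + 1) : ℂ) * (-1) ^ (s + 1 + 1)) •
            J (0 + (n + 1) - (s + 1 + 1)) B := by
        rw [bracket_J, genBracket, Finset.sum_range_succ' _ (n + 1), Finset.sum_range_succ' _ n]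
        simp
        module
      rw [e, map_sub, map_smul, map_sum, Finset.sum_eq_zero, sub_zero, smul_eq_mul] at h1
      · exact (mul_eq_zero.1 h1).resolve_left (Nat.cast_add_one_ne_zero n)
      · intro s hs
        have := Finset.mem_range.1 hs
        rw [map_smul, ih (0 + (n + 1) - (s + 1 + 1)) (by omega), smul_zero]
  funext a z
  refine hf.eq_zero_of_gen (fun k => ?_) a
  have := key (k 0).1 (Matrix.single (k 0).2.1 (k 0).2.2 1) (z 0)
  rw [J_single_eq_gen, hφ] at this
  rw [← this]
  congr 1 <;> (funext i; fin_cases i; rfl)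

end ConfModule

end LowDegree

namespace ConfModule

/-! ### The descent from γ to its contractions; basic 2-cocycles -/

section Descent

variable {N q : ℕ}

theorem d_contr_J_one {γ : PreCochain N ℂ (q + 2)} (hγ : γ ∈ (triv N).cochains (q + 2))
    (h : (triv N).d (q + 2) γ = 0) :
    (triv N).d (q + 1) (contr (J 1 1) 0 (q + 1) γ) = (triv N).del (q + 2) γ := by
  have := (triv N).contr_d_add_d_contr (J 1 1) 0 (q + 1) (isForm_of_mem hγ).skew
  rwa [h, map_zero, zero_add, lieD_J_one (isForm_of_mem hγ)] at this

theorem d_contr_J_zero {γ : PreCochain N ℂ (q + 2)} (hγ : γ ∈ (triv N).cochains (q + 2))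
    (h : (triv N).d (q + 2) γ = 0) :
    (triv N).d (q + 1) (contr (J 0 1) 0 (q + 1) γ) = 0 := by
  have := (triv N).contr_d_add_d_contr (J 0 1) 0 (q + 1) (isForm_of_mem hγ).skew
  rwa [h, map_zero, zero_add, lieD_J_zero (isForm_of_mem hγ)] at this

/-- The homotopy formula for D applied to β, the contraction of γ with J^1_I. As dβ = ∂γ, the
derivative of ∂ yields the two remaining terms on the left. -/
theorem lowerD_contr_J_one {γ : PreCochain N ℂ (q + 2)} (hγ : γ ∈ (triv N).cochains (q + 2))
    (h : (triv N).d (q + 2) γ = 0) :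
    lowerD (q + 1) (contr (J 1 1) 0 (q + 1) γ) + (triv N).del (q + 1) (contrDeriv γ) +
      contr (J 0 1) 0 (q + 1) γ =
        -(triv N).d q (contrDeriv (contr (J 1 1) 0 (q + 1) γ)) := by
  have h1 := contrDeriv_d (contr_mem hγ (J 1 1) 0)
  rw [d_contr_J_one hγ h, contrDeriv_del hγ] at h1
  rw [eq_neg_iff_add_eq_zero, add_assoc (lowerD _ _), add_assoc (lowerD _ _), h1,
    add_neg_cancel]

/-- By the regular sequence β + x = ∂ε. Applying d gives ∂γ + ∂w = ∂dε, and ∂ can be cancelled. -/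
theorem exists_eq_d_sub {γ w : PreCochain N ℂ (q + 2)} {x y : PreCochain N ℂ (q + 1)}
    (hγ : γ ∈ (triv N).cochains (q + 2)) (hw : w ∈ (triv N).cochains (q + 2))
    (hx : x ∈ (triv N).cochains (q + 1))
    (h : (triv N).d (q + 2) γ = 0) (hxw : (triv N).d (q + 1) x = (triv N).del (q + 2) w)
    (hxy : lowerD (q + 1) (contr (J 1 1) 0 (q + 1) γ + x) = (triv N).del (q + 1) y) :
    ∃ ε ∈ (triv N).cochains (q + 1), γ = (triv N).d (q + 1) ε - w := by
  obtain ⟨ε, hε, he⟩ := exists_del_eq_of_lowerD_eq (add_mem (contr_mem hγ _ _) hx) hxy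
  refine ⟨ε, hε, eq_of_del_eq hγ (sub_mem (d_mem hε) hw) ?_⟩
  rw [map_sub, del_d (isForm_of_mem hε), he, map_add, d_contr_J_one hγ h, hxw, add_sub_cancel_right]

/-- Basic `2`-cocycles are coboundaries. -/
theorem exists_d_eq_two {γ : PreCochain N ℂ 2} (hγ : γ ∈ (triv N).cochains 2)
    (h : (triv N).d 2 γ = 0) : ∃ ε ∈ (triv N).cochains 1, γ = (triv N).d 1 ε := by
  have h1 := lowerD_contr_J_one hγ h
  -- The contraction with J^0_I is a 1-cocycle, hence 0, and d vanishes on 0-cochains. So Dβ is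
  -- divisible by ∂ without any correction.
  rw [eq_zero_of_d_one (contr_mem hγ _ _) (d_contr_J_zero hγ h), triv_d_zero, add_zero,
    LinearMap.zero_apply, neg_zero, add_eq_zero_iff_eq_neg, ← map_neg] at h1
  obtain ⟨ε, hε, he⟩ := exists_eq_d_sub (w := 0) (x := 0) hγ (zero_mem _) (zero_mem _) h
    (by simp) (by rw [add_zero, h1])
  exact ⟨ε, hε, by simpa using he⟩

end Descent

/-! ### The trace form τ, the cochain ψ and the cocycle e -/

section TraceForm

variable {N : ℕ}

/-- The `1`-cochain `J^n_A ↦ δ_{n,0} tr A`. -/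
def traceForm (N : ℕ) : PreCochain N ℂ 1 :=
  cochainOne fun k => if k.1 = 0 ∧ k.2.1 = k.2.2 then 1 else 0

theorem traceForm_mem : traceForm N ∈ (triv N).cochains 1 := cochainOne_mem _

theorem traceForm_smul (t : ℂ) (p : ℂ[X]) (x : gc N) :
    traceForm N ![p • x] ![t] = p.eval (-t) * traceForm N ![x] ![t] := by
  simp [traceForm, cochainOne, conformalFunctional_smul]

theorem traceForm_csmul (t c : ℂ) (x : gc N) :
    traceForm N ![c • x] ![t] = c * traceForm N ![x] ![t] := by
  rw [smul_eq_C_smul, traceForm_smul, eval_C]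

theorem traceForm_J (t : ℂ) (n : ℕ) (A : Matrix (Fin N) (Fin N) ℂ) :
    traceForm N ![J n A] ![t] = if n = 0 then A.trace else 0 := by
  simp only [traceForm, cochainOne, Matrix.cons_val_zero, conformalFunctional_J]
  split_ifs with h
  · simp [h, Matrix.trace]
  · simp [h]

/-- Only the J^0-component counts. It needs s = m + n, which is in range in the first sum when n = 0
and in the second when m = 0. -/
theorem traceForm_genBracket (t z : ℂ) (m n : ℕ) (A B : Matrix (Fin N) (Fin N) ℂ) :
    traceForm N ![genBracket z m A n B] ![t] =
      (A * B).trace * ((if n = 0 then (z - t) ^ m else 0) - if m = 0 then (-z) ^ n else 0) := by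
  have hlin : ∀ x : gc N, traceForm N ![x] ![t] =
      conformalFunctional t (fun k => if k.1 = 0 ∧ k.2.1 = k.2.2 then 1 else 0) x := fun _ => rfl
  rw [genBracket, hlin, map_sub, map_sum, map_sum, mul_sub]
  simp only [← hlin, traceForm_smul, traceForm_csmul, traceForm_J]
  congr 1
  · rw [Finset.sum_eq_single m]
    · split_ifs with h1 h2 h2
      · simp [mul_comm, sub_eq_add_neg]
      · omega
      · omega
      · simp
    · intro s hs hsm
      rw [if_neg, mul_zero]
      have := Finset.mem_range.1 hs
      omega
    · simp
  · rw [Finset.sum_eq_single n]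
    · split_ifs with h1 h2 h2
      · simp [mul_comm, Matrix.trace_mul_comm B A]
      · omega
      · omega
      · simp
    · intro s hs hsm
      rw [if_neg, mul_zero]
      have := Finset.mem_range.1 hs
      omega
    · simp

/-- The `2`-cochain that represents the generator of the reduced cohomology. -/
def psi (N : ℕ) : PreCochain N ℂ 2 :=
  cochainTwo fun k l => if k.2.2 = l.2.1 ∧ k.2.1 = l.2.2 then
    C ((-1 : ℂ) ^ l.1 * ((k.1.factorial : ℂ) * (l.1.factorial : ℂ) /
      ((k.1 + l.1 + 1).factorial : ℂ))) * X ^ (k.1 + l.1 + 1) else 0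

/-- The variable (λ₁ - λ₂)/2 equals λ at (λ, -λ) and changes sign under the exchange of λ₁ and λ₂.
With the sign (-1)^n and the symmetry of tr(AB) this gives exact skew-symmetry. -/
theorem psi_mem : psi N ∈ (triv N).cochains 2 := by
  refine cochainTwo_mem fun k l t => ?_
  by_cases h : k.2.2 = l.2.1 ∧ k.2.1 = l.2.2
  · rw [if_pos h, if_pos ⟨h.2.symm, h.1.symm⟩]
    simp only [eval_mul, eval_C, eval_pow, eval_X]
    rw [neg_pow t, add_comm l.1 k.1, pow_succ (-1 : ℂ), pow_add (-1 : ℂ)]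
    have : (-1 : ℂ) ^ l.1 * (-1) ^ l.1 = 1 := by rw [← mul_pow]; simp
    linear_combination (-(k.1.factorial : ℂ) * l.1.factorial / (k.1 + l.1 + 1).factorial
      * (-1) ^ k.1 * t ^ (k.1 + l.1 + 1)) * this
  · rw [if_neg h, if_neg fun h' => h ⟨h'.2.symm, h'.1.symm⟩]
    simp

theorem psi_J (m n : ℕ) (A B : Matrix (Fin N) (Fin N) ℂ) (z w : ℂ) :
    psi N ![J m A, J n B] ![z, w] =
      (-1) ^ n * ((m.factorial : ℂ) * (n.factorial : ℂ) / ((m + n + 1).factorial : ℂ)) *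
        (A * B).trace * ((z - w) / 2) ^ (m + n + 1) := by
  simp only [psi, cochainTwo, Matrix.cons_val_zero, Matrix.cons_val_one, conformalFunctional_J]
  have h : ∀ i j k l : Fin N, (eval ((z - w) / 2) (if j = k ∧ i = l then
      C ((-1 : ℂ) ^ n * ((m.factorial : ℂ) * (n.factorial : ℂ) /
      ((m + n + 1).factorial : ℂ))) * X ^ (m + n + 1) else 0) : ℂ) * B k l =
      if l = i then if k = j then (-1 : ℂ) ^ n * ((m.factorial : ℂ) * (n.factorial : ℂ) /
      ((m + n + 1).factorial : ℂ)) * ((z - w) / 2) ^ (m + n + 1) * B k l else 0 else 0 := by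
    intro i j k l
    rcases eq_or_ne l i with rfl | h1
    · rcases eq_or_ne k j with rfl | h2
      · simp
      · simp [h2, h2.symm]
    · simp [h1, h1.symm]
  simp only [h]
  simp only [Finset.sum_ite_eq', Finset.mem_univ, if_true, Matrix.trace, Matrix.diag,
    Matrix.mul_apply, Finset.mul_sum, Finset.sum_mul]
  refine Finset.sum_congr rfl fun i _ => Finset.sum_congr rfl fun j _ => ?_
  ring

theorem lowerD_two_apply (γ : PreCochain N ℂ 2) (a b : gc N) (z : Fin 2 → ℂ) :
    lowerD 2 γ ![a, b] z = γ ![lower a, b] z + γ ![a, lower b] z := by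
  rw [lowerD_apply, Fin.sum_univ_two]
  congr 2 <;> (funext i; fin_cases i <;> rfl)

theorem psi_smul_left (c : ℂ) (a b : gc N) (z w : ℂ) :
    psi N ![c • a, b] ![z, w] = c * psi N ![a, b] ![z, w] := by
  simp [psi, cochainTwo]

theorem psi_smul_right (c : ℂ) (a b : gc N) (z w : ℂ) :
    psi N ![a, c • b] ![z, w] = c * psi N ![a, b] ![z, w] := by
  simp only [psi, cochainTwo, Matrix.cons_val_zero, Matrix.cons_val_one, map_smul, smul_eq_mul]
  exact conformalFunctional_mul_left _ _ _ _

theorem lower_J' (n : ℕ) (A : Matrix (Fin N) (Fin N) ℂ) :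
    lower (J n A) = (n : ℂ) • J (n - 1) A := by
  rw [lower_J, smul_eq_C_smul, map_natCast]

/-- This relation dictates the constants c(m,n) = (-1)^n m! n!/(m+n+1)!. For m, n ≥ 1 it says m
c(m-1,n) + n c(m,n-1) = 0, and for n = 0 < m it says m c(m-1,0) = 1, to match dτ. -/
theorem lowerD_psi_add_d_traceForm (m n : ℕ) (A B : Matrix (Fin N) (Fin N) ℂ) (z : ℂ) :
    (lowerD 2 (psi N) + (triv N).d 1 (traceForm N)) ![J m A, J n B] ![z, -z] = 0 := by
  rw [Pi.add_apply, Pi.add_apply, lowerD_two_apply, triv_d_one_apply, lower_J', lower_J',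
    psi_smul_left, psi_smul_right, psi_J, psi_J, bracket_J, traceForm_genBracket,
    show (z - -z) / 2 = z by ring, add_neg_cancel, sub_zero]
  cases m with
  | zero =>
    cases n with
    | zero => simp
    | succ n =>
      have : ((n + 1).factorial : ℂ) ≠ 0 := Nat.cast_ne_zero.2 (Nat.factorial_ne_zero _)
      have h2 : ((n + 1).factorial : ℂ) = (n + 1) * n.factorial := by
        rw [Nat.factorial_succ]; push_cast; ring
      simp only [Nat.add_sub_cancel, zero_add]
      simp
      rw [neg_pow z (n + 1), pow_succ (-1 : ℂ)]
      field_simp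
      rw [h2]
      ring
  | succ m =>
    have hf : ∀ k : ℕ, ((k + 1).factorial : ℂ) = (k + 1) * k.factorial := by
      intro k
      rw [Nat.factorial_succ]; push_cast; ring
    cases n with
    | zero =>
      have : ((m + 1).factorial : ℂ) ≠ 0 := Nat.cast_ne_zero.2 (Nat.factorial_ne_zero _)
      simp
      field_simp
      rw [hf m]
      ring
    | succ n =>
      simp only [Nat.add_sub_cancel]
      rw [show m + (n + 1) + 1 = m + n + 2 by ring, show m + 1 + n + 1 = m + n + 2 by ring,
        hf m, hf n]
      simp
      ring

theorem fin_two_eta {α : Type} (a : Fin 2 → α) : a = ![a 0, a 1] := by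
  funext i
  fin_cases i <;> rfl

theorem exists_del_eq_of_J {x : PreCochain N ℂ 2} (hx : x ∈ (triv N).cochains 2)
    (h : ∀ (m n : ℕ) (A B : Matrix (Fin N) (Fin N) ℂ) (z : ℂ), x ![J m A, J n B] ![z, -z] = 0) :
    ∃ ε ∈ (triv N).cochains 2, (triv N).del 2 ε = x := by
  refine exists_del_eq hx fun a z hz => (isForm_of_mem hx).eq_zero_of_gen (fun k => ?_) a
  have hz' : z 1 = -(z 0) := by
    rw [Fin.sum_univ_two] at hz
    linear_combination hz
  have := h (k 0).1 (k 1).1 (Matrix.single (k 0).2.1 (k 0).2.2 1)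
    (Matrix.single (k 1).2.1 (k 1).2.2 1) (z 0)
  rw [J_single_eq_gen, J_single_eq_gen, ← hz', ← fin_two_eta z] at this
  rw [fin_two_eta fun i => gen (k i)]
  exact this

variable (N) in
/-- The basic `3`-cocycle `e` attached to `psi`, with the cochains that relate it to `traceForm`. -/
theorem exists_threeCocycle : ∃ α ∈ (triv N).cochains 2, ∃ e ∈ (triv N).cochains 3,
    (triv N).del 2 α = lowerD 2 (psi N) + (triv N).d 1 (traceForm N) ∧
    (triv N).del 3 e = (triv N).d 2 (psi N) ∧ lowerD 3 e = (triv N).d 2 α ∧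
    (triv N).d 3 e = 0 := by
  obtain ⟨α, hα, hα'⟩ := exists_del_eq_of_J (add_mem (lowerD_mem psi_mem) (d_mem traceForm_mem))
    (lowerD_psi_add_d_traceForm (N := N))
  -- Applying d to Dψ + dτ = ∂α gives D(dψ) = ∂(dα), so dψ = ∂e and dα = De for a common e.
  obtain ⟨e, he, h1, h2⟩ := exists_del_eq_and_lowerD_eq (d_mem (psi_mem (N := N))) (d_mem hα) (by
    rw [lowerD_d psi_mem, del_d (isForm_of_mem hα), hα', map_add,
      d_d 1 (isForm_of_mem traceForm_mem), add_zero])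
  refine ⟨α, hα, e, he, hα', h1, h2, eq_zero_of_del_eq_zero (d_mem he) ?_⟩
  rw [del_d (isForm_of_mem he), h1, d_d 2 (isForm_of_mem psi_mem)]

end TraceForm

end ConfModule

namespace ConfModule

/-! ### Basic 3-cocycles -/

section ThirdCohomology

variable {N : ℕ}

theorem fin_one_eta {α : Type} (a : Fin 1 → α) : a = ![a 0] := by
  funext i
  fin_cases i
  rfl

theorem _root_.ConfCoh.IsForm.eq_zero_of_apply {q : ℕ} {γ : PreCochain N ℂ q} (h : IsForm γ)
    {a : Fin q → gc N} (z : Fin q → ℂ) (i : Fin q) (ha : a i = 0) : γ a z = 0 := by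
  have := h.update_zero a z i
  rwa [← ha, Function.update_eq_self] at this

theorem exists_linearMap_one {δ : PreCochain N ℂ 1} (h : IsForm δ) (t : ℂ) :
    ∃ f : gc N →ₗ[ℂ] ℂ, ∀ x, f x = δ ![x] ![t] :=
  ⟨h.functional 0 ![t] 0, fun x => by
    rw [IsForm.functional_apply, fin_one_eta (Function.update _ _ _), Function.update_self]⟩

theorem lowerD_one_apply (δ : PreCochain N ℂ 1) (a : gc N) (z : Fin 1 → ℂ) :
    lowerD 1 δ ![a] z = δ ![lower a] z := by
  rw [lowerD_apply, Fin.sum_univ_one, fin_one_eta (Function.update _ _ _), Function.update_self]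
  rfl

theorem cochainOne_gen (c : ℕ × Fin N × Fin N → ℂ) (k : ℕ × Fin N × Fin N) (t : ℂ) :
    cochainOne c ![gen k] ![t] = c k := by
  simp [cochainOne, conformalFunctional_gen]

/-- Modulo the images of `∂` and `lowerD`, a `1`-cochain is determined by its values on
`J^0_{E_ij}` at `λ = 0`. -/
theorem exists_decomp_one {δ : PreCochain N ℂ 1} (hδ : δ ∈ (triv N).cochains 1) :
    ∃ δ₁ ∈ (triv N).cochains 1, ∃ δ₂ ∈ (triv N).cochains 1,
      δ = cochainOne (fun k => if k.1 = 0 then δ ![gen k] ![0] else 0) +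
        (triv N).del 1 δ₁ + lowerD 1 δ₂ := by
  let δ₂ : PreCochain N ℂ 1 :=
    -- Since `lower` sends J^{n+1} to (n+1) J^n, Dδ₂ agrees with δ at λ = 0 on all J^{n+1}.
    cochainOne fun k => δ ![gen (k.1 + 1, k.2)] ![0] / ((k.1 : ℂ) + 1)
  have h₂ : δ₂ ∈ (triv N).cochains 1 := cochainOne_mem _
  have h₀ : cochainOne (fun k => if k.1 = 0 then δ ![gen k] ![0] else 0) ∈
    (triv N).cochains 1 := cochainOne_mem _
  have hx := sub_mem (sub_mem hδ h₀) (lowerD_mem h₂)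
  obtain ⟨δ₁, h₁, h⟩ := exists_del_eq hx fun a z hz =>
    (isForm_of_mem hx).eq_zero_of_gen (fun k => by
      have hz : z = ![0] := by
        rw [fin_one_eta z, ← hz, Fin.sum_univ_one]
      rw [fin_one_eta fun i => gen (k i), hz]
      simp only [Pi.sub_apply, cochainOne_gen, lowerD_one_apply, lower_gen]
      obtain ⟨f, hf⟩ := exists_linearMap_one (isForm_of_mem h₂) 0
      rw [← hf, map_smul, hf]
      simp only [δ₂, cochainOne_gen]
      obtain ⟨n, i, j⟩ := k 0
      cases n with
      | zero => simp
      | succ n =>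
        have : (n : ℂ) + 1 ≠ 0 := Nat.cast_add_one_ne_zero n
        simp
        field_simp
        ring) a
  exact ⟨δ₁, h₁, δ₂, h₂, by rw [h]; abel⟩

/-- On J^0_A, J^0_B at λ = 0 the images of D and ∂ vanish, so δ kills J^0 of all commutators. A
linear form on matrices that does so is a multiple of the trace. -/
theorem eq_smul_traceForm {δ x y : PreCochain N ℂ 1} {u v : PreCochain N ℂ 2} (i₀ : Fin N)
    (hδ : δ ∈ (triv N).cochains 1) (hv : v ∈ (triv N).cochains 2)
    (h : (triv N).d 1 δ = lowerD 2 v + (triv N).del 2 u)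
    (hxy : δ = cochainOne (fun k => if k.1 = 0 then δ ![gen k] ![0] else 0) + x + y) :
    δ = δ ![gen (0, i₀, i₀)] ![0] • traceForm N + x + y := by
  obtain ⟨f, hf⟩ := exists_linearMap_one (isForm_of_mem hδ) 0
  have hAB : ∀ A B : Matrix (Fin N) (Fin N) ℂ, f (J 0 (A * B)) = f (J 0 (B * A)) := by
    intro A B
    have h1 := congrFun (congrFun h ![J 0 A, J 0 B]) ![0, 0]
    have h2 : v ![0, J 0 B] ![0, 0] = 0 := (isForm_of_mem hv).eq_zero_of_apply _ 0 rfl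
    have h3 : v ![J 0 A, 0] ![0, 0] = 0 := (isForm_of_mem hv).eq_zero_of_apply _ 1 rfl
    rw [triv_d_one_apply, Pi.add_apply, Pi.add_apply, lowerD_two_apply, triv_del_apply, lower_J',
      lower_J'] at h1
    simp only [Nat.cast_zero, zero_smul, h2, h3, Fin.sum_univ_two, Matrix.cons_val_zero,
      Matrix.cons_val_one, add_zero, zero_mul, neg_eq_zero, bracket_J, ← hf] at h1
    rw [genBracket, map_sub] at h1
    simpa [sub_eq_zero] using h1
  have hij : ∀ i j, f (gen (0, i, j)) = if i = j then f (gen (0, i₀, i₀)) else 0 := by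
    intro i j
    have := hAB (Matrix.single i i₀ 1) (Matrix.single i₀ j 1)
    rw [Matrix.single_mul_single_same, mul_one, J_single_eq_gen] at this
    rw [this]
    split_ifs with hij
    · subst hij
      rw [Matrix.single_mul_single_same, mul_one, J_single_eq_gen]
    · rw [Matrix.single_mul_single_of_ne _ _ _ _ (Ne.symm hij), J_zero, map_zero]
  have hc : (cochainOne fun k => if k.1 = 0 then δ ![gen k] ![0] else 0) =
      δ ![gen (0, i₀, i₀)] ![0] • traceForm N := by
    simp only [← hf]
    funext a z
    simp only [Pi.smul_apply, traceForm, cochainOne, smul_eq_mul, ← conformalFunctional_mul_left]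
    congr 2
    funext k
    obtain ⟨n, i, j⟩ := k
    rcases eq_or_ne n 0 with rfl | hn
    · rw [if_pos rfl, hij i j]
      simp
    · simp [hn]
  rwa [hc] at hxy

/-- Relations between the standard cochains, as provided by `exists_threeCocycle`. -/
structure IsFundamental (α : PreCochain N ℂ 2) (e : PreCochain N ℂ 3) : Prop where
  mem_two : α ∈ (triv N).cochains 2
  mem_three : e ∈ (triv N).cochains 3
  del_two : (triv N).del 2 α = lowerD 2 (psi N) + (triv N).d 1 (traceForm N)
  del_three : (triv N).del 3 e = (triv N).d 2 (psi N)
  lowerD_three : lowerD 3 e = (triv N).d 2 α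
  d_three : (triv N).d 3 e = 0

variable (N) in
theorem exists_isFundamental :
    ∃ (α : PreCochain N ℂ 2) (e : PreCochain N ℂ 3), IsFundamental α e := by
  obtain ⟨α, hα, e, he, h1, h2, h3, h4⟩ := exists_threeCocycle N
  exact ⟨α, e, hα, he, h1, h2, h3, h4⟩

variable {α : PreCochain N ℂ 2} {e : PreCochain N ℂ 3}

/-- Here Dβ = dδ modulo ∂, with δ = cτ + ∂δ₁ + Dδ₂. The coefficient of e is kept explicit because it
has to be shown to vanish in degree 4. -/
theorem IsFundamental.exists_eq (he : IsFundamental α e) (i₀ : Fin N) {γ : PreCochain N ℂ 3}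
    (hγ : γ ∈ (triv N).cochains 3) (h : (triv N).d 3 γ = 0) {ε : PreCochain N ℂ 1}
    (hε : ε ∈ (triv N).cochains 1) (hη : contr (J 0 1) 0 2 γ = (triv N).d 1 ε) :
    ∃ θ ∈ (triv N).cochains 2, γ = (triv N).d 2 θ +
      (contrDeriv (contr (J 1 1) 0 2 γ) + ε) ![gen (0, i₀, i₀)] ![0] • e := by
  set δ := -(contrDeriv (contr (J 1 1) 0 2 γ) + ε) with hδdef
  have hδ : δ ∈ (triv N).cochains 1 := neg_mem (add_mem (contrDeriv_mem (contr_mem hγ _ _)) hε)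
  have hd : (triv N).d 1 δ =
      lowerD 2 (contr (J 1 1) 0 2 γ) + (triv N).del 2 (contrDeriv γ) := by
    have := lowerD_contr_J_one hγ h
    rw [hη] at this
    rw [hδdef, map_neg, map_add, neg_add, ← this]
    abel
  obtain ⟨δ₁, h₁, δ₂, h₂, hdec⟩ := exists_decomp_one hδ
  have hdec' := eq_smul_traceForm i₀ hδ (contr_mem hγ _ _) hd hdec
  set c := δ ![gen (0, i₀, i₀)] ![0] with hc
  -- The correction cψ turns c dτ into c∂α, and -dδ₂ removes dDδ₂ = Ddδ₂. Since dψ = ∂e, the price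
  -- is w = ce.
  obtain ⟨θ, hθ, hθ'⟩ := exists_eq_d_sub (w := c • e) (x := c • psi N - (triv N).d 1 δ₂)
    (y := c • α + (triv N).d 1 δ₁ - contrDeriv γ) hγ (Submodule.smul_mem _ c he.mem_three)
    (sub_mem (Submodule.smul_mem _ c psi_mem) (d_mem h₂)) h
    (by rw [map_sub, map_smul, map_smul, d_d 1 (isForm_of_mem h₂), sub_zero, he.del_three]) (by
      rw [hdec'] at hd
      simp only [map_add, map_sub, map_smul] at hd ⊢
      rw [lowerD_d h₂, del_d (isForm_of_mem h₁), he.del_two, smul_add, ← sub_eq_iff_eq_add.2 hd]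
      abel)
  refine ⟨θ, hθ, ?_⟩
  have hc' : (contrDeriv (contr (J 1 1) 0 2 γ) + ε) ![gen (0, i₀, i₀)] ![0] = -c := by
    simp [hc, hδdef]
  rw [hc', neg_smul, ← sub_eq_add_neg]
  exact hθ'

/-- Every basic `3`-cocycle is cohomologous to a multiple of the fundamental one. -/
theorem IsFundamental.exists_eq_add_smul (he : IsFundamental α e) (i₀ : Fin N)
    {γ : PreCochain N ℂ 3} (hγ : γ ∈ (triv N).cochains 3) (h : (triv N).d 3 γ = 0) :
    ∃ θ ∈ (triv N).cochains 2, ∃ c : ℂ, γ = (triv N).d 2 θ + c • e := by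
  obtain ⟨ε, hε, hη⟩ := exists_d_eq_two (contr_mem hγ (J 0 1) 0) (d_contr_J_zero hγ h)
  obtain ⟨θ, hθ, h'⟩ := he.exists_eq i₀ hγ h hε hη
  exact ⟨θ, hθ, _, h'⟩

/-- If e = dε, then ψ - ∂ε and α - Dε are 2-cocycles, hence dη and dζ. Then τ - ∂ζ + Dη is closed,
so it is 0. At λ = 0 on J^0_I the last two terms vanish and τ gives N. -/
theorem IsFundamental.ne_d (he : IsFundamental α e) (hN : 1 ≤ N) {ε : PreCochain N ℂ 2}
    (hε : ε ∈ (triv N).cochains 2) : e ≠ (triv N).d 2 ε := by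
  intro h
  obtain ⟨η, hη, h1⟩ := exists_d_eq_two (sub_mem (psi_mem (N := N)) (del_mem hε)) (by
    rw [map_sub, ← he.del_three, h, del_d (isForm_of_mem hε), sub_self])
  obtain ⟨ζ, hζ, h2⟩ := exists_d_eq_two (sub_mem he.mem_two (lowerD_mem hε)) (by
    rw [map_sub, ← he.lowerD_three, h, lowerD_d hε, sub_self])
  have h3 : traceForm N - (triv N).del 1 ζ + lowerD 1 η = 0 := by
    refine eq_zero_of_d_one (add_mem (sub_mem traceForm_mem (del_mem hζ)) (lowerD_mem hη)) ?_
    rw [map_add, map_sub, ← del_d (isForm_of_mem hζ), ← lowerD_d hη, ← h1, ← h2, map_sub, map_sub,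
      he.del_two, lowerD_del]
    abel
  have h4 := congrFun (congrFun h3 ![J 0 1]) ![0]
  obtain ⟨f, hf⟩ := exists_linearMap_one (isForm_of_mem hη) 0
  simp only [Pi.add_apply, Pi.sub_apply, traceForm_J, triv_del_apply, lowerD_one_apply, lower_J',
    ← hf, map_smul] at h4
  simp at h4
  omega

end ThirdCohomology

end ConfModule

/-! ### Functionals on polynomials and the diagonal derivative -/

section MonomialFunctional

variable {q : ℕ} {V : Type*} [AddCommGroup V] [Module ℂ V]

/-- The linear map with prescribed values on the monomials. -/
def monomialMap (g : (Fin q →₀ ℕ) → V) : MvPolynomial (Fin q) ℂ →ₗ[ℂ] V :=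
  (MvPolynomial.basisMonomials (Fin q) ℂ).constr ℂ g

theorem monomialMap_monomial (g : (Fin q →₀ ℕ) → V) (m : Fin q →₀ ℕ) (c : ℂ) :
    monomialMap g (MvPolynomial.monomial m c) = c • g m := by
  have h := (MvPolynomial.basisMonomials (Fin q) ℂ).constr_basis ℂ g m
  rw [MvPolynomial.coe_basisMonomials] at h
  have hm : MvPolynomial.monomial m c = c • MvPolynomial.monomial m (1 : ℂ) := by
    rw [MvPolynomial.smul_monomial, smul_eq_mul, mul_one]
  rw [monomialMap, hm, map_smul, h]

theorem linearMap_eq_of_monomial {φ ψ : MvPolynomial (Fin q) ℂ →ₗ[ℂ] V}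
    (h : ∀ m, φ (MvPolynomial.monomial m 1) = ψ (MvPolynomial.monomial m 1)) : φ = ψ :=
  (MvPolynomial.basisMonomials (Fin q) ℂ).ext fun m => by
    simpa only [MvPolynomial.coe_basisMonomials] using h m

/-- The derivative along the diagonal. -/
def diagDeriv (q : ℕ) : Derivation ℂ (MvPolynomial (Fin q) ℂ) (MvPolynomial (Fin q) ℂ) :=
  ∑ i, MvPolynomial.pderiv i

theorem diagDeriv_apply (F : MvPolynomial (Fin q) ℂ) :
    diagDeriv q F = ∑ i, MvPolynomial.pderiv i F := by
  have h : ∀ s : Finset (Fin q), (∑ i ∈ s, MvPolynomial.pderiv i :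
      Derivation ℂ (MvPolynomial (Fin q) ℂ) (MvPolynomial (Fin q) ℂ)) F =
      ∑ i ∈ s, MvPolynomial.pderiv i F := by
    intro s
    induction s using Finset.cons_induction with
    | empty => simp
    | cons i s hi ih => rw [Finset.sum_cons, Finset.sum_cons, Derivation.add_apply, ih]
  exact h _

theorem diagDeriv_X (i : Fin q) : diagDeriv q (MvPolynomial.X i) = 1 := by
  rw [diagDeriv_apply, Finset.sum_eq_single i]
  · simp
  · intro j _ hj
    simp [MvPolynomial.pderiv_X, Ne.symm hj]
  · simp

theorem diagDeriv_aeval_sub (p : ℂ[X]) (i j : Fin q) :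
    diagDeriv q (Polynomial.aeval (MvPolynomial.X i - MvPolynomial.X j) p) = 0 := by
  rw [Derivation.map_aeval, map_sub, diagDeriv_X, diagDeriv_X, sub_self, smul_zero]

/-- The multiples of X₀ and the powers of X₀ - X₁ span all polynomials, as (X₀ - X₁)^k ≡ ±X₁^k
modulo X₀. -/
theorem linearMap_eq_zero_of_sub_pow {φ : MvPolynomial (Fin 2) ℂ →ₗ[ℂ] V}
    (h : ∀ m : Fin 2 →₀ ℕ, m 0 ≠ 0 → φ (MvPolynomial.monomial m 1) = 0)
    (h' : ∀ k : ℕ, φ ((MvPolynomial.X 0 - MvPolynomial.X 1) ^ k) = 0) : φ = 0 := by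
  have hX : ∀ F, φ (MvPolynomial.X 0 * F) = 0 := by
    intro F
    have : φ ∘ₗ LinearMap.mulLeft ℂ (MvPolynomial.X 0) = 0 := by
      refine linearMap_eq_of_monomial fun m => ?_
      simp only [LinearMap.comp_apply, LinearMap.mulLeft_apply, LinearMap.zero_apply]
      rw [MvPolynomial.X, MvPolynomial.monomial_mul, one_mul]
      exact h _ (by simp)
    exact LinearMap.congr_fun this F
  refine linearMap_eq_of_monomial fun m => ?_
  by_cases hm : m 0 = 0
  · have h1 : (MvPolynomial.monomial m (1 : ℂ) : MvPolynomial (Fin 2) ℂ) =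
        MvPolynomial.X 1 ^ m 1 := by
      rw [MvPolynomial.monomial_eq, Finsupp.prod_fintype _ _ (by simp), Fin.prod_univ_two, hm]
      simp
    obtain ⟨F, hF⟩ := sub_dvd_pow_sub_pow
      (MvPolynomial.X 0 - MvPolynomial.X 1 : MvPolynomial (Fin 2) ℂ) (-MvPolynomial.X 1) (m 1)
    rw [sub_neg_eq_add, sub_add_cancel] at hF
    have h2 := congrArg φ hF
    rw [map_sub, h', hX, zero_sub, neg_eq_zero, neg_pow] at h2
    have h3 : ((-1 : MvPolynomial (Fin 2) ℂ)) ^ m 1 * MvPolynomial.X 1 ^ m 1 =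
        ((-1 : ℂ) ^ m 1) • MvPolynomial.X 1 ^ m 1 := by
      rw [MvPolynomial.smul_eq_C_mul, MvPolynomial.C_pow, MvPolynomial.C_neg, MvPolynomial.C_1]
    rw [h3, map_smul, ← h1] at h2
    simpa using h2
  · simpa using h m hm

/-- A skew-symmetric two-parameter family annihilated by the translation-invariant polynomials has
a skew-symmetric primitive. -/
theorem exists_primitive {g : ℕ → ℕ → ℂ[X]}
    (hskew : ∀ m n t, (g m n).eval (-t) = -(g n m).eval t)
    (hg : ∀ k : ℕ, monomialMap (fun m : Fin 2 →₀ ℕ => g (m 0) (m 1))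
      ((MvPolynomial.X 0 - MvPolynomial.X 1) ^ k) = 0) :
    ∃ ε : ℕ → ℕ → ℂ[X], (∀ m n t, (ε m n).eval (-t) = -(ε n m).eval t) ∧
      ∀ m n : ℕ, (m : ℂ[X]) * ε (m - 1) n + (n : ℂ[X]) * ε m (n - 1) = g m n := by
  -- The relation at (m + 1, n), solved for ε m n by recursion on n. This settles the relation for
  -- positive first index.
  let ε : ℕ → ℕ → ℂ[X] := fun m n => Nat.rec (motive := fun _ => ℕ → ℂ[X])
    (fun m => C (1 / ((m : ℂ) + 1)) * g (m + 1) 0)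
    (fun n r m => C (1 / ((m : ℂ) + 1)) * (g (m + 1) (n + 1) - ((n + 1 : ℕ) : ℂ[X]) * r (m + 1))) n m
  have hC : ∀ m : ℕ, ((m + 1 : ℕ) : ℂ[X]) * C (1 / ((m : ℂ) + 1)) = 1 := by
    intro m
    have : (m : ℂ) + 1 ≠ 0 := Nat.cast_add_one_ne_zero m
    rw [← C_eq_natCast, ← C_mul]
    push_cast
    rw [mul_one_div_cancel this, C_1]
  have h1 : ∀ m n, ((m + 1 : ℕ) : ℂ[X]) * ε m n + (n : ℂ[X]) * ε (m + 1) (n - 1) = g (m + 1) n := by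
    intro m n
    cases n with
    | zero =>
      change ((m + 1 : ℕ) : ℂ[X]) * (C (1 / ((m : ℂ) + 1)) * g (m + 1) 0) + _ = _
      rw [← mul_assoc, hC]
      simp
    | succ n =>
      change ((m + 1 : ℕ) : ℂ[X]) * (C (1 / ((m : ℂ) + 1)) *
        (g (m + 1) (n + 1) - ((n + 1 : ℕ) : ℂ[X]) * ε (m + 1) n)) + _ = _
      rw [← mul_assoc, hC]
      simp
  have hmono : ∀ (f : ℕ → ℕ → ℂ[X]) (m : Fin 2 →₀ ℕ),
      monomialMap (fun m : Fin 2 →₀ ℕ => f (m 0) (m 1)) (diagDeriv 2 (MvPolynomial.monomial m 1)) =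
      (m 0 : ℂ[X]) * f (m 0 - 1) (m 1) + (m 1 : ℂ[X]) * f (m 0) (m 1 - 1) := by
    intro f m
    rw [diagDeriv_apply, Fin.sum_univ_two, MvPolynomial.pderiv_monomial,
      MvPolynomial.pderiv_monomial, map_add, monomialMap_monomial, monomialMap_monomial]
    simp [smul_eq_C_mul]
  have hrel : ∀ m n : ℕ, (m : ℂ[X]) * ε (m - 1) n + (n : ℂ[X]) * ε m (n - 1) = g m n := by
    -- For first index 0 the hypothesis on g enters: both functionals kill the powers of X₀ - X₁,
    -- the first because the diagonal derivative does.
    have hz : monomialMap (fun m : Fin 2 →₀ ℕ => ε (m 0) (m 1)) ∘ₗ (diagDeriv 2).toLinearMap -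
        monomialMap (fun m : Fin 2 →₀ ℕ => g (m 0) (m 1)) = 0 := by
      refine linearMap_eq_zero_of_sub_pow (fun m hm => ?_) fun k => ?_
      · simp only [LinearMap.sub_apply, LinearMap.comp_apply]
        change monomialMap _ (diagDeriv 2 _) - _ = _
        rw [hmono, monomialMap_monomial, one_smul]
        obtain ⟨n, hn⟩ := Nat.exists_eq_succ_of_ne_zero hm
        rw [hn, Nat.succ_eq_add_one, Nat.add_sub_cancel, h1, sub_self]
      · simp only [LinearMap.sub_apply, LinearMap.comp_apply, hg, sub_zero]
        change monomialMap _ (diagDeriv 2 _) = _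
        have := diagDeriv_aeval_sub (q := 2) (X ^ k) 0 1
        rw [map_pow, aeval_X] at this
        rw [this, map_zero]
    intro m n
    let k : Fin 2 →₀ ℕ := Finsupp.equivFunOnFinite.symm ![m, n]
    have := LinearMap.congr_fun hz (MvPolynomial.monomial k 1)
    simp only [LinearMap.sub_apply, LinearMap.comp_apply] at this
    change monomialMap _ (diagDeriv 2 _) - _ = _ at this
    rw [hmono, monomialMap_monomial, one_smul, LinearMap.zero_apply, sub_eq_zero] at this
    simpa [k] using this
  refine ⟨ε, fun m n t => ?_, hrel⟩
  -- Compare the relation at (m + 1, n), evaluated at -t, with the one at (n, m + 1), evaluated at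
  -- t. By skewness of g and the induction hypothesis only the terms in question remain.
  induction n generalizing m with
  | zero =>
    have e1 := congrArg (eval (-t)) (hrel (m + 1) 0)
    have e2 := congrArg (eval t) (hrel 0 (m + 1))
    rw [hskew] at e1
    rw [← e2] at e1
    have : (m : ℂ) + 1 ≠ 0 := Nat.cast_add_one_ne_zero m
    simp at e1
    rw [← mul_neg] at e1
    exact mul_left_cancel₀ this e1
  | succ n ih =>
    have e1 := congrArg (eval (-t)) (hrel (m + 1) (n + 1))
    have e2 := congrArg (eval t) (hrel (n + 1) (m + 1))
    rw [hskew] at e1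
    rw [← e2] at e1
    have : (m : ℂ) + 1 ≠ 0 := Nat.cast_add_one_ne_zero m
    simp [ih] at e1
    refine mul_left_cancel₀ this ?_
    linear_combination e1

end MonomialFunctional

/-! ### Cochains of gc_1 as functionals on polynomials -/

section Symbols

namespace ConfModule

variable {q : ℕ}

/-- The functional `x^m ↦ γ_z(J^{m_1}, …, J^{m_q})`. -/
def symb (γ : PreCochain 1 ℂ q) (z : Fin q → ℂ) : MvPolynomial (Fin q) ℂ →ₗ[ℂ] ℂ :=
  monomialMap fun m => γ (fun i => J (m i) 1) z

theorem symb_monomial (γ : PreCochain 1 ℂ q) (z : Fin q → ℂ) (m : Fin q →₀ ℕ) (c : ℂ) :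
    symb γ z (MvPolynomial.monomial m c) = c * γ (fun i => J (m i) 1) z :=
  monomialMap_monomial _ _ _

theorem symb_add (γ δ : PreCochain 1 ℂ q) (z : Fin q → ℂ) (F : MvPolynomial (Fin q) ℂ) :
    symb (γ + δ) z F = symb γ z F + symb δ z F := by
  have : symb (γ + δ) z = symb γ z + symb δ z :=
    linearMap_eq_of_monomial fun m => by simp [symb_monomial]
  rw [this, LinearMap.add_apply]

theorem symb_smul (c : ℂ) (γ : PreCochain 1 ℂ q) (z : Fin q → ℂ) (F : MvPolynomial (Fin q) ℂ) :
    symb (c • γ) z F = c * symb γ z F := by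
  have : symb (c • γ) z = c • symb γ z :=
    linearMap_eq_of_monomial fun m => by simp [symb_monomial]
  rw [this, LinearMap.smul_apply, smul_eq_mul]

theorem symb_sub (γ δ : PreCochain 1 ℂ q) (z : Fin q → ℂ) (F : MvPolynomial (Fin q) ℂ) :
    symb (γ - δ) z F = symb γ z F - symb δ z F := by
  rw [sub_eq_add_neg, symb_add, ← neg_one_smul ℂ δ, symb_smul]
  ring

theorem symb_del (γ : PreCochain 1 ℂ q) {z : Fin q → ℂ} (hz : ∑ i, z i = 0)
    (F : MvPolynomial (Fin q) ℂ) : symb ((triv 1).del q γ) z F = 0 := by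
  have : symb ((triv 1).del q γ) z = 0 :=
    linearMap_eq_of_monomial fun m => by simp [symb_monomial, triv_del_apply, hz]
  rw [this, LinearMap.zero_apply]

/-- `lower` is d/dx in the notation x^n for J^n, so D is the transpose of the derivative along the
diagonal. In particular D kills translation-invariant polynomials. -/
theorem symb_lowerD {γ : PreCochain 1 ℂ q} (hγ : IsForm γ) (z : Fin q → ℂ)
    (F : MvPolynomial (Fin q) ℂ) : symb (lowerD q γ) z F = symb γ z (diagDeriv q F) := by
  have : symb (lowerD q γ) z = symb γ z ∘ₗ (diagDeriv q).toLinearMap := by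
    refine linearMap_eq_of_monomial fun m => ?_
    change _ = symb γ z (diagDeriv q _)
    rw [symb_monomial, one_mul, lowerD_apply, diagDeriv_apply, map_sum]
    refine Finset.sum_congr rfl fun i _ => ?_
    rw [MvPolynomial.pderiv_monomial, symb_monomial, one_mul, lower_J', hγ.csmul]
    congr 2
    funext j
    rcases eq_or_ne j i with rfl | hj
    · simp
    · simp [Function.update_of_ne hj, Ne.symm hj]
  rw [this]
  rfl

theorem isPolyFun_symb {γ : PreCochain 1 ℂ q} (hγ : γ ∈ (triv 1).cochains q)
    (F : MvPolynomial (Fin q) ℂ) : IsPolyFun fun z => symb γ z F := by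
  induction F using MvPolynomial.induction_on' with
  | monomial m c =>
    simp only [symb_monomial]
    exact (IsPolyFun.const c).mul (isPolyFun_of_mem hγ _)
  | add p r hp hr => simpa only [map_add] using hp.add hr

theorem _root_.ConfCoh.IsPolyFun.exists_eval {f : (Fin 2 → ℂ) → ℂ} (hf : IsPolyFun f) :
    ∃ P : ℂ[X], ∀ z, f ![z, -z] = P.eval z := by
  obtain ⟨p, hp⟩ := hf
  refine ⟨MvPolynomial.aeval ![X, -X] p, fun z => ?_⟩
  rw [hp]
  clear hp
  induction p using MvPolynomial.induction_on with
  | C a => simp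
  | add p r h h' => simp only [map_add, h, h', eval_add]
  | mul_X p i h =>
    simp only [map_mul, h, MvPolynomial.aeval_X, MvPolynomial.eval_X, eval_mul]
    fin_cases i <;> simp

theorem _root_.Polynomial.eq_zero_of_eval_ne_zero {P : ℂ[X]} (h : ∀ z, z ≠ 0 → P.eval z = 0) :
    P = 0 := by
  have : X * P = 0 := Polynomial.funext fun z => by
    rcases eq_or_ne z 0 with rfl | hz
    · simp
    · simp [h z hz]
  exact (mul_eq_zero.1 this).resolve_left X_ne_zero

theorem vec_comp_swap {β : Type*} (x y : β) :
    ![x, y] ∘ Equiv.swap (0 : Fin 2) 1 = ![y, x] := by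
  funext i
  fin_cases i <;> simp

theorem symb_swap {δ : PreCochain 1 ℂ 2} (hδ : IsForm δ) (z w : ℂ) (F : MvPolynomial (Fin 2) ℂ) :
    symb δ ![w, z] (MvPolynomial.aeval ![MvPolynomial.X 1, MvPolynomial.X 0] F) =
      -symb δ ![z, w] F := by
  induction F using MvPolynomial.induction_on' with
  | add p r hp hr => rw [map_add, map_add, hp, hr, map_add]; ring
  | monomial m c =>
    have h1 : MvPolynomial.aeval ![MvPolynomial.X 1, MvPolynomial.X 0]
        (MvPolynomial.monomial m c) = (MvPolynomial.monomial
          (Finsupp.equivFunOnFinite.symm ![m 1, m 0]) c : MvPolynomial (Fin 2) ℂ) := by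
      rw [MvPolynomial.aeval_monomial, MvPolynomial.monomial_eq,
        Finsupp.prod_fintype _ _ (by simp), Finsupp.prod_fintype _ _ (by simp), Fin.prod_univ_two,
        Fin.prod_univ_two]
      simp [MvPolynomial.algebraMap_eq, mul_comm]
    rw [h1, symb_monomial, symb_monomial, fin_two_eta fun i => J (m i) 1,
      fin_two_eta fun i => J _ 1]
    have := hδ.skew ![J (m 0) 1, J (m 1) 1] ![z, w] 0 1 rfl
    rw [vec_comp_swap, vec_comp_swap] at this
    simp only [Finsupp.equivFunOnFinite_symm_apply_apply, Matrix.cons_val_zero,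
      Matrix.cons_val_one]
    rw [this]
    ring

theorem symb_two_apply (δ : PreCochain 1 ℂ 2) (z : Fin 2 → ℂ) (c : ℂ) (m n : ℕ) :
    symb δ z (c • (MvPolynomial.X 0 ^ m * MvPolynomial.X 1 ^ n)) =
      c * δ ![J m 1, J n 1] z := by
  have h1 : c • (MvPolynomial.X 0 ^ m * MvPolynomial.X 1 ^ n) =
      (MvPolynomial.monomial (Finsupp.equivFunOnFinite.symm ![m, n]) c :
        MvPolynomial (Fin 2) ℂ) := by
    rw [MvPolynomial.monomial_eq, Finsupp.prod_fintype _ _ (by simp), Fin.prod_univ_two,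
      MvPolynomial.smul_eq_C_mul]
    simp
  rw [h1, symb_monomial, fin_two_eta fun i => J _ 1]
  simp

/-- With ∂ = -(u + v) the factor λ + ∂ of the bracket becomes -v, and the binomial theorem sums both
series. -/
theorem symb_bracket {δ : PreCochain 1 ℂ 2} (hδ : IsForm δ) (u v w : ℂ) (m n k : ℕ) :
    δ ![bracket u (J m 1) (J n 1), J k 1] ![u + v, w] = symb δ ![u + v, w]
      ((MvPolynomial.X 0 - MvPolynomial.C v) ^ m * MvPolynomial.X 0 ^ n * MvPolynomial.X 1 ^ k -
        MvPolynomial.X 0 ^ m * (MvPolynomial.X 0 - MvPolynomial.C u) ^ n *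
          MvPolynomial.X 1 ^ k) := by
  have hup : ∀ x : gc 1, Function.update ![0, J k 1] 0 x = ![x, J k 1] := by
    intro x
    funext i
    fin_cases i <;> rfl
  let φ := hδ.functional ![0, J k 1] ![u + v, w] 0
  have hφ : ∀ x, φ x = δ ![x, J k 1] ![u + v, w] := fun x => by
    simp only [φ, IsForm.functional_apply, hup]
  have hφp : ∀ (p : ℂ[X]) x, φ (p • x) = p.eval (-(u + v)) • φ x :=
    map_polySMul_of_conformal φ fun x => hδ.functional_X _ _ _ _
  have hexp : ∀ (a : ℂ) (m n : ℕ), symb δ ![u + v, w]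
      ((MvPolynomial.X 0 - MvPolynomial.C a) ^ m * MvPolynomial.X 0 ^ n * MvPolynomial.X 1 ^ k) =
      ∑ s ∈ Finset.range (m + 1), ((m.choose s : ℂ) * (-a) ^ s) * φ (J (m + n - s) 1) := by
    intro a m n
    have : (MvPolynomial.X 0 - MvPolynomial.C a) ^ m * MvPolynomial.X 0 ^ n *
        MvPolynomial.X 1 ^ k = ∑ s ∈ Finset.range (m + 1), ((m.choose s : ℂ) * (-a) ^ s) •
          (MvPolynomial.X 0 ^ (m + n - s) * MvPolynomial.X 1 ^ k : MvPolynomial (Fin 2) ℂ) := by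
      rw [sub_eq_neg_add, ← MvPolynomial.C_neg, add_pow, Finset.sum_mul, Finset.sum_mul]
      refine Finset.sum_congr rfl fun s hs => ?_
      have : m + n - s = m - s + n := by
        have := Finset.mem_range.1 hs
        omega
      rw [this, MvPolynomial.smul_eq_C_mul, MvPolynomial.C_mul, MvPolynomial.C_pow, pow_add,
        map_natCast]
      ring
    rw [this, map_sum]
    exact Finset.sum_congr rfl fun s _ => by rw [symb_two_apply, hφ]
  rw [map_sub, hexp, mul_comm (MvPolynomial.X 0 ^ m), hexp, ← hφ, bracket_J, genBracket, map_sub,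
    map_sum, map_sum, mul_one, add_comm n m]
  congr 1
  · refine Finset.sum_congr rfl fun s _ => ?_
    rw [hφp]
    simp
  · refine Finset.sum_congr rfl fun s _ => ?_
    rw [map_smul, smul_eq_mul]

theorem symb_d_two {δ : PreCochain 1 ℂ 2} (hδ : IsForm δ) (u v w : ℂ)
    (F : MvPolynomial (Fin 3) ℂ) : symb ((triv 1).d 2 δ) ![u, v, w] F =
      -symb δ ![u + v, w]
        (MvPolynomial.aeval ![MvPolynomial.X 0 - MvPolynomial.C v, MvPolynomial.X 0,
            MvPolynomial.X 1] F -
          MvPolynomial.aeval ![MvPolynomial.X 0, MvPolynomial.X 0 - MvPolynomial.C u,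
            MvPolynomial.X 1] F)
      + symb δ ![u + w, v]
        (MvPolynomial.aeval ![MvPolynomial.X 0 - MvPolynomial.C w, MvPolynomial.X 1,
            MvPolynomial.X 0] F -
          MvPolynomial.aeval ![MvPolynomial.X 0, MvPolynomial.X 1,
            MvPolynomial.X 0 - MvPolynomial.C u] F)
      - symb δ ![v + w, u]
        (MvPolynomial.aeval ![MvPolynomial.X 1, MvPolynomial.X 0 - MvPolynomial.C w,
            MvPolynomial.X 0] F -
          MvPolynomial.aeval ![MvPolynomial.X 1, MvPolynomial.X 0,
            MvPolynomial.X 0 - MvPolynomial.C v] F) := by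
  induction F using MvPolynomial.induction_on' with
  | add p r hp hr => simp only [map_add, hp, hr, map_sub]; ring
  | monomial m c =>
    have hm : ∀ x : Fin 3 → MvPolynomial (Fin 2) ℂ, MvPolynomial.aeval x
        (MvPolynomial.monomial m c) = c • (x 0 ^ m 0 * x 1 ^ m 1 * x 2 ^ m 2) := by
      intro x
      rw [MvPolynomial.aeval_monomial, Finsupp.prod_fintype _ _ (by simp), Fin.prod_univ_three,
        MvPolynomial.algebraMap_eq, MvPolynomial.smul_eq_C_mul]
    have h3 : (fun i => J (m i) 1 : Fin 3 → gc 1) = ![J (m 0) 1, J (m 1) 1, J (m 2) 1] := by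
      funext i
      fin_cases i <;> rfl
    simp only [hm, ← smul_sub, map_smul, smul_eq_mul]
    rw [symb_monomial, h3, triv_d_two_apply, symb_bracket hδ, symb_bracket hδ, symb_bracket hδ]
    simp only [Matrix.cons_val_zero, Matrix.cons_val_one, Matrix.cons_val]
    ring_nf

end ConfModule

end Symbols

namespace ConfModule

/-! ### 2-cochains of gc_1 modulo the images of ∂ and D -/

section RankOne

theorem J_one_eq_gen (m : ℕ) : J m (1 : Matrix (Fin 1) (Fin 1) ℂ) = gen (m, 0, 0) := by
  rw [← J_single_eq_gen]
  congr 1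
  ext i j
  fin_cases i
  fin_cases j
  simp

theorem symb_one {δ : PreCochain 1 ℂ 2} (z : Fin 2 → ℂ) :
    symb δ z 1 = δ ![J 0 1, J 0 1] z := by
  have := symb_two_apply δ z 1 0 0
  simpa using this

theorem symb_X_sub_X {δ : PreCochain 1 ℂ 2} (z : Fin 2 → ℂ) :
    symb δ z (MvPolynomial.X 0 - MvPolynomial.X 1) =
      δ ![J 1 1, J 0 1] z - δ ![J 0 1, J 1 1] z := by
  have h1 := symb_two_apply δ z 1 1 0
  have h2 := symb_two_apply δ z 1 0 1
  simp only [pow_one, pow_zero, mul_one, one_mul, one_smul] at h1 h2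
  rw [map_sub, h1, h2]

theorem aeval_comp_sub (x : Fin 3 → MvPolynomial (Fin 2) ℂ) (p : ℂ[X]) (i j : Fin 3) :
    MvPolynomial.aeval x (Polynomial.aeval
      (MvPolynomial.X i - MvPolynomial.X j : MvPolynomial (Fin 3) ℂ) p) =
      Polynomial.aeval (x i - x j) p := by
  rw [← Polynomial.aeval_algHom_apply, map_sub, MvPolynomial.aeval_X, MvPolynomial.aeval_X]

section

variable {δ : PreCochain 1 ℂ 2} {x y : PreCochain 1 ℂ 3}

theorem symb_d_eq_zero (hy : IsForm y)
    (h : (triv 1).d 2 δ = (triv 1).del 3 x + lowerD 3 y) (u v : ℂ) {F : MvPolynomial (Fin 3) ℂ}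
    (hF : diagDeriv 3 F = 0) : symb ((triv 1).d 2 δ) ![u, v, -u - v] F = 0 := by
  rw [h, symb_add, symb_del _ (by simp [Fin.sum_univ_three]), symb_lowerD hy, hF, map_zero,
    add_zero]

/-- The test polynomial x₀ - x₂ at (u, v, -u-v) gives the asserted relation multiplied by v. -/
theorem symb_one_add (hδ : IsForm δ) (hy : IsForm y)
    (h : (triv 1).d 2 δ = (triv 1).del 3 x + lowerD 3 y) {u v : ℂ} (hv : v ≠ 0) :
    symb δ ![u + v, -(u + v)] 1 = symb δ ![u, -u] 1 + symb δ ![v, -v] 1 := by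
  have hodd : ∀ z w : ℂ, symb δ ![w, z] 1 = -symb δ ![z, w] 1 := by
    intro z w
    have := symb_swap hδ z w 1
    rwa [map_one] at this
  have h0 := symb_d_eq_zero hy h u v (F := MvPolynomial.X 0 - MvPolynomial.X 2) (by
    rw [map_sub, diagDeriv_X, diagDeriv_X, sub_self])
  rw [symb_d_two hδ] at h0
  simp only [map_sub, MvPolynomial.aeval_X, Matrix.cons_val_zero, Matrix.cons_val] at h0
  have hC : ∀ (z : Fin 2 → ℂ) (c : ℂ), symb δ z (MvPolynomial.C c) = c * symb δ z 1 := by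
    intro z c
    rw [← smul_eq_mul, ← map_smul, MvPolynomial.smul_eq_C_mul, mul_one]
  simp only [hC] at h0
  rw [show u + (-u - v) = -v by ring, show v + (-u - v) = -u by ring,
    show -u - v = -(u + v) by ring, hodd v (-v), hodd u (-u)] at h0
  refine mul_left_cancel₀ hv ?_
  linear_combination h0

theorem symb_aeval_mul_sub (hδ : IsForm δ) (hy : IsForm y)
    (h : (triv 1).d 2 δ = (triv 1).del 3 x + lowerD 3 y) {z : ℂ} (hz : z ≠ 0) (p : ℂ[X]) :
    symb δ ![z, -z] (Polynomial.aeval (MvPolynomial.X 0 - MvPolynomial.X 1) (p * (X - C z))) =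
      p.eval z * symb δ ![0, 0] (MvPolynomial.X 0 - MvPolynomial.X 1) := by
  -- In the merge of x₀ and x₂ the factor p becomes the constant p(z) and δ is evaluated at (0, 0).
  -- In each of the other two merges a factor kills one of the two terms, and the surviving terms
  -- are mirror images of each other.
  have h0 := symb_d_eq_zero hy h z 0 (F :=
    Polynomial.aeval (MvPolynomial.X 0 - MvPolynomial.X 2) p *
      (MvPolynomial.X 1 - MvPolynomial.X 0) * (MvPolynomial.X 1 - MvPolynomial.X 2)) (by
    simp only [Derivation.leibniz, diagDeriv_aeval_sub, map_sub, diagDeriv_X, sub_self, smul_zero,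
      add_zero])
  rw [symb_d_two hδ, add_zero, sub_zero, add_neg_cancel, zero_add] at h0
  set D : MvPolynomial (Fin 2) ℂ := MvPolynomial.X 0 - MvPolynomial.X 1 with hD
  have hpC : ∀ c : ℂ, Polynomial.aeval (MvPolynomial.C c : MvPolynomial (Fin 2) ℂ) p =
      MvPolynomial.C (p.eval c) := by
    intro c
    rw [← MvPolynomial.algebraMap_eq, aeval_algebraMap_apply, coe_aeval_eq_eval]
  simp only [map_mul, map_sub, aeval_comp_sub, MvPolynomial.aeval_X, Matrix.cons_val_zero,
    Matrix.cons_val_one, Matrix.cons_val, MvPolynomial.C_0, sub_zero, MvPolynomial.C_neg,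
    sub_neg_eq_add, add_sub_cancel_left, sub_sub_cancel, hpC, sub_self, mul_zero, zero_sub,
    zero_mul] at h0
  have hneg : ∀ q : ℂ[X], symb δ ![-z, z] (Polynomial.aeval (-D) q) =
      -symb δ ![z, -z] (Polynomial.aeval D q) := by
    intro q
    have hs := symb_swap hδ z (-z) (Polynomial.aeval D q)
    rw [← Polynomial.aeval_algHom_apply] at hs
    rw [← hs, hD]
    simp
  have hX : ∀ (E : MvPolynomial (Fin 2) ℂ) (c : ℂ),
      Polynomial.aeval E (X - C c) = E - MvPolynomial.C c := by
    intro E c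
    rw [map_sub, aeval_X, aeval_C, MvPolynomial.algebraMap_eq]
  have e1 : -(Polynomial.aeval D p * (MvPolynomial.X 0 - MvPolynomial.C z - MvPolynomial.X 0) *
      (MvPolynomial.X 0 - MvPolynomial.C z - MvPolynomial.X 1)) =
      z • Polynomial.aeval D (p * (X - C z)) := by
    rw [map_mul, hX, MvPolynomial.smul_eq_C_mul, hD]
    ring
  have e2 : MvPolynomial.C (p.eval z) *
        (MvPolynomial.X 1 - (MvPolynomial.X 0 + MvPolynomial.C z)) *
        (MvPolynomial.X 1 - MvPolynomial.X 0) -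
      MvPolynomial.C (p.eval z) * (MvPolynomial.X 1 - MvPolynomial.X 0) *
        (MvPolynomial.X 1 - (MvPolynomial.X 0 - MvPolynomial.C z)) = (2 * z * p.eval z) • D := by
    rw [MvPolynomial.smul_eq_C_mul, hD]
    simp only [MvPolynomial.C_mul, map_ofNat]
    ring
  have e3 : Polynomial.aeval (MvPolynomial.X 1 - MvPolynomial.X 0) p *
      (MvPolynomial.X 0 + MvPolynomial.C z - MvPolynomial.X 1) * MvPolynomial.C z =
      (-z) • Polynomial.aeval (-D) (p * (X - C z)) := by
    rw [map_mul, hX, MvPolynomial.smul_eq_C_mul, hD, neg_sub, MvPolynomial.C_neg]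
    ring
  rw [e1, ← map_sub, e2, e3, map_smul, map_smul, map_smul, hneg] at h0
  simp only [smul_eq_mul] at h0
  refine mul_left_cancel₀ (mul_ne_zero two_ne_zero hz) ?_
  linear_combination -h0

theorem exists_symb_one_eq (hδ : δ ∈ (triv 1).cochains 2) (hy : IsForm y)
    (h : (triv 1).d 2 δ = (triv 1).del 3 x + lowerD 3 y) :
    ∃ c : ℂ, ∀ z, symb δ ![z, -z] 1 = c * z := by
  obtain ⟨P, hP⟩ := (isPolyFun_symb hδ 1).exists_eval
  -- Additivity at u = v = z gives P(2z) = 2P(z), and 2^k = 2 only for k = 1, so P is linear.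
  have hP2 : P.comp (C 2 * X) - C 2 * P = 0 := Polynomial.eq_zero_of_eval_ne_zero fun z hz => by
    have := symb_one_add (isForm_of_mem hδ) hy h (u := z) hz
    rw [hP, hP] at this
    rw [eval_sub, eval_comp, eval_mul, eval_mul, eval_C, eval_X, two_mul z, this]
    ring
  have hc : ∀ k, k ≠ 1 → P.coeff k = 0 := by
    intro k hk
    have h1 := congrArg (fun p => coeff p k) hP2
    simp only [coeff_sub, comp_C_mul_X_coeff, coeff_C_mul, coeff_zero] at h1
    have h2 : ((2 : ℂ) ^ k - 2) ≠ 0 := by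
      intro h2
      have h3 : (2 : ℂ) ^ k = ((2 ^ k : ℕ) : ℂ) := by push_cast; rfl
      rw [sub_eq_zero, h3] at h2
      have h4 : 2 ^ k = 2 := by exact_mod_cast h2
      exact hk (Nat.pow_right_injective le_rfl (h4.trans (pow_one 2).symm))
    have h3 : P.coeff k * ((2 : ℂ) ^ k - 2) = 0 := by linear_combination h1
    exact (mul_eq_zero.1 h3).resolve_right h2
  refine ⟨P.coeff 1, fun z => ?_⟩
  have hPX : P = C (P.coeff 1) * X := by
    ext k
    rw [coeff_C_mul, coeff_X]
    split_ifs with h1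
    · rw [← h1, mul_one]
    · rw [hc k (Ne.symm h1), mul_zero]
  rw [hP, hPX]
  simp

/-- For z ≠ 0 write p = q·(X - z) + p(z): both parts are killed. The value is polynomial in z, so z
= 0 follows. -/
theorem symb_aeval_eq_zero (hδ : δ ∈ (triv 1).cochains 2) (hy : IsForm y)
    (h : (triv 1).d 2 δ = (triv 1).del 3 x + lowerD 3 y)
    (h1 : ∀ z, symb δ ![z, -z] 1 = 0)
    (h2 : symb δ ![0, 0] (MvPolynomial.X 0 - MvPolynomial.X 1) = 0) (p : ℂ[X]) (z : ℂ) :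
    symb δ ![z, -z] (Polynomial.aeval (MvPolynomial.X 0 - MvPolynomial.X 1) p) = 0 := by
  obtain ⟨P, hP⟩ := (isPolyFun_symb hδ
    (Polynomial.aeval (MvPolynomial.X 0 - MvPolynomial.X 1) p)).exists_eval
  have : P = 0 := Polynomial.eq_zero_of_eval_ne_zero fun z hz => by
    rw [← hP]
    obtain ⟨q, hq⟩ := X_sub_C_dvd_sub_C_eval (a := z) (p := p)
    have hp : p = q * (X - C z) + C (p.eval z) := by linear_combination hq
    have hC : ∀ c : ℂ, symb δ ![z, -z] (Polynomial.aeval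
        (MvPolynomial.X 0 - MvPolynomial.X 1 : MvPolynomial (Fin 2) ℂ) (C c)) = 0 := by
      intro c
      rw [aeval_C, Algebra.algebraMap_eq_smul_one, map_smul, h1, smul_zero]
    rw [hp, map_add, map_add, symb_aeval_mul_sub (isForm_of_mem hδ) hy h hz, h2, mul_zero, hC,
      add_zero]
  rw [hP, this, eval_zero]

theorem exists_eq_del_add_lowerD (hδ : δ ∈ (triv 1).cochains 2) (hy : IsForm y)
    (h : (triv 1).d 2 δ = (triv 1).del 3 x + lowerD 3 y)
    (h1 : ∀ z, symb δ ![z, -z] 1 = 0)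
    (h2 : symb δ ![0, 0] (MvPolynomial.X 0 - MvPolynomial.X 1) = 0) :
    ∃ δ₁ ∈ (triv 1).cochains 2, ∃ δ₂ ∈ (triv 1).cochains 2,
      δ = (triv 1).del 2 δ₁ + lowerD 2 δ₂ := by
  have hP : ∀ m n : ℕ, ∃ P : ℂ[X], ∀ z, δ ![J m 1, J n 1] ![z, -z] = P.eval z := fun m n =>
    (isPolyFun_of_mem hδ ![J m 1, J n 1]).exists_eval
  choose g hg using hP
  have hsymb : ∀ z F, symb δ ![z, -z] F =
      (monomialMap (fun m : Fin 2 →₀ ℕ => g (m 0) (m 1)) F).eval z := by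
    intro z F
    have : symb δ ![z, -z] = Polynomial.leval z ∘ₗ
        monomialMap (fun m : Fin 2 →₀ ℕ => g (m 0) (m 1)) := by
      refine linearMap_eq_of_monomial fun m => ?_
      rw [symb_monomial, LinearMap.comp_apply, monomialMap_monomial, one_mul, one_smul,
        fin_two_eta fun i => J (m i) 1, hg]
      rfl
    rw [this]
    rfl
  obtain ⟨ε, hε, hrel⟩ := exists_primitive (g := g) (fun m n t => by
    rw [← hg, ← hg, neg_neg]
    have := (isForm_of_mem hδ).skew ![J n 1, J m 1] ![t, -t] 0 1 rfl
    rwa [vec_comp_swap, vec_comp_swap] at this) (fun k => Polynomial.funext fun z => by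
      have := symb_aeval_eq_zero hδ hy h h1 h2 (X ^ k) z
      rw [map_pow, aeval_X] at this
      rw [← hsymb, this, eval_zero])
  let δ₂ : PreCochain 1 ℂ 2 := cochainTwo fun k l => ε k.1 l.1
  have h₂ : δ₂ ∈ (triv 1).cochains 2 := cochainTwo_mem fun k l t => hε _ _ _
  obtain ⟨δ₁, h₁, hδ₁⟩ := exists_del_eq (sub_mem hδ (lowerD_mem h₂)) fun a z hz =>
    (isForm_of_mem (sub_mem hδ (lowerD_mem h₂))).eq_zero_of_gen (fun k => by
      have hz' : z 1 = -(z 0) := by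
        rw [Fin.sum_univ_two] at hz
        linear_combination hz
      have hk : ∀ i, k i = ((k i).1, 0, 0) := fun i =>
        Prod.ext rfl (Prod.ext (Subsingleton.elim _ _) (Subsingleton.elim _ _))
      rw [fin_two_eta fun i => gen (k i), fin_two_eta z, hz', hk 0, hk 1]
      generalize z 0 = t
      generalize (k 0).1 = m
      generalize (k 1).1 = n
      have hf := isForm_of_mem h₂
      have hup₀ : ∀ a b x : gc 1, Function.update ![a, b] 0 x = ![x, b] := by
        intro a b x
        funext i
        fin_cases i <;> rfl
      have hup₁ : ∀ a b x : gc 1, Function.update ![a, b] 1 x = ![a, x] := by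
        intro a b x
        funext i
        fin_cases i <;> rfl
      have hl : ∀ (c : ℂ) (a b : gc 1), δ₂ ![c • a, b] ![t, -t] = c * δ₂ ![a, b] ![t, -t] := by
        intro c a b
        have := hf.csmul ![0, b] ![t, -t] 0 c a
        rwa [hup₀, hup₀] at this
      have hr : ∀ (c : ℂ) (a b : gc 1), δ₂ ![a, c • b] ![t, -t] = c * δ₂ ![a, b] ![t, -t] := by
        intro c a b
        have := hf.csmul ![a, 0] ![t, -t] 1 c b
        rwa [hup₁, hup₁] at this
      rw [Pi.sub_apply, Pi.sub_apply, ← J_one_eq_gen, ← J_one_eq_gen, hg, lowerD_two_apply, J_one_eq_gen, J_one_eq_gen, lower_gen,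
        lower_gen, hl, hr]
      simp only [δ₂]
      rw [cochainTwo_gen, cochainTwo_gen, ← hrel]
      simp) a
  exact ⟨δ₁, h₁, δ₂, h₂, by rw [hδ₁]; abel⟩

end

variable {α : PreCochain 1 ℂ 2} {e : PreCochain 1 ℂ 3}

/-- Only ∂α is given, so the value is found where λ₁ + λ₂ ≠ 0 and extended as a polynomial. Here Dψ
contributes (λ₁ - λ₂)/2 and dτ contributes λ₂, with sum (λ₁ + λ₂)/2. -/
theorem IsFundamental.apply_J_one_J_zero (he : IsFundamental α e) (z : Fin 2 → ℂ) :
    α ![J 1 1, J 0 1] z = 1 / 2 := by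
  have : α ![J 1 1, J 0 1] = fun _ => 1 / 2 := by
    refine (isPolyFun_of_mem he.mem_two _).eq_of_sum_ne_zero (IsPolyFun.const _) fun z hz => ?_
    have h := congrFun (congrFun he.del_two ![J 1 1, J 0 1]) z
    have h0 : psi 1 ![J 1 1, 0] z = 0 := (isForm_of_mem psi_mem).eq_zero_of_apply _ 1 rfl
    rw [Pi.add_apply, Pi.add_apply, triv_del_apply, lowerD_two_apply, lower_J', lower_J',
      fin_two_eta z, triv_d_one_apply, bracket_J, traceForm_genBracket, ← fin_two_eta z,
      Nat.cast_zero, zero_smul, h0, Nat.cast_one, one_smul, fin_two_eta z, psi_J,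
      ← fin_two_eta z] at h
    refine mul_left_cancel₀ hz ?_
    rw [h, Fin.sum_univ_two]
    simp
    ring
  rw [this]

theorem IsFundamental.symb_X_sub_X (he : IsFundamental α e) (z : ℂ) :
    symb α ![z, z] (MvPolynomial.X 0 - MvPolynomial.X 1) = 1 := by
  have := (isForm_of_mem he.mem_two).skew ![J 1 1, J 0 1] ![z, z] 0 1 rfl
  rw [vec_comp_swap, vec_comp_swap] at this
  rw [ConfModule.symb_X_sub_X, this, he.apply_J_one_J_zero]
  norm_num

/-- A `2`-cochain of `gc_1` whose differential is trivial modulo the images of `∂` and `lowerD` is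
a combination of the standard ones modulo these images. -/
theorem IsFundamental.exists_decomp (he : IsFundamental α e) {δ : PreCochain 1 ℂ 2}
    {x y : PreCochain 1 ℂ 3} (hδ : δ ∈ (triv 1).cochains 2) (hy : IsForm y)
    (h : (triv 1).d 2 δ = (triv 1).del 3 x + lowerD 3 y) :
    ∃ c₁ c₂ : ℂ, ∃ δ₁ ∈ (triv 1).cochains 2, ∃ δ₂ ∈ (triv 1).cochains 2,
      δ = c₁ • psi 1 + c₂ • α + (triv 1).del 2 δ₁ + lowerD 2 δ₂ := by
  set c₂ := symb δ ![0, 0] (MvPolynomial.X 0 - MvPolynomial.X 1) with hc₂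
  have hef := isForm_of_mem he.mem_three
  have hm₁ := sub_mem hδ (Submodule.smul_mem _ c₂ he.mem_two)
  have hd₁ : (triv 1).d 2 (δ - c₂ • α) = (triv 1).del 3 x + lowerD 3 (y - c₂ • e) := by
    rw [map_sub, map_sub, map_smul, map_smul, h, he.lowerD_three, add_sub_assoc]
  obtain ⟨c₁, hc₁⟩ := exists_symb_one_eq hm₁ (hy.sub (hef.const_smul c₂)) hd₁
  have hpsi : ∀ z, symb (psi 1) ![z, -z] 1 = z := by
    intro z
    rw [symb_one, psi_J]
    simp
  have hpsi' : symb (psi 1) ![0, 0] (MvPolynomial.X 0 - MvPolynomial.X 1) = 0 := by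
    rw [ConfModule.symb_X_sub_X, psi_J, psi_J]
    simp
  -- α is normalised by the value 1 on x - y at (0, 0), where ψ vanishes, and ψ has value λ on the
  -- constant 1. So c₂ is fixed first and c₁ then removes the linear term.
  obtain ⟨δ₁, h₁, δ₂, h₂, hdec⟩ := exists_eq_del_add_lowerD
    (δ := δ - c₂ • α - c₁ • psi 1) (x := x - c₁ • e) (y := y - c₂ • e)
    (sub_mem hm₁ (Submodule.smul_mem _ c₁ psi_mem)) (hy.sub (hef.const_smul c₂))
    (by rw [map_sub _ (δ - c₂ • α), hd₁, map_smul, ← he.del_three, map_sub _ x, map_smul]; abel)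
    (fun z => by rw [symb_sub, symb_smul, hc₁, hpsi, sub_self])
    (by rw [symb_sub, symb_sub, symb_smul, symb_smul, hpsi', he.symb_X_sub_X, ← hc₂]; ring)
  refine ⟨c₁, c₂, δ₁, h₁, δ₂, h₂, ?_⟩
  rw [add_assoc _ ((triv 1).del 2 δ₁), ← hdec]
  abel

end RankOne

end ConfModule

namespace ConfModule

/-! ### Basic 4-cocycles of gc_1 -/

section FourthCohomology

theorem contr_apply_of_skew {N q : ℕ} {γ : PreCochain N ℂ (q + 2)} (h : IsForm γ) (x y : gc N)
    (μ ν : ℂ) (a : Fin q → gc N) (z : Fin q → ℂ) :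
    contr y ν q (contr x μ (q + 1) γ) a z = -contr x μ q (contr y ν (q + 1) γ) a z :=
  h.skew.cons_cons y x a ν μ z

theorem contr_contr_self {N q : ℕ} {γ : PreCochain N ℂ (q + 2)} (h : IsForm γ) (x : gc N)
    (μ : ℂ) : contr x μ q (contr x μ (q + 1) γ) = 0 := by
  funext a z
  exact self_eq_neg.1 (contr_apply_of_skew h x x μ μ a z)

variable {α : PreCochain 1 ℂ 2} {e : PreCochain 1 ℂ 3}

/-- Basic `4`-cocycles of `gc_1` are coboundaries. -/
theorem IsFundamental.exists_d_eq_four (he : IsFundamental α e) {γ : PreCochain 1 ℂ 4}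
    (hγ : γ ∈ (triv 1).cochains 4) (h : (triv 1).d 4 γ = 0) :
    ∃ ε ∈ (triv 1).cochains 3, γ = (triv 1).d 3 ε := by
  have hf := isForm_of_mem hγ
  set η := contr (J 0 1) 0 3 γ with hη
  have hηm : η ∈ (triv 1).cochains 3 := contr_mem hγ _ _
  obtain ⟨θ, hθ, hθ'⟩ := he.exists_eq 0 (ε := 0) hηm (d_contr_J_zero hγ h) (zero_mem _) (by
    rw [hη, contr_contr_self hf, map_zero])
  -- This is the coefficient of e in η. It vanishes because η already is a contraction with J^0_I at
  -- λ = 0, so a second argument J^0_I at λ = 0 gives 0.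
  have hc : (contrDeriv (contr (J 1 1) 0 2 η) + 0) ![gen (0, 0, 0)] ![0] = 0 := by
    rw [add_zero]
    have : ∀ μ : ℂ, contr (J 0 1) μ 1 (contr (J 1 1) 0 2 η) ![gen (0, 0, 0)] ![0] = 0 := by
      intro μ
      have hz : contr (J 0 1) 0 2 η = 0 := by rw [hη, contr_contr_self hf]
      have h1 : (contr (J 0 1) μ 1 (contr (J 1 1) 0 2 η)) ![J 0 1] ![0] =
          contr (J 0 1) 0 0 (contr (J 0 1) μ 1 (contr (J 1 1) 0 2 η)) ![] ![] := rfl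
      have h2 : contr (J 0 1) 0 1 (contr (J 1 1) 0 2 η) = 0 := by
        funext a z
        rw [contr_apply_of_skew (isForm_of_mem hηm), hz]
        simp [contr]
      rw [← J_one_eq_gen, h1, contr_apply_of_skew (isForm_contr (isForm_of_mem hηm) _ _), h2]
      simp [contr]
    rw [contrDeriv]
    simp only [this, deriv_const]
  rw [hc, zero_smul, add_zero] at hθ'
  set β := contr (J 1 1) 0 3 γ with hβ
  have hβm : β ∈ (triv 1).cochains 3 := contr_mem hγ _ _
  have hδm : -contrDeriv β - θ ∈ (triv 1).cochains 2 := sub_mem (neg_mem (contrDeriv_mem hβm)) hθ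
  have hrel : (triv 1).d 2 (-contrDeriv β - θ) = (triv 1).del 3 (contrDeriv γ) + lowerD 3 β := by
    have h1 := lowerD_contr_J_one hγ h
    rw [← hη, ← hβ, hθ'] at h1
    rw [map_sub, map_neg, ← h1]
    abel
  obtain ⟨c₁, c₂, δ₁, h₁, δ₂, h₂, hdec⟩ := he.exists_decomp hδm (isForm_of_mem hβm) hrel
  have hx : -(c₂ • e) - (triv 1).d 2 δ₂ ∈ (triv 1).cochains 3 :=
    sub_mem (neg_mem (Submodule.smul_mem _ _ he.mem_three)) (d_mem h₂)
  -- As De = dα, the correction -c₂e absorbs c₂α; as dψ = ∂e, the term c₁ψ is already harmless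
  -- modulo ∂. The correction is closed, so w = 0.
  obtain ⟨ε, hε, hε'⟩ := exists_eq_d_sub (w := 0) (x := -(c₂ • e) - (triv 1).d 2 δ₂)
    (y := c₁ • e + (triv 1).d 2 δ₁ - contrDeriv γ) hγ (zero_mem _) hx h
    (by rw [map_sub, map_neg, map_smul, he.d_three, d_d 2 (isForm_of_mem h₂)]; simp) (by
      rw [hdec] at hrel
      rw [← hβ]
      simp only [map_add, map_sub, map_smul, map_neg] at hrel ⊢
      rw [lowerD_d h₂, del_d (isForm_of_mem h₁), he.lowerD_three, he.del_three]
      rw [← sub_eq_iff_eq_add'] at hrel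
      rw [← hrel]
      abel)
  exact ⟨ε, hε, by rw [hε', sub_zero]⟩

end FourthCohomology

/-! ### Dimensions; reduced cohomology through the connecting map -/

section Ranks

variable {V : Type*} [AddCommGroup V] [Module ℂ V]

theorem rank_quotient_eq_zero {B Z : Submodule ℂ V} (h : Z ≤ B) :
    Module.rank ℂ (Z ⧸ B.submoduleOf Z) = 0 := by
  have : Subsingleton (Z ⧸ B.submoduleOf Z) :=
    Submodule.Quotient.subsingleton_iff.2 (Submodule.submoduleOf_eq_top.2 h)
  exact rank_subsingleton' ℂ _

theorem span_mk_eq_top {B Z : Submodule ℂ V} (v : Z) (h : ∀ w ∈ Z, ∃ c : ℂ, w - c • (v : V) ∈ B) :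
    Submodule.span ℂ {(Submodule.Quotient.mk v : Z ⧸ B.submoduleOf Z)} = ⊤ := by
  refine eq_top_iff.2 fun x _ => ?_
  obtain ⟨w, rfl⟩ := Submodule.Quotient.mk_surjective _ x
  obtain ⟨c, hc⟩ := h w w.2
  refine Submodule.mem_span_singleton.2 ⟨c, ?_⟩
  rw [← Submodule.Quotient.mk_smul, eq_comm, Submodule.Quotient.eq]
  exact hc

theorem rank_quotient_eq_one {B Z : Submodule ℂ V} {v : V} (hv : v ∈ Z) (hvB : v ∉ B)
    (h : ∀ w ∈ Z, ∃ c : ℂ, w - c • v ∈ B) : Module.rank ℂ (Z ⧸ B.submoduleOf Z) = 1 := by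
  have hs := span_mk_eq_top (B := B) (⟨v, hv⟩ : Z) h
  rw [rank_eq_one_iff]
  refine ⟨Submodule.Quotient.mk ⟨v, hv⟩, fun h0 => hvB ?_, fun x => ?_⟩
  · rw [Submodule.Quotient.mk_eq_zero] at h0
    exact h0
  · exact Submodule.mem_span_singleton.1 (hs ▸ Submodule.mem_top)

variable {N : ℕ} {α : PreCochain N ℂ 2} {e : PreCochain N ℂ 3}

theorem mem_cochains_zero (γ : PreCochain N ℂ 0) : γ ∈ (triv N).cochains 0 := by
  refine mem_cochains_iff.2 ⟨⟨fun a z i => i.elim0, fun a z i => i.elim0, fun a z i => i.elim0⟩,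
    fun a => ?_⟩
  have : γ a = fun _ => γ a ![] := by
    funext z
    rw [Subsingleton.elim z ![]]
  rw [this]
  exact IsPolyFun.const _

theorem del_cochains_zero : (triv N).del 0 = 0 := by
  ext γ a z
  simp [triv_del_apply]

theorem exists_smul_eq_zero (γ : PreCochain N ℂ 0) : ∃ c : ℂ, γ = c • fun _ _ => 1 :=
  ⟨γ ![] ![], by
    funext a z
    rw [Subsingleton.elim a ![], Subsingleton.elim z ![]]
    simp⟩

theorem one_ne_zero_cochain : (fun _ _ => 1 : PreCochain N ℂ 0) ≠ 0 := fun h =>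
  one_ne_zero (congrFun (congrFun h ![]) ![])

variable (N) in
theorem rank_basicH_zero : Module.rank ℂ ((triv N).BasicH 0) = 1 := by
  refine rank_quotient_eq_one (v := fun _ _ => 1) ⟨mem_cochains_zero _, ?_⟩ one_ne_zero_cochain
    fun w _ => ?_
  · simp [triv_d_zero]
  · obtain ⟨c, hc⟩ := exists_smul_eq_zero w
    exact ⟨c, by rw [← hc, sub_self]; exact zero_mem _⟩

variable (N) in
theorem rank_basicH_one : Module.rank ℂ ((triv N).BasicH 1) = 0 :=
  rank_quotient_eq_zero fun γ hγ => by
    rw [eq_zero_of_d_one hγ.1 hγ.2]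
    exact zero_mem _

variable (N) in
theorem rank_basicH_two : Module.rank ℂ ((triv N).BasicH 2) = 0 :=
  rank_quotient_eq_zero fun γ hγ => by
    obtain ⟨ε, hε, h⟩ := exists_d_eq_two hγ.1 hγ.2
    exact ⟨ε, hε, h.symm⟩

theorem rank_basicH_three (hN : 1 ≤ N) : Module.rank ℂ ((triv N).BasicH 3) = 1 := by
  obtain ⟨α, e, he⟩ := exists_isFundamental N
  refine rank_quotient_eq_one (v := e) ⟨he.mem_three, he.d_three⟩ ?_ fun γ hγ => ?_
  · rintro ⟨ε, hε, h⟩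
    exact he.ne_d hN hε h.symm
  · obtain ⟨θ, hθ, c, h⟩ := he.exists_eq_add_smul ⟨0, hN⟩ hγ.1 hγ.2
    exact ⟨c, θ, hθ, by rw [h, add_sub_cancel_right]⟩

variable (N) in
theorem rank_redH_zero : Module.rank ℂ ((triv N).RedH 0) = 1 := by
  refine rank_quotient_eq_one (v := fun _ _ => 1) ⟨mem_cochains_zero _, ?_⟩ ?_ fun w _ => ?_
  · change (triv N).d 0 _ ∈ (triv N).delCochains 1
    rw [triv_d_zero]
    exact zero_mem _
  · rw [redB, basicB, delCochains, del_cochains_zero, Submodule.map_zero, sup_bot_eq]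
    exact one_ne_zero_cochain
  · obtain ⟨c, hc⟩ := exists_smul_eq_zero w
    exact ⟨c, by rw [← hc, sub_self]; exact zero_mem _⟩

theorem mem_redB {q : ℕ} {ε : PreCochain N ℂ q} {η : PreCochain N ℂ (q + 1)}
    (hε : ε ∈ (triv N).cochains q) (hη : η ∈ (triv N).cochains (q + 1)) :
    (triv N).d q ε + (triv N).del (q + 1) η ∈ (triv N).redB (q + 1) :=
  Submodule.add_mem_sup ⟨ε, hε, rfl⟩ ⟨η, hη, rfl⟩

theorem exists_of_mem_redB {q : ℕ} {γ : PreCochain N ℂ (q + 1)}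
    (h : γ ∈ (triv N).redB (q + 1)) : ∃ ε ∈ (triv N).cochains q,
      ∃ η ∈ (triv N).cochains (q + 1), γ = (triv N).d q ε + (triv N).del (q + 1) η := by
  obtain ⟨_, ⟨ε, hε, rfl⟩, _, ⟨η, hη, rfl⟩, rfl⟩ := Submodule.mem_sup.1 h
  exact ⟨ε, hε, η, hη, rfl⟩

/-- The connecting map: the differential of a reduced cocycle is `∂` of a basic cocycle. -/
theorem exists_cocycle_of_mem_redZ {q : ℕ} {γ : PreCochain N ℂ q} (h : γ ∈ (triv N).redZ q) :
    ∃ δ ∈ (triv N).cochains (q + 1), (triv N).d (q + 1) δ = 0 ∧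
      (triv N).d q γ = (triv N).del (q + 1) δ := by
  obtain ⟨hγ, δ, hδ, h⟩ := h
  refine ⟨δ, hδ, eq_zero_of_del_eq_zero (d_mem hδ) ?_, h.symm⟩
  rw [del_d (isForm_of_mem hδ), h, d_d q (isForm_of_mem hγ)]

variable (N) in
theorem rank_redH_one : Module.rank ℂ ((triv N).RedH 1) = 0 :=
  rank_quotient_eq_zero fun γ hγ => by
    obtain ⟨δ, hδ, hd, h⟩ := exists_cocycle_of_mem_redZ hγ
    obtain ⟨ε, hε, rfl⟩ := exists_d_eq_two hδ hd
    rw [del_d (isForm_of_mem hε), ← sub_eq_zero, ← map_sub ((triv _).d _)] at h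
    have := sub_eq_zero.1 (eq_zero_of_d_one (sub_mem hγ.1 (del_mem hε)) h)
    rw [this]
    simpa using mem_redB (mem_cochains_zero 0) hε

variable (N) in
theorem psi_mem_redZ : psi N ∈ (triv N).redZ 2 := by
  obtain ⟨α, e, he⟩ := exists_isFundamental N
  exact ⟨psi_mem, e, he.mem_three, he.del_three⟩

/-- Here dγ = ∂(dθ + ce) and ce is the image of cψ. So γ - cψ - ∂θ is a basic 2-cocycle, hence
exact. -/
theorem exists_sub_smul_psi_mem (hN : 1 ≤ N) {γ : PreCochain N ℂ 2} (hγ : γ ∈ (triv N).redZ 2) :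
    ∃ c : ℂ, γ - c • psi N ∈ (triv N).redB 2 := by
  obtain ⟨α, e, he⟩ := exists_isFundamental N
  obtain ⟨δ, hδ, hd, h⟩ := exists_cocycle_of_mem_redZ hγ
  obtain ⟨θ, hθ, c, rfl⟩ := he.exists_eq_add_smul ⟨0, hN⟩ hδ hd
  obtain ⟨ε, hε, h'⟩ := exists_d_eq_two
    (sub_mem (sub_mem hγ.1 (Submodule.smul_mem _ c psi_mem)) (del_mem hθ)) (by
      rw [map_sub, map_sub, map_smul, h, ← del_d (isForm_of_mem hθ), ← he.del_three, map_add,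
        map_smul]
      abel)
  exact ⟨c, by rw [sub_eq_iff_eq_add.1 h']; exact mem_redB hε hθ⟩

theorem psi_notMem_redB (hN : 1 ≤ N) : psi N ∉ (triv N).redB 2 := by
  intro h
  obtain ⟨α, e, he⟩ := exists_isFundamental N
  obtain ⟨ε, hε, η, hη, h⟩ := exists_of_mem_redB h
  refine he.ne_d hN hη (eq_of_del_eq he.mem_three (d_mem hη) ?_)
  rw [he.del_three, h, map_add, d_d 1 (isForm_of_mem hε), zero_add, del_d (isForm_of_mem hη)]

theorem rank_redH_two (hN : 1 ≤ N) : Module.rank ℂ ((triv N).RedH 2) = 1 :=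
  rank_quotient_eq_one (psi_mem_redZ N) (psi_notMem_redB hN) fun _ hγ =>
    exists_sub_smul_psi_mem hN hγ

theorem rank_redH_three : Module.rank ℂ ((triv 1).RedH 3) = 1 := by
  obtain ⟨α, e, he⟩ := exists_isFundamental 1
  refine rank_quotient_eq_one (v := e) ⟨he.mem_three, ?_⟩ (fun h => ?_) fun γ hγ => ?_
  · change (triv 1).d 3 e ∈ (triv 1).delCochains 4
    rw [he.d_three]
    exact zero_mem _
  · obtain ⟨ε, hε, η, hη, h⟩ := exists_of_mem_redB h
    -- If e = dε + ∂η, then η is closed, hence dθ + ce. So ∂η = d(∂θ + cψ), and e would be exact.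
    have hdη : (triv 1).d 3 η = 0 := by
      refine eq_zero_of_del_eq_zero (d_mem hη) ?_
      have := he.d_three
      rwa [h, map_add, d_d 2 (isForm_of_mem hε), zero_add, ← del_d (isForm_of_mem hη)] at this
    obtain ⟨θ, hθ, c, rfl⟩ := he.exists_eq_add_smul 0 hη hdη
    refine he.ne_d le_rfl (add_mem (add_mem hε (del_mem hθ)) (Submodule.smul_mem _ c psi_mem)) ?_
    rw [map_add, map_add, ← del_d (isForm_of_mem hθ), map_smul, ← he.del_three, add_assoc,
      ← map_smul, ← map_add]
    exact h
  · obtain ⟨δ, hδ, hd, h⟩ := exists_cocycle_of_mem_redZ hγ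
    -- Since dγ = ∂dε, the cochain γ - ∂ε is a basic 3-cocycle, to which the classification in
    -- degree 3 applies.
    obtain ⟨ε, hε, rfl⟩ := he.exists_d_eq_four hδ hd
    rw [del_d (isForm_of_mem hε), ← sub_eq_zero, ← map_sub ((triv _).d _)] at h
    obtain ⟨θ, hθ, c, h'⟩ := he.exists_eq_add_smul 0 (sub_mem hγ.1 (del_mem hε)) h
    refine ⟨c, ?_⟩
    have : γ - c • e = (triv 1).d 2 θ + (triv 1).del 3 ε := by
      rw [sub_eq_iff_eq_add.1 h']
      abel
    rw [this]
    exact mem_redB hθ hε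

end Ranks

end ConfModule

end ConfCoh

end

theorem theorem2p5 :
    -- (1) `gc_1` with trivial coefficients, for `q ≤ 3`
    ((Module.rank ℂ ((ConfCoh.scalarModule 1 0).BasicH 0) = 1 ∧
      Module.rank ℂ ((ConfCoh.scalarModule 1 0).BasicH 1) = 0 ∧
      Module.rank ℂ ((ConfCoh.scalarModule 1 0).BasicH 2) = 0 ∧
      Module.rank ℂ ((ConfCoh.scalarModule 1 0).BasicH 3) = 1) ∧
     (Module.rank ℂ ((ConfCoh.scalarModule 1 0).RedH 0) = 1 ∧
      Module.rank ℂ ((ConfCoh.scalarModule 1 0).RedH 1) = 0 ∧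
      Module.rank ℂ ((ConfCoh.scalarModule 1 0).RedH 2) = 1 ∧
      Module.rank ℂ ((ConfCoh.scalarModule 1 0).RedH 3) = 1)) ∧
    -- (2) `gc_N` with trivial coefficients, for `q ≤ 2`
    (∀ N : ℕ, 1 ≤ N →
      (Module.rank ℂ ((ConfCoh.scalarModule N 0).BasicH 0) = 1 ∧
       Module.rank ℂ ((ConfCoh.scalarModule N 0).BasicH 1) = 0 ∧
       Module.rank ℂ ((ConfCoh.scalarModule N 0).BasicH 2) = 0) ∧
      (Module.rank ℂ ((ConfCoh.scalarModule N 0).RedH 0) = 1 ∧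
       Module.rank ℂ ((ConfCoh.scalarModule N 0).RedH 1) = 0 ∧
       Module.rank ℂ ((ConfCoh.scalarModule N 0).RedH 2) = 1) ∧
      -- the reduced cocycle that spans `H^2`, through a basic cochain `ψ` that represents it
      ∃ ψ : (ConfCoh.scalarModule N 0).redZ 2,
        (∀ (m n : ℕ) (A B : Matrix (Fin N) (Fin N) ℂ) (z : ℂ),
          (ψ : ConfCoh.PreCochain N ℂ 2) ![ConfCoh.J m A, ConfCoh.J n B] ![z, -z] =
            (-1) ^ n * ((m.factorial : ℂ) * (n.factorial : ℂ) / ((m + n + 1).factorial : ℂ)) *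
              (A * B).trace * z ^ (m + n + 1)) ∧
        Submodule.span ℂ {(Submodule.Quotient.mk ψ : (ConfCoh.scalarModule N 0).RedH 2)} = ⊤) ∧
    -- (3) the modules `ℂ_a` with `a ≠ 0`
    (∀ N : ℕ, 1 ≤ N → ∀ a : ℂ, a ≠ 0 → ∀ q : ℕ,
      Subsingleton ((ConfCoh.scalarModule N a).RedH q)) ∧
    -- (4) the modules `ℂ^N_α[∂]`, and more generally
    (∀ N : ℕ, 1 ≤ N → ∀ (α : ℂ) (q : ℕ), Subsingleton ((ConfCoh.natModule N α).RedH q)) ∧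
    (∀ N : ℕ, 1 ≤ N → ∀ (M : Type*) [AddCommGroup M] [Module ℂ M] (ρ : ConfCoh.ConfModule N M),
      Module.Free ℂ[X] (Module.AEval' ρ.D) →
      (∃ c : ℂ, c ≠ 0 ∧ ∀ v : M, ρ.act 0 (ConfCoh.J 0 (1 : Matrix (Fin N) (Fin N) ℂ)) v = c • v) →
      ∀ q : ℕ, Subsingleton (ρ.RedH q)) := by
  open ConfCoh ConfCoh.ConfModule in
  refine ⟨⟨⟨rank_basicH_zero 1, rank_basicH_one 1, rank_basicH_two 1, rank_basicH_three le_rfl⟩,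
    rank_redH_zero 1, rank_redH_one 1, rank_redH_two le_rfl, rank_redH_three⟩, fun N hN =>
    ⟨⟨rank_basicH_zero N, rank_basicH_one N, rank_basicH_two N⟩,
      ⟨rank_redH_zero N, rank_redH_one N, rank_redH_two hN⟩,
      ⟨psi N, psi_mem_redZ N⟩, fun m n A B z => ?_,
      span_mk_eq_top _ fun γ hγ => exists_sub_smul_psi_mem hN hγ⟩,
    fun N _ a ha q => subsingleton_redH_scalarModule ha q,
    fun N _ α q => subsingleton_redH_of_act_J_zero one_ne_zero (natModule_act_J_zero α) q,
    fun N _ M _ _ ρ _ ⟨c, hc, h⟩ q => subsingleton_redH_of_act_J_zero hc h q⟩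
  change ConfCoh.ConfModule.psi N ![ConfCoh.J m A, ConfCoh.J n B] ![z, -z] = _
  rw [ConfCoh.ConfModule.psi_J, show (z - -z) / 2 = z by ring]
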